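/- Let $N\ge 1$, $1<p<\infty$, let $\Omega\subset\mathbb R^N$ be a bounded open set (in particular, $\Omega$ may be a bounded domain with Lipschitz boundary), and let $\mu^+$ be a finite nonnegative Borel measure on $[0,1]$ such that $\mu^+([\bar s,1])>0$ for some $\bar s\in(0,1]$. For measurable $u:\mathbb R^N\to\mathbb R$ set $[u]_{0,p}=\|u\|_{L^p(\mathbb R^N)}$, $[u]_{1,p}=\|\nabla u\|_{L^p(\mathbb R^N)}$ (weak gradient; $+\infty$ if there is none) and, for $0<s<1$, $$[u]_{s,p}^p=c_{N,s,p}\iint_{\mathbb R^{2N}}\frac{|u(x)-u(y)|^p}{|x-y|^{N+sp}}\,dx\,dy,\qquad c_{N,s,p}=\frac{\frac{sp}{2}(1-s)2^{2s-1}}{\pi^{\frac{N-1}{2}}}\,\frac{\Gamma(\frac{N+ps}{2})}{\Gamma(\frac{p+1}{2})\,\Gamma(2-s)}.$$ Let $X_p(\Omega)$ be the space of measurable $u$ (modulo a.e. equality) with $u=0$ a.e. in $\mathbb R^N\setminus\Omega$ and $\|u\|_{X_p(\Omega)}:=\left(\int_{[0,1]}[u]_{s,p}^p\,d\mu^+(s)\right)^{1/p}<\infty$,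 and let $\mathcal M=\{u\in X_p(\Omega):\|u\|_{L^p(\Omega)}=1\}$ with the topology of $\|\cdot\|_{X_p(\Omega)}$. Define $$\lambda_{1,\mu^+}(\Omega)=\inf_{u\in X_p(\Omega)\setminus\{0\}}\frac{\|u\|_{X_p(\Omega)}^p}{\int_\Omega|u|^p\,dx},\qquad \lambda_{2,\mu^+}(\Omega)=\inf_{\phi\in\Gamma_1(\Omega)}\ \max_{u\in\phi(\mathbb S^1)}\|u\|^p_{X_p(\Omega)},$$ where $\Gamma_1(\Omega)$ is the set of odd continuous maps $\phi:\mathbb S^1\to\mathcal M$. Let $e_{1,\mu^+}\in\mathcal M$ be a first eigenfunction of $\mathcal L^+_{\mu,p}=\int_{[0,1]}(-\Delta)^s_p\,d\mu^+(s)$, i.e. a weak solution $u=e_{1,\mu^+}$ of $\mathcal L^+_{\mu,p}u=\lambda_{1,\mu^+}(\Omega)|u|^{p-2}u$ in $\Omega$, $u=0$ in $\mathbb R^N\setminus\Omega$: for all $v\in X_p(\Omega)$, $$\int_{(0,1)}c_{N,s,p}\iint_{\mathbb R^{2N}}\frac{|u(x)-u(y)|^{p-2}(u(x)-u(y))(v(x)-v(y))}{|x-y|^{N+sp}}\,dx\,dy\,d\mu^+(s)+\mu^+(\{0\})\int|u|^{p-2}uv\,dx+\mu^+(\{1\})\int|\nabla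 u|^{p-2}\nabla u\cdot\nabla v\,dx=\lambda_{1,\mu^+}(\Omega)\int_\Omega|u|^{p-2}uv\,dx .$$ Then $\lambda_{2,\mu^+}(\Omega)<\infty$ and $$\lambda_{2,\mu^+}(\Omega)=\inf_{\phi\in\Gamma_1(e_{1,\mu^+},-e_{1,\mu^+})}\ \max_{u\in\operatorname{Im}(\phi)}\|u\|^p_{X_p(\Omega)},$$ where $\Gamma_1(e_{1,\mu^+},-e_{1,\mu^+})=\{\phi\in C([-1,1],\mathcal M):\phi(-1)=-e_{1,\mu^+},\ \phi(1)=e_{1,\mu^+}\}$, and the maximum along each such path is attained. -/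

import Mathlib

open MeasureTheory Filter Topology Set
open scoped ENNReal

noncomputable section

namespace Superposition

/-- Euclidean space `ℝ^N`. -/
abbrev E (N : ℕ) : Type := EuclideanSpace ℝ (Fin N)

/-- Lebesgue measurable real functions on `ℝ^N`, modulo equality almost everywhere. -/
abbrev Fun (N : ℕ) : Type := E N →ₘ[(volume : Measure (E N))] ℝ

/-- `g` is a weak (distributional) gradient of `u` on `ℝ^N`. -/
def IsWeakGradient {N : ℕ} (u : E N → ℝ) (g : E N → E N) : Prop :=
  LocallyIntegrable u ∧ LocallyIntegrable g ∧
    ∀ φ : E N → ℝ, ContDiff ℝ ((⊤ : ℕ∞) : WithTop ℕ∞) φ → HasCompactSupport φ → ∀ w : E N,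
      ∫ x, u x * fderiv ℝ φ x w = -∫ x, inner ℝ (g x) w * φ x

open Classical in
/-- The weak gradient `∇u` (unique up to null sets); `0` when there is none. -/
def weakGrad {N : ℕ} (u : E N → ℝ) : E N → E N :=
  if h : ∃ g, IsWeakGradient u g then h.choose else 0

/-- The normalizing constant `c_{N,s,p}`. -/
def normConst (N : ℕ) (s p : ℝ) : ℝ :=
  (s * p / 2 * (1 - s) * 2 ^ (2 * s - 1)) / Real.pi ^ (((N : ℝ) - 1) / 2) *
    (Real.Gamma (((N : ℝ) + p * s) / 2) / (Real.Gamma ((p + 1) / 2) * Real.Gamma (2 - s)))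

open Classical in
/-- The `p`-th power `[u]_{s,p}^p` of the Gagliardo seminorm of order `s ∈ [0,1]`, in `[0,∞]`:
`‖u‖_{L^p(ℝ^N)}^p` for `s = 0`, `‖∇u‖_{L^p(ℝ^N)}^p` for `s = 1` (and `∞` if `u` has no weak
gradient), the normalized double integral for `0 < s < 1`. -/
def seminormPow {N : ℕ} (p : ℝ) (s : unitInterval) (u : E N → ℝ) : ℝ≥0∞ :=
  if s = 0 then ∫⁻ x, ENNReal.ofReal (|u x| ^ p)
  else if s = 1 then
    if ∃ g, IsWeakGradient u g then ∫⁻ x, ENNReal.ofReal (‖weakGrad u x‖ ^ p) else ⊤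
  else ENNReal.ofReal (normConst N s p) *
    ∫⁻ z : E N × E N,
      ENNReal.ofReal (|u z.1 - u z.2| ^ p / ‖z.1 - z.2‖ ^ ((N : ℝ) + s * p))

/-- `‖u‖_{X_p} = (∫_{[0,1]} [u]_{s,p}^p dμ(s))^{1/p}`, in `[0,∞]`. -/
def xNorm {N : ℕ} (p : ℝ) (μ : Measure unitInterval) (u : Fun N) : ℝ≥0∞ :=
  (∫⁻ s, seminormPow p s u ∂μ) ^ (1 / p)

/-- The space `X_p(Ω)`. -/
def X {N : ℕ} (p : ℝ) (μ : Measure unitInterval) (Ω : Set (E N)) : Set (Fun N) :=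
  {u | (∀ᵐ x, x ∉ Ω → u x = 0) ∧ xNorm p μ u < ⊤}

/-- The constraint set `𝓜 = {u ∈ X_p(Ω) : ‖u‖_{L^p(Ω)} = 1}`. -/
def M {N : ℕ} (p : ℝ) (μ : Measure unitInterval) (Ω : Set (E N)) : Set (Fun N) :=
  {u | u ∈ X p μ Ω ∧ eLpNorm u (ENNReal.ofReal p) (volume.restrict Ω) = 1}

/-- The pairing `⟨𝔏_p'(u), v⟩` of the operator `∫_{[0,1]} (-Δ)_p^s dμ(s)`, with the contributions
of the orders `0` and `1` written separately. -/
def pairing {N : ℕ} (p : ℝ) (μ : Measure unitInterval) (u v : Fun N) : ℝ :=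
  (∫ s in Ioo (0 : unitInterval) 1, normConst N s p *
      (∫ z : E N × E N, |u z.1 - u z.2| ^ (p - 2) * (u z.1 - u z.2) * (v z.1 - v z.2) /
        ‖z.1 - z.2‖ ^ ((N : ℝ) + s * p)) ∂μ)
    + μ.real {0} * (∫ x, |u x| ^ (p - 2) * u x * v x)
    + μ.real {1} * (∫ x, ‖weakGrad u x‖ ^ (p - 2) * inner ℝ (weakGrad u x) (weakGrad v x))

/-- `u` is an eigenfunction for the eigenvalue `lam`: a nontrivial weak solution of
`∫_{[0,1]} (-Δ)_p^s u dμ(s) = lam |u|^{p-2} u` in `Ω`, `u = 0` in `ℝ^N ∖ Ω`. -/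
def IsEigenfunction {N : ℕ} (p : ℝ) (μ : Measure unitInterval) (Ω : Set (E N)) (lam : ℝ)
    (u : Fun N) : Prop :=
  u ∈ X p μ Ω ∧ u ≠ 0 ∧
    ∀ v ∈ X p μ Ω, pairing p μ u v = lam * ∫ x in Ω, |u x| ^ (p - 2) * u x * v x

/-- The first eigenvalue: the infimum of the Rayleigh quotient. -/
def lambda1 {N : ℕ} (p : ℝ) (μ : Measure unitInterval) (Ω : Set (E N)) : ℝ≥0∞ :=
  ⨅ u ∈ X p μ Ω \ {0}, xNorm p μ u ^ p / ∫⁻ x in Ω, ENNReal.ofReal (|u x| ^ p)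

/-- `e` is an `L^p`-normalized first eigenfunction. -/
def IsFirstEigenfunction {N : ℕ} (p : ℝ) (μ : Measure unitInterval) (Ω : Set (E N))
    (e : Fun N) : Prop :=
  e ∈ M p μ Ω ∧ IsEigenfunction p μ Ω (lambda1 p μ Ω).toReal e

/-- The elements of `C(T, 𝓜)`, where `𝓜` carries the topology of the norm of `X_p(Ω)`. -/
def IsContinuousInto {N : ℕ} {T : Type*} [TopologicalSpace T] (p : ℝ) (μ : Measure unitInterval)
    (Ω : Set (E N)) (φ : T → Fun N) : Prop :=
  (∀ t, φ t ∈ M p μ Ω) ∧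
    ∀ t₀, Tendsto (fun t => xNorm p μ (φ t - φ t₀)) (𝓝 t₀) (𝓝 0)

/-- The unit circle `𝕊¹`. -/
abbrev S1 : Type := Metric.sphere (0 : EuclideanSpace ℝ (Fin 2)) 1

/-- Odd continuous maps `𝕊¹ → 𝓜`. -/
def oddLoops {N : ℕ} (p : ℝ) (μ : Measure unitInterval) (Ω : Set (E N)) : Set (S1 → Fun N) :=
  {φ | IsContinuousInto p μ Ω φ ∧ ∀ ω, φ (-ω) = -φ ω}

/-- The second eigenvalue `λ₂`: the minimax value over odd continuous maps `𝕊¹ → 𝓜`. -/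
def lambda2 {N : ℕ} (p : ℝ) (μ : Measure unitInterval) (Ω : Set (E N)) : ℝ≥0∞ :=
  ⨅ φ ∈ oddLoops p μ Ω, ⨆ ω, xNorm p μ (φ ω) ^ p

/-- Continuous paths `[-1,1] → 𝓜` from `-e` to `e`. -/
def paths {N : ℕ} (p : ℝ) (μ : Measure unitInterval) (Ω : Set (E N)) (e : Fun N) :
    Set (Icc (-1 : ℝ) 1 → Fun N) :=
  {φ | IsContinuousInto p μ Ω φ ∧
    φ ⟨-1, by norm_num⟩ = -e ∧ φ ⟨1, by norm_num⟩ = e}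

end Superposition

end

noncomputable section

set_option linter.unusedSectionVars false

namespace Superposition

/-! ### Powers of `L^p` norms as lower integrals -/

section Lintegral

variable {α : Type*} [MeasurableSpace α]

/-! A path from `-e` to `e` closes up to an odd loop by reflection (`lambda2_le_of_path`), which
gives one inequality. Conversely, if an odd loop has all norms below `L`, one of its arcs joins some
`u` to `-u` inside the set of normalized functions of norm at most `L` (`sublevel`). The point is
that `-e` and `e` are then joined inside the same set (`joinedIn_neg_of_joinedIn_neg`). No
deformation flow, Palais-Smale condition, regularity theory or maximum principle is used; three
facts suffice.

Compactness. A bounded sequence in the constraint set subconverges in `L^p`, and the norm is lower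
semicontinuous for this convergence (`exists_subseq_limit`). Two normalized functions that are close
in `L^p` are joined by a normalized segment at little cost in energy (`joinedIn_segment`). Hence the
norm attains its minimum over the part of a path component that matters (`exists_min_joinedIn`).

Hidden concavity. The energy of `α u⁺ - β u⁻` is concave as a function of `(α^p, β^p)`
(`W.norm_signComb_concave`), while its `L^p` norm to the power `p` is linear in these variables. So
along the normalized curve of such combinations the energy is concave. If `u` is a minimizer over
its component and changes sign, it is an interior local minimum of this curve, so the whole curve
lies below it. It leads to a nonnegative function (`exists_nonneg_joinedIn`).

Submodularity. Passing from two functions to their maximum and minimum does not increase the sum of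
the energies (`W.norm_sup_add_norm_inf_le`). Therefore a nonnegative function is joined to a
nonnegative global minimizer through normalized maxima, below its own energy
(`joinedIn_nonneg_minimizer`).

The component of `u` is symmetric because it contains `-u`, so signs are harmless: it contains a
nonnegative function, then a nonnegative global minimizer, then one of `e` and `-e`, hence both. The
eigenfunction equation enters only through the test function `e` itself, which shows that `e` is a
global minimizer (`IsFirstEigenfunction.norm_le`).

Finiteness of `λ₂` requires two independent elements of the space. Smooth bumps qualify: the `L^p`
increments of a bump are dominated by those of any normalized function supported in `Ω`, here `e`,
so its fractional energy is finite without estimating the kernel (`energy_lt_top_of_contDiff`). -/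

theorem eLpNorm_ofReal_eq {F : Type*} [NormedAddCommGroup F] {p : ℝ} (hp : 0 < p) (f : α → F)
    (ν : Measure α) :
    eLpNorm f (ENNReal.ofReal p) ν = (∫⁻ x, ‖f x‖ₑ ^ p ∂ν) ^ (1 / p) := by
  rw [eLpNorm_eq_lintegral_rpow_enorm_toReal (by simpa using hp) ENNReal.ofReal_ne_top,
    ENNReal.toReal_ofReal hp.le]

theorem eLpNorm_ofReal_rpow {F : Type*} [NormedAddCommGroup F] {p : ℝ} (hp : 0 < p) (f : α → F)
    (ν : Measure α) :
    eLpNorm f (ENNReal.ofReal p) ν ^ p = ∫⁻ x, ‖f x‖ₑ ^ p ∂ν := by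
  rw [eLpNorm_ofReal_eq hp, ← ENNReal.rpow_mul, one_div_mul_cancel hp.ne', ENNReal.rpow_one]

theorem lintegral_rpow_ne_top_of_memLp {F : Type*} [NormedAddCommGroup F] {p : ℝ} (hp : 0 < p)
    {f : α → F} {ν : Measure α} (hf : MemLp f (ENNReal.ofReal p) ν) :
    ∫⁻ x, ‖f x‖ₑ ^ p ∂ν ≠ ⊤ := by
  rw [← eLpNorm_ofReal_rpow hp]
  exact ENNReal.rpow_ne_top_of_nonneg hp.le hf.2.ne

theorem memLp_of_lintegral_rpow_ne_top {F : Type*} [NormedAddCommGroup F] {p : ℝ} (hp : 0 < p)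
    {f : α → F} {ν : Measure α} (hfm : AEStronglyMeasurable f ν)
    (hf : ∫⁻ x, ‖f x‖ₑ ^ p ∂ν ≠ ⊤) : MemLp f (ENNReal.ofReal p) ν := by
  refine ⟨hfm, ?_⟩
  rw [eLpNorm_ofReal_eq hp]
  exact ENNReal.rpow_lt_top_of_nonneg (by positivity) hf

/-- Jensen's inequality, obtained from Hölder's inequality against the constant `1`. -/
theorem rpow_lintegral_le_lintegral_rpow {p : ℝ} (hp : 1 < p) (P : Measure α)
    [IsProbabilityMeasure P] {f : α → ℝ≥0∞} (hf : AEMeasurable f P) :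
    (∫⁻ x, f x ∂P) ^ p ≤ ∫⁻ x, f x ^ p ∂P := by
  have hpq := Real.HolderConjugate.conjExponent hp
  have h := ENNReal.lintegral_mul_le_Lp_mul_Lq P hpq hf (g := fun _ => 1) aemeasurable_const
  simp only [Pi.mul_apply, mul_one, ENNReal.one_rpow, lintegral_const, measure_univ] at h
  calc (∫⁻ x, f x ∂P) ^ p ≤ ((∫⁻ x, f x ^ p ∂P) ^ (1 / p)) ^ p := by gcongr
    _ = _ := by
      rw [← ENNReal.rpow_mul, one_div_mul_cancel (by positivity), ENNReal.rpow_one]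

theorem tendsto_eLpNorm_iff {ι : Type*} {l : Filter ι} {F : Type*} [NormedAddCommGroup F] {p : ℝ}
    (hp : 0 < p) (f : ι → α → F) (ν : Measure α) :
    Tendsto (fun i => eLpNorm (f i) (ENNReal.ofReal p) ν) l (𝓝 0) ↔
      Tendsto (fun i => ∫⁻ x, ‖f i x‖ₑ ^ p ∂ν) l (𝓝 0) := by
  constructor
  · intro h
    have := (ENNReal.continuous_rpow_const (y := p)).tendsto 0 |>.comp h
    simpa [Function.comp_def, eLpNorm_ofReal_rpow hp, ENNReal.zero_rpow_of_pos hp] using this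
  · intro h
    have := (ENNReal.continuous_rpow_const (y := 1 / p)).tendsto 0 |>.comp h
    simpa [Function.comp_def, ← eLpNorm_ofReal_eq hp, ENNReal.zero_rpow_of_pos (inv_pos.2 hp),
      eLpNorm_ofReal_eq hp] using this

end Lintegral

/-! ### Continuity of translations in `L^p` -/

section Translation

variable {V : Type*} [NormedAddCommGroup V] [NormedSpace ℝ V] [FiniteDimensional ℝ V]
  [MeasurableSpace V] [BorelSpace V] {ν : Measure V} [ν.IsAddHaarMeasure]

/-- Translations act continuously on `L^p`. -/
theorem tendsto_eLpNorm_translate_sub {F : Type*} [NormedAddCommGroup F] {q : ℝ≥0∞}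
    [Fact (1 ≤ q)] (hq : q ≠ ⊤) {f : V → F} (hf : MemLp f q ν) :
    Tendsto (fun h : V => eLpNorm (fun x => f (x + h) - f x) q ν) (𝓝 0) (𝓝 0) := by
  have : Fact (q ≠ ⊤) := ⟨hq⟩
  have hmp : ∀ h : V, MeasurePreserving (fun x : V => x + h) ν ν :=
    fun h => measurePreserving_add_right ν h
  let c : V → C(V, V) := fun h => ⟨fun x => x + h, by fun_prop⟩
  have hc : Continuous c :=
    (ContinuousMap.mk (fun a : V × V => a.2 + a.1) (by fun_prop)).curry.continuous
  have h1 := (tendsto_const_nhds (x := hf.toLp f) (f := 𝓝 (0 : V))).compMeasurePreservingLp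
    (hc.tendsto 0) (fun h => hmp h) (hmp 0) hq
  have h2 := tendsto_iff_edist_tendsto_0.1 h1
  refine h2.congr fun h => ?_
  rw [Lp.edist_def]
  refine eLpNorm_congr_ae ?_
  have e1 := Lp.coeFn_compMeasurePreserving (hf.toLp f) (hmp h)
  have e2 := Lp.coeFn_compMeasurePreserving (hf.toLp f) (hmp 0)
  have e3 := (hmp h).quasiMeasurePreserving.ae_eq_comp hf.coeFn_toLp
  have e4 := (hmp 0).quasiMeasurePreserving.ae_eq_comp hf.coeFn_toLp
  filter_upwards [e1, e2, e3, e4] with x a1 a2 a3 a4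
  simp only [Function.comp_apply] at a1 a2 a3 a4
  simp only [Pi.sub_apply]
  change (Lp.compMeasurePreserving _ (hmp h) (hf.toLp f)) x -
    (Lp.compMeasurePreserving _ (hmp 0) (hf.toLp f)) x = _
  rw [a1, a2, a3, a4, add_zero]

theorem tendsto_lintegral_translate_sub {F : Type*} [NormedAddCommGroup F] {p : ℝ} (hp : 1 < p)
    {f : V → F} (hf : MemLp f (ENNReal.ofReal p) ν) :
    Tendsto (fun h : V => ∫⁻ x, ‖f (x + h) - f x‖ₑ ^ p ∂ν) (𝓝 0) (𝓝 0) := by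
  have : Fact (1 ≤ ENNReal.ofReal p) := ⟨by simpa using hp.le⟩
  exact (tendsto_eLpNorm_iff (by linarith) _ _).1
    (tendsto_eLpNorm_translate_sub ENNReal.ofReal_ne_top hf)

end Translation

/-! ### Weak directional derivatives and averages over segments -/

section WeakDeriv

variable {N : ℕ}

/-- `γ` is a weak derivative of `u` in the direction `w`. -/
def IsWeakDeriv (u : E N → ℝ) (w : E N) (γ : E N → ℝ) : Prop :=
  ∀ φ : E N → ℝ, ContDiff ℝ ((⊤ : ℕ∞) : WithTop ℕ∞) φ → HasCompactSupport φ →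
    ∫ x, u x * fderiv ℝ φ x w = -∫ x, γ x * φ x

/-- Lebesgue measure on the unit interval `(0, 1]`. -/
abbrev unitMeasure : Measure ℝ := volume.restrict (Ioc (0 : ℝ) 1)

instance : IsProbabilityMeasure unitMeasure := ⟨by simp [unitMeasure]⟩

theorem integrable_mul_of_hasCompactSupport {f ψ : E N → ℝ} (hf : LocallyIntegrable f)
    (hψ : Continuous ψ) (hc : HasCompactSupport ψ) : Integrable (fun x => f x * ψ x) := by
  simpa [mul_comm] using hf.integrable_smul_left_of_hasCompactSupport hψ hc

/-- Dominating compact set for translates of a compactly supported function. -/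
theorem exists_compact_translate_bound {ψ : E N → ℝ} (hψ : Continuous ψ)
    (hc : HasCompactSupport ψ) (r : ℝ) :
    ∃ C : ℝ, ∃ K : Set (E N), 0 ≤ C ∧ IsCompact K ∧
      ∀ x v, ‖v‖ ≤ r → ‖ψ (x - v)‖ ≤ K.indicator (fun _ => C) x := by
  obtain ⟨C, hC⟩ := hψ.bounded_above_of_compact_support hc
  have hC0 : 0 ≤ C := (norm_nonneg _).trans (hC 0)
  refine ⟨C, Metric.cthickening (max r 0) (tsupport ψ), hC0, hc.cthickening, fun x v hv => ?_⟩
  by_cases hx : x ∈ Metric.cthickening (max r 0) (tsupport ψ)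
  · rw [indicator_of_mem hx]; exact hC _
  · rw [indicator_of_notMem hx]
    have : x - v ∉ tsupport ψ := fun h => hx (Metric.mem_cthickening_of_dist_le x (x - v) _ _ h (by
      simpa [dist_eq_norm] using Or.inl hv))
    rw [image_eq_zero_of_notMem_tsupport this, norm_zero]

theorem integrable_prod_mul_translate {f ψ : E N → ℝ} (hf : LocallyIntegrable f)
    (hψ : Continuous ψ) (hc : HasCompactSupport ψ) (v : E N) :
    Integrable (fun q : ℝ × E N => f q.2 * ψ (q.2 - q.1 • v)) (unitMeasure.prod volume) := by
  obtain ⟨C, K, hC0, hK, hb⟩ := exists_compact_translate_bound hψ hc ‖v‖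
  have h1 : Integrable (fun x => K.indicator (fun x => f x) x * C) :=
    (hf.integrableOn_isCompact hK |>.integrable_indicator hK.measurableSet).mul_const C
  have h2 : Integrable (fun q : ℝ × E N => (1 : ℝ) * (K.indicator (fun x => f x) q.2 * C))
      (unitMeasure.prod volume) := (integrable_const (1 : ℝ)).mul_prod h1
  refine h2.mono ?_ ?_
  · exact (hf.aestronglyMeasurable.comp_snd).mul (by fun_prop)
  · have : ∀ᵐ q : ℝ × E N ∂(unitMeasure.prod volume), q.1 ∈ Ioc (0 : ℝ) 1 :=
      Measure.quasiMeasurePreserving_fst.ae (ae_restrict_mem measurableSet_Ioc)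
    filter_upwards [this] with q hq
    have hv : ‖q.1 • v‖ ≤ ‖v‖ := by
      rw [norm_smul, Real.norm_of_nonneg hq.1.le]
      exact mul_le_of_le_one_left (norm_nonneg _) hq.2
    have := hb q.2 (q.1 • v) hv
    rw [one_mul, norm_mul, norm_mul]
    by_cases hx : q.2 ∈ K
    · rw [indicator_of_mem hx] at this ⊢
      rw [Real.norm_of_nonneg hC0]
      gcongr
    · rw [indicator_of_notMem hx] at this
      rw [norm_le_zero_iff.1 this, norm_zero, mul_zero]; positivity

/-- The shear moves the translation from the test function to the locally integrable factor without
losing integrability on the product. -/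
theorem measurePreserving_shear (v : E N) :
    MeasurePreserving (fun q : ℝ × E N => (q.1, q.2 + q.1 • v)) (unitMeasure.prod volume)
      (unitMeasure.prod volume) :=
  (MeasurePreserving.id unitMeasure).skew_product (g := fun t x => x + t • v)
    (by simp only [Function.uncurry_def]; fun_prop)
    (Eventually.of_forall fun t => (measurePreserving_add_right volume (t • v)).map_eq)

theorem integrable_prod_translate_mul {f ψ : E N → ℝ} (hf : LocallyIntegrable f)
    (hψ : Continuous ψ) (hc : HasCompactSupport ψ) (v : E N) :
    Integrable (fun q : ℝ × E N => f (q.2 + q.1 • v) * ψ q.2) (unitMeasure.prod volume) := by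
  have := (measurePreserving_shear v).integrable_comp_of_integrable
    (integrable_prod_mul_translate hf hψ hc v)
  simpa [Function.comp_def] using this

/-- The average of a function over the segment `[x, x + v]`. -/
def segAvg (γ : E N → ℝ) (v x : E N) : ℝ := ∫ t, γ (x + t • v) ∂unitMeasure

theorem stronglyMeasurable_segAvg {γ : E N → ℝ} (hγ : Measurable γ) (v : E N) :
    StronglyMeasurable (segAvg γ v) := by
  have : StronglyMeasurable (fun q : E N × ℝ => γ (q.1 + q.2 • v)) :=
    (hγ.comp (by fun_prop)).stronglyMeasurable
  exact this.integral_prod_right (ν := unitMeasure)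

/-- Jensen in the segment parameter, then Tonelli and translation invariance. -/
theorem lintegral_segAvg_rpow_le {p : ℝ} (hp : 1 < p) {γ : E N → ℝ} (hγ : Measurable γ) (v : E N) :
    ∫⁻ x, ‖segAvg γ v x‖ₑ ^ p ≤ ∫⁻ x, ‖γ x‖ₑ ^ p := by
  calc ∫⁻ x, ‖segAvg γ v x‖ₑ ^ p ≤ ∫⁻ x, ∫⁻ t, ‖γ (x + t • v)‖ₑ ^ p ∂unitMeasure := by
        refine lintegral_mono fun x => ?_
        refine le_trans ?_ (rpow_lintegral_le_lintegral_rpow hp unitMeasure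
          (f := fun t => ‖γ (x + t • v)‖ₑ) (by fun_prop))
        gcongr
        exact enorm_integral_le_lintegral_enorm _
    _ = ∫⁻ t, ∫⁻ x, ‖γ (x + t • v)‖ₑ ^ p ∂volume ∂unitMeasure :=
        lintegral_lintegral_swap (by simp only [Function.uncurry_def]; fun_prop)
    _ = ∫⁻ x, ‖γ x‖ₑ ^ p := by
        have : ∀ t : ℝ, ∫⁻ x, ‖γ (x + t • v)‖ₑ ^ p = ∫⁻ x, ‖γ x‖ₑ ^ p := fun t =>
          lintegral_add_right_eq_self (fun x => ‖γ x‖ₑ ^ p) (t • v)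
        simp [this]

theorem memLp_segAvg {p : ℝ} (hp : 1 < p) {γ : E N → ℝ} (hγ : Measurable γ)
    (hγp : MemLp γ (ENNReal.ofReal p)) (v : E N) : MemLp (segAvg γ v) (ENNReal.ofReal p) :=
  memLp_of_lintegral_rpow_ne_top (by linarith) (stronglyMeasurable_segAvg hγ v).aestronglyMeasurable
    ((lintegral_segAvg_rpow_le hp hγ v).trans_lt
      (lintegral_rpow_ne_top_of_memLp (by linarith) hγp).lt_top).ne

theorem one_le_ofReal {p : ℝ} (hp : 1 < p) : 1 ≤ ENNReal.ofReal p := by simpa using hp.le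

/-- Fundamental theorem of calculus for weak derivatives. -/
theorem IsWeakDeriv.translate_sub_ae_eq {p : ℝ} (hp : 1 < p) {u γ : E N → ℝ} {w : E N}
    (h : IsWeakDeriv u w γ) (hu : LocallyIntegrable u) (hγ : Measurable γ)
    (hγp : MemLp γ (ENNReal.ofReal p)) (r : ℝ) :
    ∀ᵐ x, u (x + r • w) - u x = r * segAvg γ (r • w) x := by
  have hγl : LocallyIntegrable γ := hγp.locallyIntegrable (one_le_ofReal hp)
  have hut : LocallyIntegrable (fun x => u (x + r • w)) := by
    intro x
    obtain ⟨s, hs, hsi⟩ := hu (x + r • w)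
    refine ⟨(fun y => y + r • w) ⁻¹' s, (by fun_prop : Continuous fun y => y + r • w).continuousAt hs, ?_⟩
    exact ((measurePreserving_add_right volume (r • w)).integrableOn_comp_preimage
      (measurableEmbedding_addRight (r • w))).2 hsi
  -- Both sides are tested against a smooth `φ`. The translation is moved onto `φ`, the classical
  -- fundamental theorem of calculus is applied to `φ` along the segment, the weak derivative is
  -- used with each translate of `φ` as test function, and the translation is moved back onto `γ`.
  refine ae_eq_of_integral_contDiff_smul_eq (hut.sub hu)
    ((memLp_segAvg hp hγ hγp (r • w)).const_mul r |>.locallyIntegrable (one_le_ofReal hp)) ?_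
  intro φ hφ hc
  have hφc : Continuous φ := hφ.continuous
  have hφd : Continuous (fun x => fderiv ℝ φ x w) :=
    (hφ.continuous_fderiv (by simp)).clm_apply continuous_const
  have hdc : HasCompactSupport (fun x => fderiv ℝ φ x w) := hc.fderiv_apply (𝕜 := ℝ) w
  set v := r • w with hv
  have hshift : ∀ y : E N, HasCompactSupport (fun x => φ (x - y)) := fun y => by
    simpa [sub_eq_add_neg, Function.comp_def] using hc.comp_homeomorph (Homeomorph.addRight (-y))
  have eL : ∫ x, φ x • (u (x + v) - u x) = ∫ x, u x * (φ (x - v) - φ x) := by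
    have i1 : Integrable (fun x => u (x + v) * φ x) :=
      integrable_mul_of_hasCompactSupport hut hφc hc
    have i2 : Integrable (fun x => u x * φ x) := integrable_mul_of_hasCompactSupport hu hφc hc
    have i3 : Integrable (fun x => u x * φ (x - v)) :=
      integrable_mul_of_hasCompactSupport hu (by fun_prop) (hshift v)
    have : ∫ x, u (x + v) * φ x = ∫ x, u x * φ (x - v) := by
      rw [← integral_add_right_eq_self (fun x => u x * φ (x - v)) v]; simp
    simp only [smul_eq_mul, mul_sub, mul_comm (φ _), sub_mul]
    rw [integral_sub i1 i2, integral_sub i3 i2, this]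
  have hftc : ∀ x, φ (x - v) - φ x = ∫ t, -(r * fderiv ℝ φ (x - t • v) w) ∂unitMeasure := by
    intro x
    rw [← intervalIntegral.integral_of_le zero_le_one]
    have hd : ∀ t ∈ uIcc (0 : ℝ) 1, HasDerivAt (fun t : ℝ => φ (x - t • v))
        (-(r * fderiv ℝ φ (x - t • v) w)) t := by
      intro t _
      have h1 : HasDerivAt (fun t : ℝ => x - t • v) (-v) t := by
        simpa using ((hasDerivAt_id t).smul_const v).const_sub x
      have h2 := ((hφ.differentiable (by simp)) (x - t • v)).hasFDerivAt.comp_hasDerivAt t h1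
      rwa [map_neg, show fderiv ℝ φ (x - t • v) v = r * fderiv ℝ φ (x - t • v) w by
        rw [← smul_eq_mul, ← map_smul]] at h2
    rw [intervalIntegral.integral_eq_sub_of_hasDerivAt hd]
    · simp
    · apply Continuous.intervalIntegrable
      exact (continuous_const.mul (hφd.comp (by fun_prop))).neg
  have eM : ∫ x, u x * (φ (x - v) - φ x) =
      ∫ t, (∫ x, u x * (-(r * fderiv ℝ φ (x - t • v) w))) ∂unitMeasure := by
    have hi : Integrable (fun q : ℝ × E N => u q.2 * (-(r * fderiv ℝ φ (q.2 - q.1 • v) w)))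
        (unitMeasure.prod volume) := by
      have := (integrable_prod_mul_translate hu hφd hdc v).const_mul (-r)
      refine this.congr (Eventually.of_forall fun q => ?_)
      simp only; ring
    rw [integral_integral_swap hi]
    refine integral_congr_ae (Eventually.of_forall fun x => ?_)
    simp only [hftc, ← integral_const_mul]
  have eT : ∀ t : ℝ, ∫ x, u x * (-(r * fderiv ℝ φ (x - t • v) w)) =
      ∫ x, r * (γ (x + t • v) * φ x) := by
    intro t
    have h1 := h (fun x => φ (x - t • v)) (hφ.comp (by fun_prop)) (hshift _)
    simp only [fderiv_comp_sub] at h1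
    have : ∫ x, γ x * φ (x - t • v) = ∫ x, γ (x + t • v) * φ x := by
      rw [← integral_add_right_eq_self (fun x => γ x * φ (x - t • v)) (t • v)]; simp
    rw [integral_const_mul, ← this]
    have e : ∀ x, u x * (-(r * fderiv ℝ φ (x - t • v) w)) =
      -r * (u x * fderiv ℝ φ (x - t • v) w) := fun x => by ring
    simp only [e]
    rw [integral_const_mul, h1]; ring
  rw [eL, eM]
  simp only [eT]
  rw [integral_integral_swap]
  · refine integral_congr_ae (Eventually.of_forall fun x => ?_)
    simp only [segAvg, smul_eq_mul]
    rw [integral_const_mul, integral_mul_const]; ring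
  · exact (integrable_prod_translate_mul hγl hφc hc v).const_mul r

end WeakDeriv

/-! ### Difference quotients and weak derivatives -/

section WeakDeriv

variable {N : ℕ} {p : ℝ}

theorem IsWeakDeriv.lintegral_translate_sub_le (hp : 1 < p) {u γ : E N → ℝ} {w : E N}
    (h : IsWeakDeriv u w γ) (hu : LocallyIntegrable u) (hγ : Measurable γ)
    (hγp : MemLp γ (ENNReal.ofReal p)) :
    ∫⁻ x, ‖u (x + w) - u x‖ₑ ^ p ≤ ∫⁻ x, ‖γ x‖ₑ ^ p := by
  refine le_trans (le_of_eq (lintegral_congr_ae ?_)) (lintegral_segAvg_rpow_le hp hγ w)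
  filter_upwards [h.translate_sub_ae_eq hp hu hγ hγp 1] with x hx
  simp only [one_smul, one_mul] at hx
  simp only [hx]

/-- Difference quotients converge strongly to the weak derivative. -/
theorem IsWeakDeriv.tendsto_lintegral_diffQuot (hp : 1 < p) {u γ : E N → ℝ} {w : E N}
    (h : IsWeakDeriv u w γ) (hu : LocallyIntegrable u) (hγ : Measurable γ)
    (hγp : MemLp γ (ENNReal.ofReal p)) :
    Tendsto (fun r : ℝ => ∫⁻ x, ‖r⁻¹ * (u (x + r • w) - u x) - γ x‖ₑ ^ p) (𝓝[≠] 0) (𝓝 0) := by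
  have htr := tendsto_lintegral_translate_sub hp hγp
  rw [ENNReal.tendsto_nhds_zero] at htr ⊢
  intro η hη
  obtain ⟨δ, hδ, hball⟩ := Metric.eventually_nhds_iff.1 (htr η hη)
  have hsm : ∀ᶠ r : ℝ in 𝓝[≠] 0, ‖r • w‖ < δ := by
    have : Tendsto (fun r : ℝ => ‖r • w‖) (𝓝 0) (𝓝 0) := by
      have : Continuous (fun r : ℝ => ‖r • w‖) := by fun_prop
      simpa using this.tendsto 0
    exact (this.mono_left nhdsWithin_le_nhds).eventually_lt_const hδ
  filter_upwards [hsm, self_mem_nhdsWithin] with r hr hr0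
  have hr0 : r ≠ 0 := hr0
  have hmeas : Measurable (fun q : E N × ℝ => γ (q.1 + q.2 • (r • w)) - γ q.1) := by fun_prop
  have hinteg : ∀ᵐ x, Integrable (fun t => γ (x + t • (r • w))) unitMeasure := by
    have hfin : ∫⁻ x, ∫⁻ t, ‖γ (x + t • (r • w))‖ₑ ^ p ∂unitMeasure ≠ ⊤ := by
      rw [lintegral_lintegral_swap (by simp only [Function.uncurry_def]; fun_prop)]
      have : ∀ t : ℝ, ∫⁻ x, ‖γ (x + t • (r • w))‖ₑ ^ p = ∫⁻ x, ‖γ x‖ₑ ^ p := fun t =>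
        lintegral_add_right_eq_self (fun x => ‖γ x‖ₑ ^ p) (t • (r • w))
      simpa [this] using lintegral_rpow_ne_top_of_memLp (by linarith) hγp
    have hm : Measurable (fun x => ∫⁻ t, ‖γ (x + t • (r • w))‖ₑ ^ p ∂unitMeasure) :=
      Measurable.lintegral_prod_right' (f := fun q : E N × ℝ => ‖γ (q.1 + q.2 • (r • w))‖ₑ ^ p)
        (by fun_prop)
    filter_upwards [ae_lt_top hm hfin] with x hx
    exact (memLp_of_lintegral_rpow_ne_top (by linarith)
      (by fun_prop : Measurable fun t : ℝ => γ (x + t • (r • w))).aestronglyMeasurable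
      hx.ne).integrable (one_le_ofReal hp)
  -- The difference quotient minus `γ` is the average over `t` of `γ (x + t • (r • w)) - γ x`, so
  -- Jensen reduces the claim to continuity of translations on `γ`.
  calc ∫⁻ x, ‖r⁻¹ * (u (x + r • w) - u x) - γ x‖ₑ ^ p
      ≤ ∫⁻ x, ∫⁻ t, ‖γ (x + t • (r • w)) - γ x‖ₑ ^ p ∂unitMeasure := by
        refine lintegral_mono_ae ?_
        filter_upwards [h.translate_sub_ae_eq hp hu hγ hγp r, hinteg] with x hx hi
        have e : r⁻¹ * (u (x + r • w) - u x) - γ x =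
            ∫ t, (γ (x + t • (r • w)) - γ x) ∂unitMeasure := by
          rw [hx, integral_sub hi (integrable_const _), inv_mul_cancel_left₀ hr0, integral_const]
          simp [segAvg]
        rw [e]
        refine le_trans ?_ (rpow_lintegral_le_lintegral_rpow hp unitMeasure
          (f := fun t => ‖γ (x + t • (r • w)) - γ x‖ₑ) (by fun_prop))
        gcongr
        exact enorm_integral_le_lintegral_enorm _
    _ = ∫⁻ t, (∫⁻ x, ‖γ (x + t • (r • w)) - γ x‖ₑ ^ p) ∂unitMeasure :=
        lintegral_lintegral_swap (by simp only [Function.uncurry_def]; fun_prop)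
    _ ≤ ∫⁻ _, η ∂unitMeasure := by
        refine lintegral_mono_ae ?_
        filter_upwards [ae_restrict_mem measurableSet_Ioc] with t ht
        refine hball ?_
        rw [dist_zero_right, norm_smul, Real.norm_of_nonneg ht.1.le]
        exact (mul_le_of_le_one_left (norm_nonneg _) ht.2).trans_lt hr
    _ = η := by simp

/-- Weak limits of difference quotients are weak derivatives. -/
theorem isWeakDeriv_of_tendsto_diffQuot {v β : E N → ℝ} {w : E N} (hv : LocallyIntegrable v)
    {r : ℕ → ℝ} (hr : Tendsto r atTop (𝓝[≠] 0))
    (h : ∀ φ : E N → ℝ, ContDiff ℝ ((⊤ : ℕ∞) : WithTop ℕ∞) φ → HasCompactSupport φ →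
      Tendsto (fun n => ∫ x, ((r n)⁻¹ * (v (x + r n • w) - v x)) * φ x) atTop
        (𝓝 (∫ x, β x * φ x))) : IsWeakDeriv v w β := by
  intro φ hφ hc
  have hφc : Continuous φ := hφ.continuous
  have hr0 : ∀ᶠ n in atTop, r n ≠ 0 := hr.eventually self_mem_nhdsWithin
  have hr' : Tendsto r atTop (𝓝 0) := hr.mono_right nhdsWithin_le_nhds
  have hut : ∀ y : E N, LocallyIntegrable (fun x => v (x + y)) := by
    intro y x
    obtain ⟨s, hs, hsi⟩ := hv (x + y)
    refine ⟨(fun z => z + y) ⁻¹' s, (by fun_prop : Continuous fun z => z + y).continuousAt hs, ?_⟩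
    exact ((measurePreserving_add_right volume y).integrableOn_comp_preimage
      (measurableEmbedding_addRight y)).2 hsi
  have hshift : ∀ y : E N, HasCompactSupport (fun x => φ (x - y)) := fun y => by
    simpa [sub_eq_add_neg, Function.comp_def] using hc.comp_homeomorph (Homeomorph.addRight (-y))
  -- Discrete integration by parts: the difference quotient passes to the smooth function `φ`, where
  -- it converges classically and is dominated through the Lipschitz constant of `φ`.
  have hswap : ∀ n, ∫ x, ((r n)⁻¹ * (v (x + r n • w) - v x)) * φ x =
      ∫ x, v x * ((r n)⁻¹ * (φ (x - r n • w) - φ x)) := by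
    intro n
    have i1 : Integrable (fun x => v (x + r n • w) * φ x) :=
      integrable_mul_of_hasCompactSupport (hut _) hφc hc
    have i2 : Integrable (fun x => v x * φ x) := integrable_mul_of_hasCompactSupport hv hφc hc
    have i3 : Integrable (fun x => v x * φ (x - r n • w)) :=
      integrable_mul_of_hasCompactSupport hv (by fun_prop) (hshift _)
    have e : ∫ x, v (x + r n • w) * φ x = ∫ x, v x * φ (x - r n • w) := by
      rw [← integral_add_right_eq_self (fun x => v x * φ (x - r n • w)) (r n • w)]; simp
    have e1 : ∀ x, ((r n)⁻¹ * (v (x + r n • w) - v x)) * φ x =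
      (r n)⁻¹ * (v (x + r n • w) * φ x - v x * φ x) := fun x => by ring
    have e2 : ∀ x, v x * ((r n)⁻¹ * (φ (x - r n • w) - φ x)) =
      (r n)⁻¹ * (v x * φ (x - r n • w) - v x * φ x) := fun x => by ring
    simp only [e1, e2]
    rw [integral_const_mul, integral_const_mul, integral_sub i1 i2, integral_sub i3 i2, e]
  have hlim : Tendsto (fun n => ∫ x, v x * ((r n)⁻¹ * (φ (x - r n • w) - φ x))) atTop
      (𝓝 (∫ x, v x * (-fderiv ℝ φ x w))) := by
    obtain ⟨C, K, hC0, hK, hb⟩ := exists_compact_translate_bound hφc hc ‖w‖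
    obtain ⟨L, hL⟩ := (hφ.of_le (by simp : (1 : WithTop ℕ∞) ≤ ((⊤ : ℕ∞) : WithTop ℕ∞))
      ).lipschitzWith_of_hasCompactSupport hc (by simp)
    refine tendsto_integral_filter_of_dominated_convergence
      (fun x => ‖K.indicator v x‖ * (L * ‖w‖)) ?_ ?_ ?_ ?_
    · exact Eventually.of_forall fun n => hv.aestronglyMeasurable.mul (by fun_prop)
    · have hsm : ∀ᶠ n in atTop, |r n| ≤ 1 := by
        have := hr'.abs
        rw [abs_zero] at this
        exact this.eventually_le_const one_pos
      filter_upwards [hr0, hsm] with n hn hn1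
      refine Eventually.of_forall fun x => ?_
      have hle : ‖r n • w‖ ≤ ‖w‖ := by
        rw [norm_smul]; exact mul_le_of_le_one_left (norm_nonneg _) hn1
      have h1 := hb x (r n • w) hle
      have h2 := hb x 0 (by simp)
      rw [sub_zero] at h2
      rw [norm_mul]
      by_cases hx : x ∈ K
      · rw [indicator_of_mem hx]
        gcongr
        rw [norm_mul, norm_inv]
        have := hL.dist_le_mul (x - r n • w) x
        rw [dist_eq_norm, dist_eq_norm, sub_sub_cancel_left, norm_neg, norm_smul] at this
        have hpos : 0 < ‖r n‖ := norm_pos_iff.2 hn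
        calc ‖r n‖⁻¹ * ‖φ (x - r n • w) - φ x‖ ≤ ‖r n‖⁻¹ * (L * (‖r n‖ * ‖w‖)) := by gcongr
          _ = L * ‖w‖ := by field_simp
      · rw [indicator_of_notMem hx] at h1 h2
        rw [norm_le_zero_iff.1 h1, norm_le_zero_iff.1 h2]
        simp only [sub_self, mul_zero, norm_zero]
        positivity
    · exact ((hv.integrableOn_isCompact hK).integrable_indicator hK.measurableSet).norm.mul_const _
    · refine Eventually.of_forall fun x => ?_
      refine Tendsto.const_mul _ ?_
      have h1 : HasDerivAt (fun t : ℝ => x - t • w) (-w) 0 := by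
        simpa using ((hasDerivAt_id (0 : ℝ)).smul_const w).const_sub x
      have h3 : HasFDerivAt φ (fderiv ℝ φ (x - (0 : ℝ) • w)) (x - (0 : ℝ) • w) :=
        ((hφ.differentiable (by simp)) _).hasFDerivAt
      have h2 := h3.comp_hasDerivAt (0 : ℝ) h1
      have h4 := (hasDerivAt_iff_tendsto_slope_zero.1 h2).comp hr
      simpa [Function.comp_def] using h4
  have := tendsto_nhds_unique hlim (by simpa only [hswap] using h φ hφ hc)
  simp only [mul_neg, integral_neg] at this
  linarith

/-- Hölder: a test function has finite norm for the conjugate exponent. -/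
theorem tendsto_integral_mul_of_tendsto_lintegral (hp : 1 < p) {f : ℕ → E N → ℝ} {g ψ : E N → ℝ}
    (hf : ∀ n, MemLp (f n) (ENNReal.ofReal p)) (hg : MemLp g (ENNReal.ofReal p))
    (hψ : Continuous ψ) (hc : HasCompactSupport ψ)
    (h : Tendsto (fun n => ∫⁻ x, ‖f n x - g x‖ₑ ^ p) atTop (𝓝 0)) :
    Tendsto (fun n => ∫ x, f n x * ψ x) atTop (𝓝 (∫ x, g x * ψ x)) := by
  have hpq := Real.HolderConjugate.conjExponent hp
  have hi : ∀ {k : E N → ℝ}, MemLp k (ENNReal.ofReal p) → Integrable (fun x => k x * ψ x) :=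
    fun hk => integrable_mul_of_hasCompactSupport (hk.locallyIntegrable (one_le_ofReal hp)) hψ hc
  refine tendsto_integral_of_L1 _ (hi hg).1 (Eventually.of_forall fun n => hi (hf n)) ?_
  set D := (∫⁻ x, ‖ψ x‖ₑ ^ (p.conjExponent)) ^ (1 / p.conjExponent) with hD
  have hDfin : D ≠ ⊤ := by
    have := (hψ.memLp_of_hasCompactSupport (p := ENNReal.ofReal p.conjExponent) (μ := volume) hc).2
    rw [eLpNorm_ofReal_eq hpq.symm.pos] at this
    exact this.ne
  have hle : ∀ n, ∫⁻ x, ‖f n x * ψ x - g x * ψ x‖ₑ ≤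
      (∫⁻ x, ‖f n x - g x‖ₑ ^ p) ^ (1 / p) * D := by
    intro n
    refine le_trans (le_of_eq ?_) (ENNReal.lintegral_mul_le_Lp_mul_Lq volume hpq
      ((hf n).1.sub hg.1).enorm hψ.measurable.enorm.aemeasurable)
    refine lintegral_congr fun x => ?_
    simp only [Pi.mul_apply]
    rw [← sub_mul, enorm_mul]
  have hz : Tendsto (fun n => (∫⁻ x, ‖f n x - g x‖ₑ ^ p) ^ (1 / p) * D) atTop (𝓝 0) := by
    have h1 := ((ENNReal.continuous_rpow_const (y := 1 / p)).tendsto 0).comp h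
    rw [ENNReal.zero_rpow_of_pos (by positivity)] at h1
    simpa using ENNReal.Tendsto.mul_const h1 (Or.inr hDfin)
  exact tendsto_of_tendsto_of_tendsto_of_le_of_le tendsto_const_nhds hz (fun _ => zero_le) hle

end WeakDeriv

/-! ### Weak derivative of the positive part -/

section PosPart

variable {N : ℕ} {p : ℝ}

/-- With `a = u x`, `b = u (x + r • w)` and `c` the derivative at `x`: when `a` and `b` are both
positive or both nonpositive, the last term is not needed. Otherwise the difference of indicators is
`±1`, and `|2c|` absorbs the error because the quotient of the positive parts is no larger than that
of `u`. -/
theorem abs_diffQuot_posPart_sub_le (a b r c : ℝ) :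
    |r⁻¹ * (max b 0 - max a 0) - (Ioi 0).indicator (fun _ => c) a| ≤
      |r⁻¹ * (b - a) - c| + |2 * c * ((Ioi 0).indicator 1 b - (Ioi 0).indicator 1 a)| := by
  have key : |r⁻¹ * (max b 0 - max a 0)| ≤ |r⁻¹ * (b - a)| := by
    rw [abs_mul, abs_mul]
    exact mul_le_mul_of_nonneg_left (abs_max_sub_max_le_abs b a 0) (abs_nonneg _)
  by_cases ha : 0 < a <;> by_cases hb : 0 < b
  · simp [ha, hb, max_eq_left ha.le, max_eq_left hb.le]
  · simp only [ha, hb, mem_Ioi, indicator_of_mem, indicator_of_notMem, not_false_iff,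
      Pi.one_apply, zero_sub, mul_neg, mul_one, abs_neg, abs_mul, abs_two]
    rw [abs_mul, abs_mul] at key
    have h1 := abs_sub_abs_le_abs_sub (r⁻¹ * (b - a)) c
    have h2 := abs_sub (r⁻¹ * (max b 0 - max a 0)) c
    rw [abs_mul] at h1 h2
    linarith
  · simp only [ha, hb, mem_Ioi, indicator_of_mem, indicator_of_notMem, not_false_iff,
      Pi.one_apply, sub_zero, mul_one, abs_mul, abs_two]
    rw [abs_mul, abs_mul] at key
    have h1 := abs_sub_abs_le_abs_sub (r⁻¹ * (b - a)) c
    rw [abs_mul] at h1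
    linarith [abs_nonneg c]
  · simp [ha, hb, max_eq_right (not_lt.1 ha), max_eq_right (not_lt.1 hb)]

theorem memLp_max_zero {u : E N → ℝ} (hu : MemLp u (ENNReal.ofReal p)) :
    MemLp (fun x => max (u x) 0) (ENNReal.ofReal p) := by
  refine hu.mono ((continuous_id.max continuous_const).comp_aestronglyMeasurable hu.1)
    (Eventually.of_forall fun x => ?_)
  rw [Real.norm_eq_abs, Real.norm_eq_abs, abs_of_nonneg (le_max_right _ _)]
  exact max_le (le_abs_self _) (abs_nonneg _)

theorem memLp_diffQuot {u : E N → ℝ} (hu : MemLp u (ENNReal.ofReal p)) (c : ℝ) (h : E N) :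
    MemLp (fun x => c * (u (x + h) - u x)) (ENNReal.ofReal p) :=
  ((hu.comp_measurePreserving (measurePreserving_add_right volume h)).sub hu).const_mul c

/-- The difference quotients of `u⁺` converge strongly in `L^p` to the truncated derivative, which
bypasses the usual smooth approximation of the positive part. The finite measure of the support puts
the indicator of `{u > 0}` in `L^p`, so that translations act continuously on it. -/
theorem IsWeakDeriv.posPart (hp : 1 < p) {u γ : E N → ℝ} {w : E N}
    (h : IsWeakDeriv u w γ) (hum : Measurable u) (hu : MemLp u (ENNReal.ofReal p))
    (hsupp : volume {x | u x ≠ 0} ≠ ⊤) (hγ : Measurable γ) (hγp : MemLp γ (ENNReal.ofReal p)) :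
    IsWeakDeriv (fun x => max (u x) 0) w ({x | 0 < u x}.indicator γ) := by
  have hp0 : 0 < p := by linarith
  set A : Set (E N) := {x | 0 < u x} with hA
  have hAm : MeasurableSet A := measurableSet_lt measurable_const hum
  have hAfin : volume A ≠ ⊤ :=
    ((measure_mono fun x (hx : 0 < u x) => hx.ne').trans_lt hsupp.lt_top).ne
  set χ : E N → ℝ := A.indicator 1 with hχ
  have hχm : Measurable χ := measurable_one.indicator hAm
  have hχp : MemLp χ (ENNReal.ofReal p) := memLp_indicator_const _ hAm 1 (Or.inr hAfin)
  let r₀ : ℕ → ℝ := fun n => 1 / ((n : ℝ) + 1)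
  have hr₀ : Tendsto r₀ atTop (𝓝[≠] 0) := by
    refine tendsto_nhdsWithin_iff.2 ⟨tendsto_one_div_add_atTop_nhds_zero_nat,
      Eventually.of_forall fun n => ?_⟩
    have : (0 : ℝ) < 1 / ((n : ℝ) + 1) := by positivity
    exact this.ne'
  have hshift : Tendsto (fun n => r₀ n • w) atTop (𝓝 0) := by
    simpa using (tendsto_nhdsWithin_iff.1 hr₀).1.smul_const w
  have hconv : Tendsto (fun n => eLpNorm ((fun x => χ (x + r₀ n • w)) - χ) (ENNReal.ofReal p) volume)
      atTop (𝓝 0) :=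
    (tendsto_eLpNorm_iff hp0 _ _).2 ((tendsto_lintegral_translate_sub hp hχp).comp hshift)
  -- Along a subsequence of increments the translated indicators converge almost everywhere; this is
  -- what dominated convergence needs for the term carrying `γ`.
  obtain ⟨ns, hns, hae⟩ := (tendstoInMeasure_of_tendsto_eLpNorm (by simpa using hp0)
    (fun n => (by fun_prop : Measurable fun x => χ (x + r₀ n • w)).aestronglyMeasurable)
    hχm.aestronglyMeasurable hconv).exists_seq_tendsto_ae
  set r : ℕ → ℝ := r₀ ∘ ns with hr
  have hrlim : Tendsto r atTop (𝓝[≠] 0) := hr₀.comp hns.tendsto_atTop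
  refine isWeakDeriv_of_tendsto_diffQuot
    ((memLp_max_zero hu).locallyIntegrable (one_le_ofReal hp)) hrlim fun φ hφ hc => ?_
  refine tendsto_integral_mul_of_tendsto_lintegral hp
    (fun n => memLp_diffQuot (memLp_max_zero hu) _ _) (hγp.indicator hAm) hφ.continuous hc ?_
  have hq := (h.tendsto_lintegral_diffQuot hp (hu.locallyIntegrable (one_le_ofReal hp)) hγ
    hγp).comp hrlim
  have hs : Tendsto (fun n => ∫⁻ x, ‖2 * γ x * (χ (x + r n • w) - χ x)‖ₑ ^ p) atTop (𝓝 0) := by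
    have := tendsto_lintegral_of_dominated_convergence (μ := volume)
      (F := fun n x => ‖2 * γ x * (χ (x + r n • w) - χ x)‖ₑ ^ p) (f := fun _ => 0)
      (fun x => ‖2 * γ x‖ₑ ^ p) (fun n => by fun_prop) ?_ ?_ ?_
    · simpa using this
    · intro n
      refine Eventually.of_forall fun x => ?_
      simp only
      gcongr 1
      rw [enorm_mul]
      refine mul_le_of_le_one_right (zero_le) ?_
      rw [Real.enorm_eq_ofReal_abs]
      refine ENNReal.ofReal_le_one.2 ?_
      simp only [hχ, indicator_apply, Pi.one_apply]
      split_ifs <;> simp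
    · exact lintegral_rpow_ne_top_of_memLp hp0 (hγp.const_mul 2)
    · filter_upwards [hae] with x hx
      have h1 : Tendsto (fun n => χ (x + r n • w) - χ x) atTop (𝓝 0) := by
        simpa [hr] using Tendsto.sub_const hx (χ x)
      have h2 : Tendsto (fun n => ‖2 * γ x * (χ (x + r n • w) - χ x)‖ₑ) atTop (𝓝 0) := by
        simpa using (h1.const_mul (2 * γ x)).enorm
      have h3 := ((ENNReal.continuous_rpow_const (y := p)).tendsto 0).comp h2
      rwa [ENNReal.zero_rpow_of_pos hp0] at h3
  have hsum := (ENNReal.Tendsto.const_mul (hq.add hs) (a := 2 ^ (p - 1))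
    (Or.inr (ENNReal.rpow_ne_top_of_nonneg (by linarith) (by simp))))
  simp only [add_zero, mul_zero] at hsum
  refine tendsto_of_tendsto_of_tendsto_of_le_of_le tendsto_const_nhds hsum (fun _ => zero_le) ?_
  intro n
  simp only [Function.comp_apply]
  rw [← lintegral_add_left' ?_, ← lintegral_const_mul'' _ ?_]
  · refine lintegral_mono fun x => ?_
    refine le_trans ?_ (ENNReal.rpow_add_le_mul_rpow_add_rpow _ _ hp.le)
    gcongr
    rw [Real.enorm_eq_ofReal_abs, Real.enorm_eq_ofReal_abs, Real.enorm_eq_ofReal_abs,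
      ← ENNReal.ofReal_add (abs_nonneg _) (abs_nonneg _)]
    exact ENNReal.ofReal_le_ofReal (abs_diffQuot_posPart_sub_le (u x) (u (x + r n • w)) (r n) (γ x))
  · fun_prop
  · fun_prop

end PosPart

/-! ### Calculus of weak gradients -/

section WeakGradient

variable {N : ℕ} {p : ℝ}

theorem isWeakGradient_iff {u : E N → ℝ} {g : E N → E N} :
    IsWeakGradient u g ↔ LocallyIntegrable u ∧ LocallyIntegrable g ∧
      ∀ w, IsWeakDeriv u w (fun x => inner ℝ (g x) w) := by
  unfold IsWeakGradient IsWeakDeriv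
  exact ⟨fun h => ⟨h.1, h.2.1, fun w φ hφ hc => h.2.2 φ hφ hc w⟩,
    fun h => ⟨h.1, h.2.1, fun φ hφ hc w => h.2.2 w φ hφ hc⟩⟩

theorem IsWeakGradient.congr {u v : E N → ℝ} {g k : E N → E N} (h : IsWeakGradient u g)
    (huv : u =ᵐ[volume] v) (hgk : g =ᵐ[volume] k) : IsWeakGradient v k := by
  refine ⟨h.1.congr huv, h.2.1.congr hgk, fun φ hφ hc w => ?_⟩
  rw [← integral_congr_ae (huv.mono fun x hx => by simp only [hx] :
      (fun x => u x * fderiv ℝ φ x w) =ᵐ[volume] fun x => v x * fderiv ℝ φ x w), h.2.2 φ hφ hc w,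
    integral_congr_ae (hgk.mono fun x hx => by simp only [hx] :
      (fun x => inner ℝ (g x) w * φ x) =ᵐ[volume] fun x => inner ℝ (k x) w * φ x)]

theorem LocallyIntegrable.inner_const {g : E N → E N} (hg : LocallyIntegrable g) (w : E N) :
    LocallyIntegrable (fun x => inner ℝ (g x) w) := fun x => by
  obtain ⟨s, hs, hi⟩ := hg x
  exact ⟨s, hs, Integrable.inner_const hi w⟩

/-- Uniqueness by the fundamental lemma of the calculus of variations. It makes the chosen
`weakGrad` interchangeable with any convenient gradient. -/
theorem IsWeakGradient.ae_eq {u : E N → ℝ} {g k : E N → E N} (h : IsWeakGradient u g)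
    (h' : IsWeakGradient u k) : g =ᵐ[volume] k := by
  refine ae_eq_of_integral_contDiff_smul_eq h.2.1 h'.2.1 fun φ hφ hc => ?_
  refine ext_inner_left ℝ fun w => ?_
  have i1 := h.2.1.integrable_smul_left_of_hasCompactSupport hφ.continuous hc
  have i2 := h'.2.1.integrable_smul_left_of_hasCompactSupport hφ.continuous hc
  rw [← integral_inner i1, ← integral_inner i2]
  have e := (h.2.2 φ hφ hc w).symm.trans (h'.2.2 φ hφ hc w)
  rw [neg_inj] at e
  simpa only [inner_smul_right, real_inner_comm, mul_comm] using e

theorem IsWeakGradient.weakGrad_ae_eq {u : E N → ℝ} {g : E N → E N} (h : IsWeakGradient u g) :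
    weakGrad u =ᵐ[volume] g := by
  have he : ∃ g, IsWeakGradient u g := ⟨g, h⟩
  have : IsWeakGradient u (weakGrad u) := by
    unfold weakGrad; rw [dif_pos he]; exact he.choose_spec
  exact this.ae_eq h

theorem IsWeakGradient.add {u v : E N → ℝ} {g k : E N → E N} (h : IsWeakGradient u g)
    (h' : IsWeakGradient v k) : IsWeakGradient (fun x => u x + v x) (fun x => g x + k x) := by
  refine ⟨h.1.add h'.1, h.2.1.add h'.2.1, fun φ hφ hc w => ?_⟩
  have hφd : Continuous (fun x => fderiv ℝ φ x w) :=
    (hφ.continuous_fderiv (by simp)).clm_apply continuous_const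
  have hdc : HasCompactSupport (fun x => fderiv ℝ φ x w) := hc.fderiv_apply (𝕜 := ℝ) w
  simp only [add_mul, inner_add_left]
  rw [integral_add (integrable_mul_of_hasCompactSupport h.1 hφd hdc)
      (integrable_mul_of_hasCompactSupport h'.1 hφd hdc),
    integral_add
      (integrable_mul_of_hasCompactSupport (LocallyIntegrable.inner_const h.2.1 w) hφ.continuous hc)
      (integrable_mul_of_hasCompactSupport (LocallyIntegrable.inner_const h'.2.1 w) hφ.continuous
        hc), h.2.2 φ hφ hc w, h'.2.2 φ hφ hc w]
  ring

theorem IsWeakGradient.const_smul {u : E N → ℝ} {g : E N → E N} (h : IsWeakGradient u g) (c : ℝ) :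
    IsWeakGradient (fun x => c * u x) (fun x => c • g x) := by
  refine ⟨h.1.smul c, h.2.1.smul c, fun φ hφ hc w => ?_⟩
  simp only [inner_smul_left, mul_assoc]
  rw [integral_const_mul, integral_const_mul, h.2.2 φ hφ hc w]
  simp

theorem IsWeakGradient.sub {u v : E N → ℝ} {g k : E N → E N} (h : IsWeakGradient u g)
    (h' : IsWeakGradient v k) : IsWeakGradient (fun x => u x - v x) (fun x => g x - k x) := by
  simpa [sub_eq_add_neg] using h.add (h'.const_smul (-1))

theorem IsWeakGradient.zero : IsWeakGradient (fun _ : E N => (0 : ℝ)) (fun _ => 0) :=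
  ⟨locallyIntegrable_zero, locallyIntegrable_zero, fun φ _ _ w => by simp⟩

/-- The derivative in direction `w` is bounded by `‖w‖ ‖g‖`. This estimate drives the compactness
argument when the order `1` is charged, and bounds the increments of smooth functions. -/
theorem IsWeakGradient.lintegral_translate_sub_le (hp : 1 < p) {u : E N → ℝ} {g : E N → E N}
    (h : IsWeakGradient u g) (hg : MemLp g (ENNReal.ofReal p)) (w : E N) :
    ∫⁻ x, ‖u (x + w) - u x‖ₑ ^ p ≤ ‖w‖ₑ ^ p * ∫⁻ x, ‖g x‖ₑ ^ p := by
  have hk := h.congr .rfl hg.1.ae_eq_mk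
  set k := hg.1.mk g with hkdef
  have hkm : Measurable k := hg.1.stronglyMeasurable_mk.measurable
  have hkp : MemLp k (ENNReal.ofReal p) := hg.ae_eq hg.1.ae_eq_mk
  refine ((isWeakGradient_iff.1 hk).2.2 w |>.lintegral_translate_sub_le hp h.1 (by fun_prop)
    (hkp.inner_const w)).trans ?_
  rw [← lintegral_const_mul' _ _ (ENNReal.rpow_ne_top_of_nonneg (by linarith) (by simp))]
  refine lintegral_mono_ae ?_
  filter_upwards [hg.1.ae_eq_mk] with x hx
  rw [← ENNReal.mul_rpow_of_nonneg _ _ (by linarith : (0:ℝ) ≤ p), hx]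
  gcongr
  rw [mul_comm]
  rw [← ofReal_norm, ← ofReal_norm, ← ofReal_norm, ← ENNReal.ofReal_mul (norm_nonneg _)]
  exact ENNReal.ofReal_le_ofReal (norm_inner_le_norm _ _)

theorem IsWeakGradient.posPart (hp : 1 < p) {u : E N → ℝ} {g : E N → E N}
    (h : IsWeakGradient u g) (hu : MemLp u (ENNReal.ofReal p)) (hg : MemLp g (ENNReal.ofReal p))
    (hsupp : volume {x | u x ≠ 0} ≠ ⊤) :
    IsWeakGradient (fun x => max (u x) 0) ({x | 0 < u x}.indicator g) := by
  have hv := hu.1.ae_eq_mk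
  set v := hu.1.mk u with hvdef
  have hvm : Measurable v := hu.1.stronglyMeasurable_mk.measurable
  have hvp : MemLp v (ENNReal.ofReal p) := hu.ae_eq hv
  have hk := h.congr hv hg.1.ae_eq_mk
  set k := hg.1.mk g with hkdef
  have hkm : Measurable k := hg.1.stronglyMeasurable_mk.measurable
  have hkp : MemLp k (ENNReal.ofReal p) := hg.ae_eq hg.1.ae_eq_mk
  have hs : volume {x | v x ≠ 0} ≠ ⊤ := by
    rwa [← measure_congr (s := {x | u x ≠ 0}) (t := {x | v x ≠ 0})]
    filter_upwards [hv] with x hx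
    exact congrArg (fun y : ℝ => y ≠ 0) hx
  have hAm : MeasurableSet {x | 0 < v x} := measurableSet_lt measurable_const hvm
  have key : IsWeakGradient (fun x => max (v x) 0) ({x | 0 < v x}.indicator k) := by
    refine isWeakGradient_iff.2 ⟨(memLp_max_zero hvp).locallyIntegrable (one_le_ofReal hp),
      (hkp.indicator hAm).locallyIntegrable (one_le_ofReal hp), fun w => ?_⟩
    have := ((isWeakGradient_iff.1 hk).2.2 w).posPart hp hvm hvp hs (by fun_prop)
      (hkp.inner_const w)
    convert this using 2 with x
    by_cases hx : 0 < v x <;> simp [indicator, hx]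
  refine key.congr ?_ ?_
  · filter_upwards [hv] with x hx; rw [hx]
  · filter_upwards [hv, hg.1.ae_eq_mk] with x hx hx'
    simp only [indicator, mem_ofPred_eq, hx, ← hx', hkdef]

/-- The weak gradient vanishes almost everywhere on the zero set. -/
theorem IsWeakGradient.ae_eq_zero_of_eq_zero (hp : 1 < p) {u : E N → ℝ} {g : E N → E N}
    (h : IsWeakGradient u g) (hu : MemLp u (ENNReal.ofReal p)) (hg : MemLp g (ENNReal.ofReal p))
    (hsupp : volume {x | u x ≠ 0} ≠ ⊤) : ∀ᵐ x, u x = 0 → g x = 0 := by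
  -- The negative part is both `u⁺ - u` and `(-u)⁺`. Its two gradients are `-g` and `0` on the zero
  -- set of `u`, and they agree almost everywhere.
  have h1 := (h.posPart hp hu hg hsupp).sub h
  have h2 := (h.const_smul (-1)).posPart hp (hu.const_mul (-1)) (hg.const_smul (-1 : ℝ))
    (by simpa using hsupp)
  have e : (fun x => max (u x) 0 - u x) = fun x => max (-1 * u x) 0 := by
    ext x; rcases le_total (u x) 0 with hx | hx
    · rw [max_eq_right hx, max_eq_left (by linarith)]; ring
    · rw [max_eq_left hx, max_eq_right (by linarith)]; ring
  rw [e] at h1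
  filter_upwards [h1.ae_eq h2] with x hx h0
  simpa [indicator, h0] using hx

theorem isWeakGradient_of_tendsto (hp : 1 < p) {u : ℕ → E N → ℝ} {g : ℕ → E N → E N}
    {v : E N → ℝ} {k : E N → E N} (h : ∀ n, IsWeakGradient (u n) (g n))
    (hu : ∀ n, MemLp (u n) (ENNReal.ofReal p)) (hg : ∀ n, MemLp (g n) (ENNReal.ofReal p))
    (hv : MemLp v (ENNReal.ofReal p)) (hk : MemLp k (ENNReal.ofReal p))
    (huv : Tendsto (fun n => ∫⁻ x, ‖u n x - v x‖ₑ ^ p) atTop (𝓝 0))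
    (hgk : Tendsto (fun n => ∫⁻ x, ‖g n x - k x‖ₑ ^ p) atTop (𝓝 0)) : IsWeakGradient v k := by
  refine ⟨hv.locallyIntegrable (one_le_ofReal hp), hk.locallyIntegrable (one_le_ofReal hp),
    fun φ hφ hc w => ?_⟩
  have hφd : Continuous (fun x => fderiv ℝ φ x w) :=
    (hφ.continuous_fderiv (by simp)).clm_apply continuous_const
  have hdc : HasCompactSupport (fun x => fderiv ℝ φ x w) := hc.fderiv_apply (𝕜 := ℝ) w
  have t1 := tendsto_integral_mul_of_tendsto_lintegral hp hu hv hφd hdc huv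
  have t2 := tendsto_integral_mul_of_tendsto_lintegral hp (fun n => (hg n).inner_const w)
    (hk.inner_const w) hφ.continuous hc (by
      have := ENNReal.Tendsto.const_mul hgk (a := ‖w‖ₑ ^ p)
        (Or.inr (ENNReal.rpow_ne_top_of_nonneg (by linarith) (by simp)))
      rw [mul_zero] at this
      refine tendsto_of_tendsto_of_tendsto_of_le_of_le tendsto_const_nhds this
        (fun _ => zero_le) fun n => ?_
      simp only
      rw [← lintegral_const_mul' _ _ (ENNReal.rpow_ne_top_of_nonneg (by linarith) (by simp))]
      refine lintegral_mono fun x => ?_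
      rw [← ENNReal.mul_rpow_of_nonneg _ _ (by linarith : (0:ℝ) ≤ p), ← inner_sub_left]
      gcongr
      rw [mul_comm, ← ofReal_norm, ← ofReal_norm, ← ofReal_norm,
        ← ENNReal.ofReal_mul (norm_nonneg _)]
      exact ENNReal.ofReal_le_ofReal (norm_inner_le_norm _ _))
  simp only [fun n => (h n).2.2 φ hφ hc w] at t1
  exact tendsto_nhds_unique t1 t2.neg

end WeakGradient

/-! ### Quantitative convexity of the `p`-th power of the norm -/

section UniformConvexity

variable {F : Type*} [NormedAddCommGroup F] [InnerProductSpace ℝ F]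

/-- For equal norms, strict convexity of the Euclidean ball; for different norms, strict convexity
of `t ↦ t ^ p`. -/
theorem norm_half_add_rpow_lt {p : ℝ} (hp : 1 < p) {a b : F} (hab : a ≠ b) :
    ‖(1 / 2 : ℝ) • (a + b)‖ ^ p < (‖a‖ ^ p + ‖b‖ ^ p) / 2 := by
  have hp0 : 0 < p := by linarith
  by_cases hn : ‖a‖ = ‖b‖
  · have h1 : ‖(1 / 2 : ℝ) • (a + b)‖ < ‖a‖ := (norm_midpoint_lt_iff hn).2 hab
    have := Real.rpow_lt_rpow (norm_nonneg _) h1 hp0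
    rw [← hn]; linarith
  · have h1 : ‖(1 / 2 : ℝ) • (a + b)‖ ≤ 1 / 2 * ‖a‖ + 1 / 2 * ‖b‖ := by
      rw [norm_smul, ← mul_add]
      have : ‖(1 / 2 : ℝ)‖ = 1 / 2 := by norm_num
      rw [this]
      gcongr
      exact norm_add_le a b
    have h2 := (strictConvexOn_rpow hp).2 (norm_nonneg a) (norm_nonneg b) hn
      (by norm_num : (0 : ℝ) < 1 / 2) (by norm_num : (0 : ℝ) < 1 / 2) (by norm_num)
    simp only [smul_eq_mul] at h2
    have h3 := Real.rpow_le_rpow (norm_nonneg _) h1 hp0.le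
    linarith

theorem norm_half_add_rpow_le {p : ℝ} (hp : 1 < p) (a b : F) :
    ‖(1 / 2 : ℝ) • (a + b)‖ ^ p ≤ (‖a‖ ^ p + ‖b‖ ^ p) / 2 := by
  by_cases hab : a = b
  · subst hab
    rw [← two_smul ℝ a, smul_smul]; norm_num
  · exact (norm_half_add_rpow_lt hp hab).le

variable [FiniteDimensional ℝ F]

/-- Quantitative strict convexity of `‖·‖ ^ p`. -/
theorem exists_norm_sub_rpow_le {p : ℝ} (hp : 1 < p) {ε : ℝ} (hε : 0 < ε) :
    ∃ C : ℝ, 0 ≤ C ∧ ∀ a b : F, ‖a - b‖ ^ p ≤ ε * (‖a‖ ^ p + ‖b‖ ^ p) +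
      C * ((‖a‖ ^ p + ‖b‖ ^ p) / 2 - ‖(1 / 2 : ℝ) • (a + b)‖ ^ p) := by
  have hp0 : 0 < p := by linarith
  have cn : ∀ {f : F × F → F}, Continuous f → Continuous fun z => ‖f z‖ ^ p := fun hf =>
    hf.norm.rpow_const fun _ => Or.inr hp0.le
  let gap : F × F → ℝ := fun z => (‖z.1‖ ^ p + ‖z.2‖ ^ p) / 2 - ‖(1 / 2 : ℝ) • (z.1 + z.2)‖ ^ p
  have hgap : Continuous gap := (((cn continuous_fst).add (cn continuous_snd)).div_const 2).sub
    (cn (by fun_prop))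
  have hgap0 : ∀ z, 0 ≤ gap z := fun z => sub_nonneg.2 (norm_half_add_rpow_le hp z.1 z.2)
  -- By homogeneity one may normalize the sum of the powers. On this compact set the midpoint gap is
  -- continuous and positive, hence bounded below by some `δ`; off it the `ε` term suffices.
  let S : Set (F × F) := {z | ‖z.1‖ ^ p + ‖z.2‖ ^ p = 1 ∧ ε ≤ ‖z.1 - z.2‖ ^ p}
  have hle1 : ∀ z : F × F, ‖z.1‖ ^ p + ‖z.2‖ ^ p = 1 → ‖z.1‖ ≤ 1 ∧ ‖z.2‖ ≤ 1 := by
    intro z hz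
    have h1 : 0 ≤ ‖z.1‖ ^ p := by positivity
    have h2 : 0 ≤ ‖z.2‖ ^ p := by positivity
    refine ⟨?_, ?_⟩
    · refine (Real.rpow_le_rpow_iff (norm_nonneg _) zero_le_one hp0).1 ?_
      rw [Real.one_rpow]; linarith
    · refine (Real.rpow_le_rpow_iff (norm_nonneg _) zero_le_one hp0).1 ?_
      rw [Real.one_rpow]; linarith
  have hS : IsCompact S := by
    refine Metric.isCompact_of_isClosed_isBounded ?_ ?_
    · exact (isClosed_eq ((cn continuous_fst).add (cn continuous_snd)) continuous_const).inter
        (isClosed_le continuous_const (cn (by fun_prop)))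
    · refine (Metric.isBounded_closedBall (x := (0 : F × F)) (r := 1)).subset fun z hz => ?_
      rw [mem_closedBall_zero_iff, Prod.norm_def]
      exact max_le (hle1 z hz.1).1 (hle1 z hz.1).2
  have hδ : ∃ δ > 0, ∀ z ∈ S, δ ≤ gap z := by
    rcases S.eq_empty_or_nonempty with he | hne
    · exact ⟨1, one_pos, by simp [he]⟩
    · obtain ⟨z₀, hz₀, hmin⟩ := hS.exists_isMinOn hne hgap.continuousOn
      refine ⟨gap z₀, ?_, fun z hz => hmin hz⟩
      refine sub_pos.2 (norm_half_add_rpow_lt hp ?_)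
      intro h
      have := hz₀.2
      rw [h, sub_self, norm_zero, Real.zero_rpow hp0.ne'] at this
      linarith
  obtain ⟨δ, hδ0, hδ⟩ := hδ
  -- After normalization both norms are at most `1`, so `‖a - b‖ ^ p ≤ 2 ^ p`, which is at most `2 ^
  -- p / δ` times the gap on `S`.
  refine ⟨2 ^ p / δ, by positivity, fun a b => ?_⟩
  have hnorm : ∀ z : F × F, ‖z.1‖ ^ p + ‖z.2‖ ^ p = 1 → ‖z.1 - z.2‖ ^ p ≤ ε + 2 ^ p / δ * gap z := by
    intro z hz
    by_cases hz' : ε ≤ ‖z.1 - z.2‖ ^ p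
    · have h1 := hδ z ⟨hz, hz'⟩
      have h2 : ‖z.1 - z.2‖ ^ p ≤ 2 ^ p := by
        refine Real.rpow_le_rpow (norm_nonneg _) ?_ hp0.le
        have := norm_sub_le z.1 z.2
        linarith [(hle1 z hz).1, (hle1 z hz).2]
      have h3 : (2 : ℝ) ^ p ≤ 2 ^ p / δ * gap z := by
        rw [div_mul_eq_mul_div, le_div_iff₀ hδ0]
        gcongr
      linarith
    · have := hgap0 z
      have : 0 ≤ 2 ^ p / δ * gap z := by positivity
      linarith [not_le.1 hz']
  set t := ‖a‖ ^ p + ‖b‖ ^ p with ht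
  have ha0 : 0 ≤ ‖a‖ ^ p := by positivity
  have hb0 : 0 ≤ ‖b‖ ^ p := by positivity
  rcases (add_nonneg ha0 hb0).eq_or_lt' with h0 | h0
  · have ha : a = 0 := by
      have : ‖a‖ ^ p = 0 := by linarith
      exact norm_eq_zero.1 ((Real.rpow_eq_zero (norm_nonneg _) hp0.ne').1 this)
    have hb : b = 0 := by
      have : ‖b‖ ^ p = 0 := by linarith
      exact norm_eq_zero.1 ((Real.rpow_eq_zero (norm_nonneg _) hp0.ne').1 this)
    subst ha; subst hb
    simp [ht, Real.zero_rpow hp0.ne']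
  · rw [← ht] at h0
    set r : ℝ := t ^ (-(1 / p)) with hr
    have hr0 : 0 < r := Real.rpow_pos_of_pos h0 _
    have hrp : r ^ p = t⁻¹ := by
      rw [hr, ← Real.rpow_mul h0.le, neg_mul, one_div_mul_cancel hp0.ne', Real.rpow_neg_one]
    have hsc : ∀ c : F, ‖r • c‖ ^ p = t⁻¹ * ‖c‖ ^ p := fun c => by
      rw [norm_smul, Real.mul_rpow (norm_nonneg _) (norm_nonneg _), Real.norm_of_nonneg hr0.le, hrp]
    have key := hnorm (r • a, r • b) (by
      simp only [hsc]; rw [← mul_add, ← ht, inv_mul_cancel₀ h0.ne'])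
    simp only [gap, ← smul_sub, ← smul_add, smul_comm (1 / 2 : ℝ) r, hsc] at key
    rw [← mul_add, ← ht] at key
    have e : t * (ε + 2 ^ p / δ * (t⁻¹ * t / 2 - t⁻¹ * ‖(1 / 2 : ℝ) • (a + b)‖ ^ p)) =
        ε * t + 2 ^ p / δ * (t / 2 - ‖(1 / 2 : ℝ) • (a + b)‖ ^ p) := by
      field_simp
    rw [← e]
    calc ‖a - b‖ ^ p = t * (t⁻¹ * ‖a - b‖ ^ p) := by rw [mul_inv_cancel_left₀ h0.ne']
      _ ≤ _ := by gcongr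

variable {α : Type*} [MeasurableSpace α] {ν : Measure α}

theorem ofReal_norm_Lp_rpow {G : Type*} [NormedAddCommGroup G] {p : ℝ} (hp : 1 < p)
    (f : Lp G (ENNReal.ofReal p) ν) :
    ENNReal.ofReal (‖f‖ ^ p) = ∫⁻ x, ‖f x‖ₑ ^ p ∂ν := by
  rw [← eLpNorm_ofReal_rpow (by linarith), Lp.norm_def, ← ENNReal.ofReal_rpow_of_nonneg
    ENNReal.toReal_nonneg (by linarith), ENNReal.ofReal_toReal (Lp.eLpNorm_ne_top f)]

theorem norm_Lp_rpow_eq_integral {G : Type*} [NormedAddCommGroup G] {p : ℝ} (hp : 1 < p)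
    (f : Lp G (ENNReal.ofReal p) ν) : ‖f‖ ^ p = ∫ x, ‖f x‖ ^ p ∂ν := by
  rw [integral_eq_lintegral_of_nonneg_ae (Eventually.of_forall fun x => by positivity)
    ((Lp.aestronglyMeasurable f).norm.aemeasurable.pow_const p).aestronglyMeasurable,
    ← ENNReal.toReal_ofReal (Real.rpow_nonneg (Lp.norm_def f ▸ ENNReal.toReal_nonneg) p : 0 ≤ ‖f‖ ^ p), ofReal_norm_Lp_rpow hp]
  congr 1
  refine lintegral_congr fun x => ?_
  rw [← ofReal_norm, ENNReal.ofReal_rpow_of_nonneg (norm_nonneg _) (by linarith)]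

theorem integrable_norm_Lp_rpow {G : Type*} [NormedAddCommGroup G] {p : ℝ} (hp : 1 < p)
    (f : Lp G (ENNReal.ofReal p) ν) : Integrable (fun x => ‖f x‖ ^ p) ν := by
  have := (Lp.memLp f).integrable_norm_rpow (by simp; linarith) ENNReal.ofReal_ne_top
  rwa [ENNReal.toReal_ofReal (by linarith)] at this

/-- The pointwise inequality is linear in `p`-th powers, so it integrates with the same constant. It
serves as a uniform convexity of `L^p` valid for every `p > 1`. -/
theorem exists_norm_Lp_sub_rpow_le {p : ℝ} (hp : 1 < p) {ε : ℝ} (hε : 0 < ε) :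
    ∃ C : ℝ, 0 ≤ C ∧ ∀ a b : Lp F (ENNReal.ofReal p) ν,
      ‖a - b‖ ^ p ≤ ε * (‖a‖ ^ p + ‖b‖ ^ p) +
        C * ((‖a‖ ^ p + ‖b‖ ^ p) / 2 - ‖(1 / 2 : ℝ) • (a + b)‖ ^ p) := by
  obtain ⟨C, hC, h⟩ := exists_norm_sub_rpow_le (F := F) hp hε
  refine ⟨C, hC, fun a b => ?_⟩
  simp only [norm_Lp_rpow_eq_integral hp]
  have ia := integrable_norm_Lp_rpow hp a
  have ib := integrable_norm_Lp_rpow hp b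
  have iab := integrable_norm_Lp_rpow hp ((1 / 2 : ℝ) • (a + b))
  have iS : Integrable (fun x => ‖a x‖ ^ p + ‖b x‖ ^ p) ν := ia.add ib
  have iD : Integrable (fun x => (‖a x‖ ^ p + ‖b x‖ ^ p) / 2 -
    ‖((1 / 2 : ℝ) • (a + b) : Lp F (ENNReal.ofReal p) ν) x‖ ^ p) ν := (iS.div_const 2).sub iab
  rw [← integral_add ia ib, ← integral_div, ← integral_sub (iS.div_const 2) iab,
    ← integral_const_mul, ← integral_const_mul, ← integral_add (iS.const_mul ε) (iD.const_mul C)]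
  refine integral_mono_ae (integrable_norm_Lp_rpow hp (a - b))
    ((iS.const_mul ε).add (iD.const_mul C)) ?_
  filter_upwards [Lp.coeFn_sub a b, Lp.coeFn_smul (1 / 2 : ℝ) (a + b), Lp.coeFn_add a b]
    with x h1 h2 h3
  simp only [h1, h2, Pi.sub_apply, Pi.smul_apply, h3, Pi.add_apply]
  exact h (a x) (b x)

end UniformConvexity

/-! ### Weak closedness of the gradient via Mazur's lemma -/

section Closedness

variable {N : ℕ} {p : ℝ}

theorem isWeakGradient_convexComb {u v : Lp ℝ (ENNReal.ofReal p) (volume : Measure (E N))}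
    {g k : Lp (E N) (ENNReal.ofReal p) (volume : Measure (E N))}
    (h : IsWeakGradient u g) (h' : IsWeakGradient v k) (a b : ℝ) :
    IsWeakGradient (a • u + b • v : Lp ℝ (ENNReal.ofReal p) (volume : Measure (E N)))
      (a • g + b • k : Lp (E N) (ENNReal.ofReal p) (volume : Measure (E N))) := by
  refine ((h.const_smul a).add (h'.const_smul b)).congr ?_ ?_
  · filter_upwards [Lp.coeFn_add (a • u) (b • v), Lp.coeFn_smul a u, Lp.coeFn_smul b v]
      with x h1 h2 h3
    rw [h1, Pi.add_apply, h2, h3]; rfl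
  · filter_upwards [Lp.coeFn_add (a • g) (b • k), Lp.coeFn_smul a g, Lp.coeFn_smul b k]
      with x h1 h2 h3
    rw [h1, Pi.add_apply, h2, h3]; rfl

/-- Mazur's lemma in a space whose norm satisfies a quantitative convexity inequality. -/
theorem exists_convexComb_tendsto {A D : Type*} [NormedAddCommGroup A] [NormedSpace ℝ A]
    [NormedAddCommGroup D] [NormedSpace ℝ D] [CompleteSpace D] (hp0 : 0 < p)
    (hconv : ∀ ε : ℝ, 0 < ε → ∃ C : ℝ, 0 ≤ C ∧ ∀ a b : D,
      ‖a - b‖ ^ p ≤ ε * (‖a‖ ^ p + ‖b‖ ^ p) +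
        C * ((‖a‖ ^ p + ‖b‖ ^ p) / 2 - ‖(1 / 2 : ℝ) • (a + b)‖ ^ p))
    {z : ℕ → A × D} {V : A} (hzV : Tendsto (fun n => (z n).1) atTop (𝓝 V)) {B : ℝ} (hBn : 0 ≤ B)
    (hzB : ∀ n, ‖(z n).2‖ ≤ B) :
    ∃ (y : ℕ → A × D) (K : D), (∀ n, y n ∈ convexHull ℝ (range z)) ∧
      Tendsto (fun n => (y n).1) atTop (𝓝 V) ∧ Tendsto (fun n => (y n).2) atTop (𝓝 K) ∧
      ‖K‖ ≤ B := by
  -- In each convex hull of a tail choose an element whose second component is nearly of minimal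
  -- norm. The infima increase to a limit, so midpoints of late choices leave only a small convexity
  -- gap, and the second components form a Cauchy sequence.
  let T : ℕ → Set (A × D) := fun n => convexHull ℝ (z '' Ici n)
  have hzT : ∀ {n k}, n ≤ k → z k ∈ T n := fun hk => subset_convexHull ℝ _ ⟨_, hk, rfl⟩
  have hTanti : ∀ {n m}, n ≤ m → T m ⊆ T n := fun hnm =>
    convexHull_mono (image_mono (Ici_subset_Ici.2 hnm))
  have hTB : ∀ n, ∀ y ∈ T n, ‖y.2‖ ≤ B := by
    intro n
    have hsub : T n ⊆ Prod.snd ⁻¹' Metric.closedBall (0 : D) B := by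
      refine convexHull_min ?_ ((convex_closedBall _ _).linear_preimage (LinearMap.snd ℝ A D))
      rintro _ ⟨k, -, rfl⟩
      rw [mem_preimage, mem_closedBall_zero_iff]
      exact hzB k
    intro y hy
    have := hsub hy
    rwa [mem_preimage, mem_closedBall_zero_iff] at this
  have hTBp : ∀ n, ∀ y ∈ T n, ‖y.2‖ ^ p ≤ B ^ p := fun n y hy =>
    Real.rpow_le_rpow (norm_nonneg _) (hTB n y hy) hp0.le
  have hBp : 0 ≤ B ^ p := by positivity
  let d : ℕ → ℝ := fun n => sInf ((fun y : A × D => ‖y.2‖ ^ p) '' T n)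
  have hbdd : ∀ n, BddBelow ((fun y : A × D => ‖y.2‖ ^ p) '' T n) := fun n =>
    ⟨0, by rintro _ ⟨y, -, rfl⟩; positivity⟩
  have hne : ∀ n, ((fun y : A × D => ‖y.2‖ ^ p) '' T n).Nonempty := fun n =>
    ⟨_, z n, hzT le_rfl, rfl⟩
  have hdle : ∀ {n}, ∀ y ∈ T n, d n ≤ ‖y.2‖ ^ p := fun y hy => csInf_le (hbdd _) ⟨y, hy, rfl⟩
  have hdmono : Monotone d := fun n m hnm => csInf_le_csInf (hbdd n) (hne m)
    (image_mono (hTanti hnm))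
  have hdB : ∀ n, d n ≤ B ^ p := fun n => (hdle _ (hzT le_rfl)).trans (hTBp n _ (hzT le_rfl))
  obtain ⟨dl, hdl⟩ : ∃ dl, Tendsto d atTop (𝓝 dl) :=
    ⟨_, tendsto_atTop_ciSup hdmono ⟨B ^ p, by rintro _ ⟨n, rfl⟩; exact hdB n⟩⟩
  have hdldl : ∀ n, d n ≤ dl := fun n => hdmono.ge_of_tendsto hdl n
  have hch : ∀ n : ℕ, ∃ y ∈ T n, ‖y.2‖ ^ p < d n + 1 / ((n : ℝ) + 1) := by
    intro n
    obtain ⟨_, ⟨y, hy, rfl⟩, hlt⟩ := exists_lt_of_csInf_lt (hne n)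
      (lt_add_of_pos_right (d n) (by positivity : (0 : ℝ) < 1 / ((n : ℝ) + 1)))
    exact ⟨y, hy, hlt⟩
  choose y hyT hylt using hch
  have hcauchy : CauchySeq (fun n => (y n).2) := by
    refine Metric.cauchySeq_iff'.2 fun ρ hρ => ?_
    -- The sum of the two powers is at most `2 * B ^ p`, so this choice of `ε` costs at most half of
    -- `ρ ^ p`; the gap term takes the other half.
    obtain ⟨C, hC, hconv⟩ := hconv (ρ ^ p / (4 * (B ^ p + 1))) (by positivity)
    have hsmall : Tendsto (fun n : ℕ => C * (dl - d n + 1 / ((n : ℝ) + 1))) atTop (𝓝 0) := by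
      have := (((tendsto_const_nhds (x := dl)).sub hdl).add
        tendsto_one_div_add_atTop_nhds_zero_nat).const_mul C
      simpa using this
    obtain ⟨n, hn⟩ := (hsmall.eventually_lt_const (by positivity : 0 < ρ ^ p / 2)).exists
    refine ⟨n, fun m hm => ?_⟩
    have hmid : (1 / 2 : ℝ) • (y m + y n) ∈ T n := by
      rw [smul_add]
      exact convex_convexHull ℝ _ (hTanti hm (hyT m)) (hyT n) (by norm_num) (by norm_num)
        (by norm_num)
    have h1 := hconv (y m).2 (y n).2
    have h2 : d n ≤ ‖(1 / 2 : ℝ) • ((y m).2 + (y n).2)‖ ^ p := hdle _ hmid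
    have h3 := hTBp m _ (hyT m)
    have h4 := hTBp n _ (hyT n)
    have hmn : 1 / ((m : ℝ) + 1) ≤ 1 / ((n : ℝ) + 1) := by gcongr
    have h5 : ρ ^ p / (4 * (B ^ p + 1)) * (‖(y m).2‖ ^ p + ‖(y n).2‖ ^ p) ≤ ρ ^ p / 2 := by
      calc _ ≤ ρ ^ p / (4 * (B ^ p + 1)) * (2 * (B ^ p + 1)) := by gcongr; linarith
        _ = ρ ^ p / 2 := by field_simp; norm_num
    have h6 : C * ((‖(y m).2‖ ^ p + ‖(y n).2‖ ^ p) / 2 -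
        ‖(1 / 2 : ℝ) • ((y m).2 + (y n).2)‖ ^ p) ≤ C * (dl - d n + 1 / ((n : ℝ) + 1)) := by
      gcongr
      linarith [hylt m, hylt n, hdldl m, hdldl n]
    have h7 : ‖(y m).2 - (y n).2‖ ^ p < ρ ^ p := by linarith
    rw [dist_eq_norm]
    exact (Real.rpow_lt_rpow_iff (norm_nonneg _) hρ.le hp0).1 h7
  obtain ⟨K, hK⟩ := cauchySeq_tendsto_of_complete hcauchy
  refine ⟨y, K, fun n => convexHull_mono (image_subset_range _ _) (hyT n), ?_, hK,
    le_of_tendsto hK.norm (Eventually.of_forall fun n => hTB n _ (hyT n))⟩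
  refine Metric.tendsto_atTop.2 fun ρ hρ => ?_
  obtain ⟨n, hn⟩ := Metric.tendsto_atTop.1 hzV ρ hρ
  refine ⟨n, fun m hm => ?_⟩
  -- First components follow `V` since balls are convex and the tail already lies in one.
  have hsub : T m ⊆ Prod.fst ⁻¹' Metric.ball V ρ := by
    refine convexHull_min ?_ ((convex_ball _ _).linear_preimage (LinearMap.fst ℝ A D))
    rintro _ ⟨k, hk, rfl⟩
    exact hn k (hm.trans hk)
  exact hsub (hyT m)

theorem tendsto_lintegral_of_tendsto_Lp {α G : Type*} [MeasurableSpace α] {ν : Measure α}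
    [NormedAddCommGroup G] (hp : 1 < p) [Fact (1 ≤ ENNReal.ofReal p)]
    {f : ℕ → Lp G (ENNReal.ofReal p) ν} {f₀ : Lp G (ENNReal.ofReal p) ν}
    (hf : Tendsto f atTop (𝓝 f₀)) :
    Tendsto (fun n => ∫⁻ x, ‖f n x - f₀ x‖ₑ ^ p ∂ν) atTop (𝓝 0) := by
  have := tendsto_iff_edist_tendsto_0.1 hf
  simp only [Lp.edist_def] at this
  exact (tendsto_eLpNorm_iff (by linarith) _ _).1 this

/-- An `L^p` limit of functions with weak gradients bounded in `L^p` has a weak gradient obeying the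
same bound. -/
theorem exists_isWeakGradient_of_bounded (hp : 1 < p) {u : ℕ → E N → ℝ} {g : ℕ → E N → E N}
    {v : E N → ℝ} (h : ∀ n, IsWeakGradient (u n) (g n))
    (hu : ∀ n, MemLp (u n) (ENNReal.ofReal p)) (hv : MemLp v (ENNReal.ofReal p))
    (huv : Tendsto (fun n => ∫⁻ x, ‖u n x - v x‖ₑ ^ p) atTop (𝓝 0)) {B : ℝ≥0∞} (hB : B ≠ ⊤)
    (hgB : ∀ n, ∫⁻ x, ‖g n x‖ₑ ^ p ≤ B) :
    ∃ k : E N → E N, IsWeakGradient v k ∧ MemLp k (ENNReal.ofReal p) ∧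
      ∫⁻ x, ‖k x‖ₑ ^ p ≤ B := by
  have hp0 : 0 < p := by linarith
  have : Fact (1 ≤ ENNReal.ofReal p) := ⟨one_le_ofReal hp⟩
  have hgp : ∀ n, MemLp (g n) (ENNReal.ofReal p) := fun n =>
    memLp_of_lintegral_rpow_ne_top hp0 (h n).2.1.aestronglyMeasurable
      ((hgB n).trans_lt hB.lt_top).ne
  have hzV : Tendsto (fun n => (hu n).toLp (u n)) atTop (𝓝 (hv.toLp v)) := by
    refine tendsto_iff_edist_tendsto_0.2 ?_
    simp only [Lp.edist_toLp_toLp]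
    exact (tendsto_eLpNorm_iff hp0 _ _).2 huv
  have hBr : (B ^ (1 / p)).toReal ^ p = B.toReal := by
    rw [ENNReal.toReal_rpow, ← ENNReal.rpow_mul, one_div_mul_cancel hp0.ne', ENNReal.rpow_one]
  have hzB : ∀ n, ‖(hgp n).toLp (g n)‖ ≤ (B ^ (1 / p)).toReal := by
    intro n
    rw [Lp.norm_toLp, eLpNorm_ofReal_eq hp0]
    exact ENNReal.toReal_mono (ENNReal.rpow_ne_top_of_nonneg (by positivity) hB)
      (ENNReal.rpow_le_rpow (hgB n) (by positivity))
  obtain ⟨y, K, hy, hyV, hyK, hKB⟩ := exists_convexComb_tendsto hp0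
    (fun ε hε => exists_norm_Lp_sub_rpow_le (F := E N) (ν := (volume : Measure (E N))) hp hε)
    (z := fun n => ((hu n).toLp (u n), (hgp n).toLp (g n))) hzV ENNReal.toReal_nonneg hzB
  -- Pairs of a function and its weak gradient form a convex set, so the convex combinations from
  -- Mazur's lemma remain such pairs, and strong convergence of both components passes to the limit.
  have hW : ∀ n, IsWeakGradient (y n).1 (y n).2 := by
    intro n
    have hsub : convexHull ℝ (range fun n => ((hu n).toLp (u n), (hgp n).toLp (g n))) ⊆
        {y | IsWeakGradient y.1 y.2} := by
      refine convexHull_min ?_ ?_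
      · rintro _ ⟨k, rfl⟩
        exact (h k).congr (hu k).coeFn_toLp.symm (hgp k).coeFn_toLp.symm
      · intro y hy y' hy' a b _ _ _
        exact isWeakGradient_convexComb hy hy' a b
    exact hsub (hy n)
  refine ⟨K, ?_, Lp.memLp K, ?_⟩
  · have := isWeakGradient_of_tendsto hp hW (fun n => Lp.memLp (y n).1)
      (fun n => Lp.memLp (y n).2) (Lp.memLp (hv.toLp v)) (Lp.memLp K)
      (tendsto_lintegral_of_tendsto_Lp hp hyV) (tendsto_lintegral_of_tendsto_Lp hp hyK)
    exact this.congr hv.coeFn_toLp .rfl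
  · rw [← ofReal_norm_Lp_rpow hp, ← ENNReal.ofReal_toReal hB, ← hBr]
    exact ENNReal.ofReal_le_ofReal (Real.rpow_le_rpow (norm_nonneg _) hKB hp0.le)

end Closedness

/-! ### The energy as a sum of three `L^p` norms -/

section Kernel

variable {N : ℕ} {p : ℝ}

theorem continuous_normConst (hN : 1 ≤ N) (hp : 1 < p) :
    Continuous (fun s : unitInterval => normConst N s p) := by
  have hN' : (1 : ℝ) ≤ N := by exact_mod_cast hN
  have hG : ∀ {f : unitInterval → ℝ}, Continuous f → (∀ s, 0 < f s) →
      Continuous fun s => Real.Gamma (f s) := fun {f} hf hpos =>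
    continuous_iff_continuousAt.2 fun s =>
      (Real.differentiableAt_Gamma (s := f s) fun m => by
        have := hpos s
        have : (0 : ℝ) ≤ m := m.cast_nonneg
        linarith).continuousAt.comp hf.continuousAt
  unfold normConst
  have h1 : Continuous fun s : unitInterval => Real.Gamma (((N : ℝ) + p * s) / 2) :=
    hG (by fun_prop) fun s => by
      have : 0 ≤ p * (s : ℝ) := mul_nonneg (by linarith) s.2.1
      linarith
  have h2 : Continuous fun s : unitInterval => Real.Gamma (2 - (s : ℝ)) :=
    hG (by fun_prop) fun s => by linarith [s.2.2]
  have h3 : ∀ s : unitInterval, Real.Gamma ((p + 1) / 2) * Real.Gamma (2 - (s : ℝ)) ≠ 0 := fun s =>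
    (mul_pos (Real.Gamma_pos_of_pos (by linarith)) (Real.Gamma_pos_of_pos (by linarith [s.2.2]))).ne'
  have h4 : Continuous fun s : unitInterval => (2 : ℝ) ^ (2 * (s : ℝ) - 1) :=
    continuous_const.rpow (by fun_prop) fun _ => Or.inl two_ne_zero
  exact ((((by fun_prop : Continuous fun s : unitInterval => (s : ℝ) * p / 2 * (1 - s)).mul
    h4).div_const _).mul (h1.div (continuous_const.mul h2) h3))

theorem normConst_nonneg (hN : 1 ≤ N) (hp : 1 < p) (s : unitInterval) : 0 ≤ normConst N s p := by
  have hN' : (1 : ℝ) ≤ N := by exact_mod_cast hN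
  have hs := s.2
  have h0 : 0 ≤ p * (s : ℝ) := mul_nonneg (by linarith) hs.1
  unfold normConst
  have h1 := Real.Gamma_pos_of_pos (by linarith : 0 < ((N : ℝ) + p * s) / 2)
  have h2 := Real.Gamma_pos_of_pos (by linarith : 0 < (p + 1) / 2)
  have h3 := Real.Gamma_pos_of_pos (by linarith [hs.2] : 0 < 2 - (s : ℝ))
  have h4 : 0 ≤ 1 - (s : ℝ) := by linarith [hs.2]
  have h5 := hs.1
  have h6 : 0 < p := by linarith
  have := Real.pi_pos
  positivity

theorem normConst_pos (hN : 1 ≤ N) (hp : 1 < p) {s : unitInterval} (h0 : 0 < s) (h1 : s < 1) :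
    0 < normConst N s p := by
  have hN' : (1 : ℝ) ≤ N := by exact_mod_cast hN
  have hs0 : 0 < (s : ℝ) := by exact_mod_cast h0
  have hs1 : (s : ℝ) < 1 := by exact_mod_cast h1
  have hp0 : 0 < p := by linarith
  unfold normConst
  have h1 := Real.Gamma_pos_of_pos (by positivity : 0 < ((N : ℝ) + p * s) / 2)
  have h2 := Real.Gamma_pos_of_pos (by linarith : 0 < (p + 1) / 2)
  have h3 := Real.Gamma_pos_of_pos (by linarith : 0 < 2 - (s : ℝ))
  have h4 : 0 < 1 - (s : ℝ) := by linarith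
  have := Real.pi_pos
  positivity

/-- The interaction kernel of the fractional orders `s ∈ (0,1)`, as a function of the increment. -/
def fracKernel (p : ℝ) (μ : Measure unitInterval) (h : E N) : ℝ≥0∞ :=
  ∫⁻ s in Ioo (0 : unitInterval) 1,
    ENNReal.ofReal (normConst N s p / ‖h‖ ^ ((N : ℝ) + s * p)) ∂μ

theorem measurable_fracIntegrand (hN : 1 ≤ N) (hp : 1 < p) :
    Measurable (fun q : unitInterval × E N =>
      ENNReal.ofReal (normConst N q.1 p / ‖q.2‖ ^ ((N : ℝ) + q.1 * p))) :=
  (((continuous_normConst hN hp).measurable.comp measurable_fst).div (measurable_snd.norm.pow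
    (((measurable_subtype_coe.comp measurable_fst).mul_const p).const_add _))).ennreal_ofReal

theorem measurable_fracKernel (hN : 1 ≤ N) (hp : 1 < p) (μ : Measure unitInterval)
    [IsFiniteMeasure μ] : Measurable (fracKernel (N := N) p μ) :=
  Measurable.lintegral_prod_left' (measurable_fracIntegrand hN hp)

/-- The measure on pairs (increment, point) weighting the fractional increments. -/
def fracMeasure (N : ℕ) (p : ℝ) (μ : Measure unitInterval) : Measure (E N × E N) :=
  (volume.withDensity (fracKernel p μ)).prod volume

/-- The increment `u(x + h) - u(x)` at `q = (h, x)`. -/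
def incr (u : E N → ℝ) (q : E N × E N) : ℝ := u (q.2 + q.1) - u q.2

/-- The `p`-th power of the norm of `X_p`. -/
def energy (p : ℝ) (μ : Measure unitInterval) (u : E N → ℝ) : ℝ≥0∞ := ∫⁻ s, seminormPow p s u ∂μ

theorem ofReal_norm_rpow {F : Type*} [NormedAddCommGroup F] (hp : 1 < p) (a : F) :
    ENNReal.ofReal (‖a‖ ^ p) = ‖a‖ₑ ^ p := by
  rw [← ENNReal.ofReal_rpow_of_nonneg (norm_nonneg _) (by linarith), ofReal_norm]

theorem ofReal_abs_rpow (hp : 1 < p) (a : ℝ) : ENNReal.ofReal (|a| ^ p) = ‖a‖ₑ ^ p :=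
  ofReal_norm_rpow hp a

theorem lintegral_fracMeasure (hN : 1 ≤ N) (hp : 1 < p) (μ : Measure unitInterval)
    [IsFiniteMeasure μ] {f : E N × E N → ℝ≥0∞} (hf : Measurable f) :
    ∫⁻ q, f q ∂(fracMeasure N p μ) = ∫⁻ h, fracKernel p μ h * ∫⁻ x, f (h, x) := by
  unfold fracMeasure
  have : SFinite ((volume : Measure (E N)).withDensity (fracKernel p μ)) := inferInstance
  rw [lintegral_prod _ hf.aemeasurable, lintegral_withDensity_eq_lintegral_mul _
    (measurable_fracKernel hN hp μ) hf.lintegral_prod_right']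
  rfl

theorem measurable_pairKernel (hN : 1 ≤ N) (hp : 1 < p) :
    Measurable (fun q : unitInterval × (E N × E N) =>
      ENNReal.ofReal (normConst N q.1 p / ‖q.2.1 - q.2.2‖ ^ ((N : ℝ) + q.1 * p))) := by
  have hm : Measurable fun q : unitInterval × (E N × E N) => (q.1, q.2.1 - q.2.2) := by fun_prop
  have h := (measurable_fracIntegrand hN hp).comp hm
  simpa only [Function.comp_def] using h

theorem lintegral_lintegral_fracIntegrand (hN : 1 ≤ N) (hp : 1 < p) (μ : Measure unitInterval)
    [IsFiniteMeasure μ] {f : E N × E N → ℝ≥0∞} (hf : Measurable f) :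
    ∫⁻ s in Ioo (0 : unitInterval) 1, (∫⁻ z : E N × E N,
        ENNReal.ofReal (normConst N s p / ‖z.1 - z.2‖ ^ ((N : ℝ) + s * p)) * f z) ∂μ =
      ∫⁻ z : E N × E N, fracKernel p μ (z.1 - z.2) * f z := by
  rw [lintegral_lintegral_swap ((measurable_pairKernel hN hp).mul (hf.comp measurable_snd)).aemeasurable]
  refine lintegral_congr fun z => ?_
  rw [fracKernel, lintegral_mul_const]
  have hm : Measurable fun s : unitInterval => (s, z.1 - z.2) := by fun_prop
  have h := (measurable_fracIntegrand hN hp).comp hm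
  simpa only [Function.comp_def] using h

/-- The change of variables `(x, y) = (y + h, y)`: the kernel depends on the increment only, so all
fractional orders merge into one measure on pairs `(h, y)`. -/
theorem lintegral_fracKernel_mul (hN : 1 ≤ N) (hp : 1 < p) (μ : Measure unitInterval)
    [IsFiniteMeasure μ] {f : E N × E N → ℝ≥0∞} (hf : Measurable f) :
    ∫⁻ z : E N × E N, fracKernel p μ (z.1 - z.2) * f z =
      ∫⁻ q, f (q.2 + q.1, q.2) ∂(fracMeasure N p μ) := by
  have hk := measurable_fracKernel hN hp μ
  rw [Measure.volume_eq_prod, lintegral_prod_symm _ (by fun_prop),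
    lintegral_fracMeasure hN hp μ (by fun_prop)]
  calc ∫⁻ y, ∫⁻ x, fracKernel p μ (x - y) * f (x, y)
      = ∫⁻ y, ∫⁻ h, fracKernel p μ h * f (y + h, y) := by
        refine lintegral_congr fun y => ?_
        rw [← lintegral_add_right_eq_self _ y]
        refine lintegral_congr fun h => ?_
        rw [add_sub_cancel_right, add_comm]
    _ = ∫⁻ h, ∫⁻ y, fracKernel p μ h * f (y + h, y) :=
        lintegral_lintegral_swap (by simp only [Function.uncurry_def]; fun_prop)
    _ = _ := by
        refine lintegral_congr fun h => ?_
        rw [lintegral_const_mul _ (by fun_prop)]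

theorem seminormPow_eq_lintegral (hN : 1 ≤ N) (hp : 1 < p) {u : E N → ℝ} (hu : Measurable u)
    {s : unitInterval} (hs : s ∈ Ioo (0 : unitInterval) 1) :
    seminormPow p s u = ∫⁻ z : E N × E N,
      ENNReal.ofReal (normConst N s p / ‖z.1 - z.2‖ ^ ((N : ℝ) + s * p)) *
        ‖u z.1 - u z.2‖ₑ ^ p := by
  simp only [seminormPow, hs.1.ne', hs.2.ne, if_false]
  rw [← lintegral_const_mul _ (by fun_prop)]
  refine lintegral_congr fun z => ?_
  rw [← ofReal_abs_rpow hp, ← ENNReal.ofReal_mul (normConst_nonneg hN hp s),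
    ← ENNReal.ofReal_mul (div_nonneg (normConst_nonneg hN hp s) (by positivity))]
  congr 1; ring

theorem lintegral_frac_seminormPow (hN : 1 ≤ N) (hp : 1 < p) (μ : Measure unitInterval)
    [IsFiniteMeasure μ] {u : E N → ℝ} (hu : Measurable u) :
    ∫⁻ s in Ioo (0 : unitInterval) 1, seminormPow p s u ∂μ =
      ∫⁻ q, ‖incr u q‖ₑ ^ p ∂(fracMeasure N p μ) := by
  have hf : Measurable fun z : E N × E N => ‖u z.1 - u z.2‖ₑ ^ p := by fun_prop
  refine Eq.trans ?_ ((lintegral_lintegral_fracIntegrand hN hp μ hf).trans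
    (lintegral_fracKernel_mul hN hp μ hf))
  exact setLIntegral_congr_fun measurableSet_Ioo fun s hs => seminormPow_eq_lintegral hN hp hu hs

theorem seminormPow_congr_ae {s : unitInterval} {u v : E N → ℝ} (h : u =ᵐ[volume] v) :
    seminormPow p s u = seminormPow p s v := by
  unfold seminormPow
  split_ifs with h0 h1 h2 h3 h4
  · exact lintegral_congr_ae (h.mono fun x hx => by simp only [hx])
  · obtain ⟨g, hg⟩ := h2
    refine lintegral_congr_ae ?_
    filter_upwards [hg.weakGrad_ae_eq, (hg.congr h .rfl).weakGrad_ae_eq] with x hx hx'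
    rw [hx, hx']
  · exact absurd (h2.imp fun g hg => hg.congr h .rfl) h3
  · exact absurd (h4.imp fun g hg => hg.congr h.symm .rfl) h2
  · rfl
  · congr 1
    have a1 : ∀ᵐ z : E N × E N, u z.1 = v z.1 := Measure.quasiMeasurePreserving_fst.ae h
    have a2 : ∀ᵐ z : E N × E N, u z.2 = v z.2 := Measure.quasiMeasurePreserving_snd.ae h
    refine lintegral_congr_ae ?_
    filter_upwards [a1, a2] with z h1 h2
    rw [h1, h2]

theorem energy_congr_ae {μ : Measure unitInterval} {u v : E N → ℝ} (h : u =ᵐ[volume] v) :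
    energy p μ u = energy p μ v :=
  lintegral_congr fun _ => seminormPow_congr_ae h

theorem quasiMeasurePreserving_fracMeasure_snd (μ : Measure unitInterval) :
    Measure.QuasiMeasurePreserving Prod.snd (fracMeasure N p μ) volume :=
  Measure.quasiMeasurePreserving_snd

/-- Null sets pull back to null sets because each slice is a translate. Hence `incr` is well defined
on classes modulo almost everywhere equality. -/
theorem quasiMeasurePreserving_fracMeasure_add (hN : 1 ≤ N) (hp : 1 < p) (μ : Measure unitInterval)
    [IsFiniteMeasure μ] :
    Measure.QuasiMeasurePreserving (fun q : E N × E N => q.2 + q.1) (fracMeasure N p μ) volume := by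
  refine ⟨by fun_prop, Measure.AbsolutelyContinuous.mk fun s hs h0 => ?_⟩
  rw [Measure.map_apply (by fun_prop) hs, ← lintegral_indicator_one (hs.preimage (by fun_prop)),
    lintegral_fracMeasure hN hp μ (measurable_one.indicator (hs.preimage (by fun_prop)))]
  have : ∀ h : E N, ∫⁻ x, ((fun q : E N × E N => q.2 + q.1) ⁻¹' s).indicator 1 (h, x) = 0 := by
    intro h
    have e : ∀ x, ((fun q : E N × E N => q.2 + q.1) ⁻¹' s).indicator (1 : E N × E N → ℝ≥0∞) (h, x) =
      s.indicator 1 (x + h) := fun x => rfl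
    simp only [e]
    rw [lintegral_add_right_eq_self (s.indicator 1) h, lintegral_indicator_one hs, h0]
  simp [this]

theorem incr_congr_ae (hN : 1 ≤ N) (hp : 1 < p) (μ : Measure unitInterval) [IsFiniteMeasure μ]
    {u v : E N → ℝ} (h : u =ᵐ[volume] v) : incr u =ᵐ[fracMeasure N p μ] incr v := by
  filter_upwards [(quasiMeasurePreserving_fracMeasure_snd μ).ae h,
    (quasiMeasurePreserving_fracMeasure_add hN hp μ).ae h] with q h1 h2
  simp only [incr, h1, h2]

theorem aestronglyMeasurable_incr (hN : 1 ≤ N) (hp : 1 < p) (μ : Measure unitInterval)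
    [IsFiniteMeasure μ] {u : E N → ℝ} (hu : AEStronglyMeasurable u) :
    AEStronglyMeasurable (incr u) (fracMeasure N p μ) :=
  (hu.comp_quasiMeasurePreserving (quasiMeasurePreserving_fracMeasure_add hN hp μ)).sub
    (hu.comp_quasiMeasurePreserving (quasiMeasurePreserving_fracMeasure_snd μ))

/-- `g` is a weak gradient of `u`, if the order `1` occurs in the operator. -/
def HasGrad (μ : Measure unitInterval) (u : E N → ℝ) (g : E N → E N) : Prop :=
  μ {1} ≠ 0 → IsWeakGradient u g

/-- The interval splits into its endpoints and its interior. A measurable representative is needed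
for Tonelli in the middle term, and every seminorm is insensitive to that choice. -/
theorem energy_split (hN : 1 ≤ N) (hp : 1 < p) (μ : Measure unitInterval)
    [IsFiniteMeasure μ] {u : E N → ℝ} (hu : AEStronglyMeasurable u) :
    energy p μ u = μ {0} * (∫⁻ x, ‖u x‖ₑ ^ p) + ∫⁻ q, ‖incr u q‖ₑ ^ p ∂(fracMeasure N p μ) +
      μ {1} * seminormPow p 1 u := by
  have hv := hu.ae_eq_mk
  have hvm : Measurable (hu.mk u) := hu.stronglyMeasurable_mk.measurable
  have huniv : (univ : Set unitInterval) = ({0} ∪ Ioo 0 1) ∪ {1} := by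
    ext s
    simp only [mem_univ, mem_union, mem_singleton_iff, mem_Ioo, true_iff]
    rcases eq_or_ne s 0 with h | h
    · exact Or.inl (Or.inl h)
    rcases eq_or_ne s 1 with h' | h'
    · exact Or.inr h'
    · exact Or.inl (Or.inr ⟨unitInterval.pos_iff_ne_zero.2 h, unitInterval.lt_one_iff_ne_one.2 h'⟩)
  have e1 : ∫⁻ q, ‖incr u q‖ₑ ^ p ∂(fracMeasure N p μ) =
      ∫⁻ q, ‖incr (hu.mk u) q‖ₑ ^ p ∂(fracMeasure N p μ) :=
    lintegral_congr_ae ((incr_congr_ae hN hp μ hv).mono fun q hq => by simp only [hq])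
  have e2 : ∫⁻ s in Ioo (0 : unitInterval) 1, seminormPow p s u ∂μ =
      ∫⁻ s in Ioo (0 : unitInterval) 1, seminormPow p s (hu.mk u) ∂μ :=
    lintegral_congr fun s => seminormPow_congr_ae hv
  have e3 : seminormPow p 0 u = ∫⁻ x, ‖u x‖ₑ ^ p := by
    simp only [seminormPow, if_true, ofReal_abs_rpow hp]
  rw [e1, ← lintegral_frac_seminormPow hN hp μ hvm, ← e2, ← e3, energy, ← setLIntegral_univ,
    huniv, lintegral_union (measurableSet_singleton _) (by simp),
    lintegral_union measurableSet_Ioo (by simp), lintegral_singleton, lintegral_singleton,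
    mul_comm (μ {0}), mul_comm (μ {1})]

/-- The energy as a sum of three `L^p` norms. -/
theorem energy_eq (hN : 1 ≤ N) (hp : 1 < p) {μ : Measure unitInterval}
    [IsFiniteMeasure μ] {u : E N → ℝ} (hu : AEStronglyMeasurable u) {g : E N → E N}
    (hg : HasGrad μ u g) :
    energy p μ u = ∫⁻ x, ‖u x‖ₑ ^ p ∂(μ {0} • volume) +
      ∫⁻ q, ‖incr u q‖ₑ ^ p ∂(fracMeasure N p μ) + ∫⁻ x, ‖g x‖ₑ ^ p ∂(μ {1} • volume) := by
  rw [energy_split hN hp μ hu, lintegral_smul_measure, lintegral_smul_measure, smul_eq_mul,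
    smul_eq_mul]
  congr 1
  rcases eq_or_ne (μ {1}) 0 with h | h
  · simp [h]
  · congr 1
    have : ∃ g, IsWeakGradient u g := ⟨g, hg h⟩
    simp only [seminormPow, one_ne_zero, if_false, if_true, this]
    refine lintegral_congr_ae ?_
    filter_upwards [(hg h).weakGrad_ae_eq] with x hx
    rw [hx, ofReal_norm_rpow hp]

theorem exists_hasGrad (hN : 1 ≤ N) (hp : 1 < p) {μ : Measure unitInterval}
    [IsFiniteMeasure μ] {u : E N → ℝ} (hu : AEStronglyMeasurable u) (h : energy p μ u ≠ ⊤) :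
    ∃ g, HasGrad μ u g ∧ MemLp g (ENNReal.ofReal p) := by
  rcases eq_or_ne (μ {1}) 0 with h0 | h0
  · exact ⟨0, fun h => absurd h0 h, MemLp.zero⟩
  by_cases hex : ∃ g, IsWeakGradient u g
  · obtain ⟨g, hg⟩ := hex
    refine ⟨g, fun _ => hg, memLp_of_lintegral_rpow_ne_top (by linarith)
      hg.2.1.aestronglyMeasurable fun htop => h ?_⟩
    rw [energy_eq hN hp hu (fun _ => hg), lintegral_smul_measure (μ {1}), htop, smul_eq_mul,
      ENNReal.mul_top h0, add_top]
  -- Without a weak gradient the order `1` alone contributes `μ {1} * ⊤ = ⊤`.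
  · refine absurd ?_ h
    rw [energy_split hN hp μ hu]
    simp [seminormPow, hex, ENNReal.mul_top h0]

end Kernel

/-! ### Homogeneity and triangle inequality for `xNorm` -/

section EnergyNorm

variable {N : ℕ} {p : ℝ} {μ : Measure unitInterval} [IsFiniteMeasure μ]

theorem HasGrad.add {u v : E N → ℝ} {g k : E N → E N} (h : HasGrad μ u g) (h' : HasGrad μ v k) :
    HasGrad μ (fun x => u x + v x) (fun x => g x + k x) := fun h0 => (h h0).add (h' h0)

theorem HasGrad.sub {u v : E N → ℝ} {g k : E N → E N} (h : HasGrad μ u g) (h' : HasGrad μ v k) :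
    HasGrad μ (fun x => u x - v x) (fun x => g x - k x) := fun h0 => (h h0).sub (h' h0)

theorem HasGrad.const_smul {u : E N → ℝ} {g : E N → E N} (h : HasGrad μ u g) (c : ℝ) :
    HasGrad μ (fun x => c * u x) (fun x => c • g x) := fun h0 => (h h0).const_smul c

theorem energy_zero (hN : 1 ≤ N) (hp : 1 < p) : energy p μ (fun _ : E N => (0 : ℝ)) = 0 := by
  rw [energy_eq hN hp aestronglyMeasurable_const (g := fun _ => 0) fun _ => IsWeakGradient.zero]
  simp [incr, ENNReal.zero_rpow_of_pos (by linarith : 0 < p)]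

theorem lintegral_enorm_const_smul_rpow {α F : Type*} [MeasurableSpace α] {ν : Measure α}
    [NormedAddCommGroup F] [NormedSpace ℝ F] (hp : 1 < p) (c : ℝ) (f : α → F) :
    ∫⁻ x, ‖c • f x‖ₑ ^ p ∂ν = ‖c‖ₑ ^ p * ∫⁻ x, ‖f x‖ₑ ^ p ∂ν := by
  rw [← lintegral_const_mul' _ _ (ENNReal.rpow_ne_top_of_nonneg (by linarith) (by simp))]
  refine lintegral_congr fun x => ?_
  rw [enorm_smul, ENNReal.mul_rpow_of_nonneg _ _ (by linarith : (0 : ℝ) ≤ p)]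

theorem incr_const_mul (c : ℝ) (u : E N → ℝ) (q : E N × E N) :
    incr (fun x => c * u x) q = c • incr u q := by
  simp only [incr, smul_eq_mul]; ring

theorem energy_const_mul_le (hN : 1 ≤ N) (hp : 1 < p) {u : E N → ℝ} (hu : AEStronglyMeasurable u)
    (c : ℝ) : energy p μ (fun x => c * u x) ≤ ‖c‖ₑ ^ p * energy p μ u := by
  rcases eq_or_ne c 0 with rfl | hc
  · simp only [zero_mul, energy_zero hN hp]; exact zero_le
  by_cases h : energy p μ u = ⊤
  · rw [h, ENNReal.mul_top]
    · exact le_top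
    · simp [hc, ENNReal.rpow_eq_zero_iff]
  obtain ⟨g, hg, -⟩ := exists_hasGrad hN hp hu h
  rw [energy_eq hN hp hu hg, energy_eq hN hp (hu.const_mul c) (hg.const_smul c), mul_add, mul_add]
  have e1 : ∫⁻ x, ‖c * u x‖ₑ ^ p ∂(μ {0} • volume) = ‖c‖ₑ ^ p * ∫⁻ x, ‖u x‖ₑ ^ p ∂(μ {0} • volume) :=
    lintegral_enorm_const_smul_rpow hp c u
  simp only [incr_const_mul]
  rw [e1, lintegral_enorm_const_smul_rpow hp, lintegral_enorm_const_smul_rpow hp]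

theorem energy_const_mul (hN : 1 ≤ N) (hp : 1 < p) {u : E N → ℝ} (hu : AEStronglyMeasurable u)
    (c : ℝ) : energy p μ (fun x => c * u x) = ‖c‖ₑ ^ p * energy p μ u := by
  have hp0 : 0 < p := by linarith
  refine le_antisymm (energy_const_mul_le hN hp hu c) ?_
  rcases eq_or_ne c 0 with rfl | hc
  · simp [ENNReal.zero_rpow_of_pos hp0]
  -- The reverse inequality is the first one applied to `c u` with the factor `c⁻¹`; in this way
  -- infinite energies need no separate discussion.
  have h := energy_const_mul_le (μ := μ) hN hp (hu.const_mul c) c⁻¹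
  simp only [inv_mul_cancel_left₀ hc] at h
  calc ‖c‖ₑ ^ p * energy p μ u ≤ ‖c‖ₑ ^ p * (‖c⁻¹‖ₑ ^ p * energy p μ fun x => c * u x) := by gcongr
    _ = _ := by
      rw [← mul_assoc, ← ENNReal.mul_rpow_of_nonneg _ _ hp0.le, ← enorm_mul, mul_inv_cancel₀ hc,
        enorm_one, ENNReal.one_rpow, one_mul]

theorem rpow_add_three_le (hp : 1 < p) (a b c a' b' c' : ℝ≥0∞) :
    ((a + a') ^ p + (b + b') ^ p + (c + c') ^ p) ^ (1 / p) ≤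
      (a ^ p + b ^ p + c ^ p) ^ (1 / p) + (a' ^ p + b' ^ p + c' ^ p) ^ (1 / p) := by
  have := ENNReal.Lp_add_le Finset.univ ![a, b, c] ![a', b', c'] hp.le
  simpa [Fin.sum_univ_three] using this

/-- Minkowski in each of the three `L^p` spaces, then Minkowski in `ℓ^p` on three coordinates. This
needs gradients that add up, which exist once both energies are finite. -/
theorem energy_add_rpow_le (hN : 1 ≤ N) (hp : 1 < p) {u v : E N → ℝ}
    (hu : AEStronglyMeasurable u) (hv : AEStronglyMeasurable v) :
    energy p μ (fun x => u x + v x) ^ (1 / p) ≤ energy p μ u ^ (1 / p) + energy p μ v ^ (1 / p) := by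
  have hp0 : 0 < p := by linarith
  by_cases h1 : energy p μ u = ⊤
  · rw [h1, ENNReal.top_rpow_of_pos (by positivity), top_add]; exact le_top
  by_cases h2 : energy p μ v = ⊤
  · rw [h2, ENNReal.top_rpow_of_pos (by positivity), add_top]; exact le_top
  obtain ⟨g, hg, hgp⟩ := exists_hasGrad hN hp hu h1
  obtain ⟨k, hk, hkp⟩ := exists_hasGrad hN hp hv h2
  have huv : AEStronglyMeasurable (fun x => u x + v x) := hu.add hv
  rw [energy_eq hN hp hu hg, energy_eq hN hp hv hk, energy_eq hN hp huv (hg.add hk)]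
  simp only [← eLpNorm_ofReal_rpow hp0]
  refine le_trans ?_ (rpow_add_three_le hp _ _ _ _ _ _)
  have h1p := one_le_ofReal hp
  have hac : ∀ c : ℝ≥0∞, (c • (volume : Measure (E N))) ≪ volume := fun c =>
    Measure.smul_absolutelyContinuous
  gcongr
  · exact eLpNorm_add_le (hu.mono_ac (hac _)) (hv.mono_ac (hac _)) h1p
  · have e : incr (fun x => u x + v x) = incr u + incr v := by
      ext q; simp only [incr, Pi.add_apply]; ring
    rw [e]
    exact eLpNorm_add_le (aestronglyMeasurable_incr hN hp μ hu)
      (aestronglyMeasurable_incr hN hp μ hv) h1p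
  · exact eLpNorm_add_le (hgp.1.mono_ac (hac _)) (hkp.1.mono_ac (hac _)) h1p

theorem xNorm_eq (u : Fun N) : xNorm p μ u = energy p μ u ^ (1 / p) := rfl

theorem xNorm_rpow (hp : 1 < p) (u : Fun N) : xNorm p μ u ^ p = energy p μ u := by
  rw [xNorm_eq, ← ENNReal.rpow_mul, one_div_mul_cancel (by linarith), ENNReal.rpow_one]

theorem xNorm_lt_top_iff (hp : 1 < p) (u : Fun N) : xNorm p μ u < ⊤ ↔ energy p μ u < ⊤ :=
  ENNReal.rpow_lt_top_iff_of_pos (by positivity)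

theorem xNorm_smul (hN : 1 ≤ N) (hp : 1 < p) (c : ℝ) (u : Fun N) :
    xNorm p μ (c • u) = ‖c‖ₑ * xNorm p μ u := by
  have hp0 : 0 < p := by linarith
  rw [xNorm_eq, energy_congr_ae (v := fun x => c * u x) (AEEqFun.coeFn_smul c u),
    energy_const_mul hN hp u.aestronglyMeasurable, ENNReal.mul_rpow_of_nonneg _ _ (by positivity),
    ← ENNReal.rpow_mul, mul_one_div_cancel hp0.ne', ENNReal.rpow_one, xNorm_eq]

theorem xNorm_add_le (hN : 1 ≤ N) (hp : 1 < p) (u v : Fun N) :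
    xNorm p μ (u + v) ≤ xNorm p μ u + xNorm p μ v := by
  rw [xNorm_eq, energy_congr_ae (v := fun x => u x + v x) (AEEqFun.coeFn_add u v)]
  exact energy_add_rpow_le hN hp u.aestronglyMeasurable v.aestronglyMeasurable

end EnergyNorm

/-! ### The seminormed space `X_p(Ω) ∩ L^p` -/

section Space

variable (N : ℕ) (p : ℝ) (μ : Measure unitInterval) [IsFiniteMeasure μ] (Ω : Set (E N))
  [Fact (1 ≤ N)] [Fact (1 < p)]

/-- The functions of `X_p(Ω)` that lie in `L^p`. -/
def xSubmodule : Submodule ℝ (Fun N) where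
  carrier := {u | u ∈ X p μ Ω ∧ MemLp u (ENNReal.ofReal p)}
  add_mem' := by
    rintro u v ⟨⟨hu, hu'⟩, hup⟩ ⟨⟨hv, hv'⟩, hvp⟩
    refine ⟨⟨?_, (xNorm_add_le Fact.out Fact.out u v).trans_lt (ENNReal.add_lt_top.2 ⟨hu', hv'⟩)⟩,
      (memLp_congr_ae (AEEqFun.coeFn_add u v)).2 (hup.add hvp)⟩
    filter_upwards [hu, hv, AEEqFun.coeFn_add u v] with x h1 h2 h3 hx
    rw [h3, Pi.add_apply, h1 hx, h2 hx, add_zero]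
  zero_mem' := by
    refine ⟨⟨?_, ?_⟩, (memLp_congr_ae (AEEqFun.coeFn_zero (β := ℝ))).2 MemLp.zero⟩
    · filter_upwards [AEEqFun.coeFn_zero (μ := (volume : Measure (E N))) (β := ℝ)] with x hx _
      rw [hx]; rfl
    · have h0 := xNorm_smul (μ := μ) (p := p) Fact.out Fact.out 0 (0 : Fun N)
      rw [zero_smul, enorm_zero, zero_mul] at h0
      rw [h0]; exact ENNReal.zero_lt_top
  smul_mem' := by
    rintro c u ⟨⟨hu, hu'⟩, hup⟩
    refine ⟨⟨?_, ?_⟩, (memLp_congr_ae (AEEqFun.coeFn_smul c u)).2 (hup.const_smul c)⟩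
    · filter_upwards [hu, AEEqFun.coeFn_smul c u] with x h1 h3 hx
      rw [h3, Pi.smul_apply, h1 hx, smul_zero]
    · rw [xNorm_smul Fact.out Fact.out]
      exact ENNReal.mul_lt_top enorm_lt_top (show xNorm p μ u < ⊤ from hu')

/-- `X_p(Ω) ∩ L^p` with the seminorm of `X_p(Ω)`. -/
def W : Type := xSubmodule N p μ Ω

instance : AddCommGroup (W N p μ Ω) := inferInstanceAs (AddCommGroup (xSubmodule N p μ Ω))
instance : Module ℝ (W N p μ Ω) := inferInstanceAs (Module ℝ (xSubmodule N p μ Ω))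

variable {N p μ Ω}

/-- The underlying function class. -/
def W.val (u : W N p μ Ω) : Fun N := Subtype.val u

theorem W.ext {u v : W N p μ Ω} (h : u.val = v.val) : u = v := Subtype.ext h

/-- Bundling. -/
def W.mk (u : Fun N) (h : u ∈ X p μ Ω) (h' : MemLp u (ENNReal.ofReal p)) : W N p μ Ω := ⟨u, h, h'⟩

theorem W.mem_X (u : W N p μ Ω) : u.val ∈ X p μ Ω := u.2.1
theorem W.memLp (u : W N p μ Ω) : MemLp u.val (ENNReal.ofReal p) := u.2.2
theorem W.ae_eq_zero (u : W N p μ Ω) : ∀ᵐ x, x ∉ Ω → u.val x = 0 := u.2.1.1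
theorem W.xNorm_lt_top (u : W N p μ Ω) : xNorm p μ u.val < ⊤ := u.2.1.2
theorem W.energy_lt_top (u : W N p μ Ω) : energy p μ u.val < ⊤ :=
  (xNorm_lt_top_iff Fact.out _).1 u.xNorm_lt_top

@[simp] theorem W.val_add (u v : W N p μ Ω) : (u + v).val = u.val + v.val := rfl
@[simp] theorem W.val_sub (u v : W N p μ Ω) : (u - v).val = u.val - v.val := rfl
@[simp] theorem W.val_neg (u : W N p μ Ω) : (-u).val = -u.val := rfl
@[simp] theorem W.val_smul (c : ℝ) (u : W N p μ Ω) : (c • u).val = c • u.val := rfl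

instance : Norm (W N p μ Ω) := ⟨fun u => (xNorm p μ u.val).toReal⟩

theorem W.norm_def (u : W N p μ Ω) : ‖u‖ = (xNorm p μ u.val).toReal := rfl

theorem W.core : SeminormedSpace.Core ℝ (W N p μ Ω) where
  norm_nonneg _ := ENNReal.toReal_nonneg
  norm_smul c u := by
    rw [W.norm_def, W.norm_def, W.val_smul, xNorm_smul Fact.out Fact.out, ENNReal.toReal_mul,
      toReal_enorm]
  norm_triangle u v := by
    rw [W.norm_def, W.norm_def, W.norm_def, W.val_add,
      ← ENNReal.toReal_add u.xNorm_lt_top.ne v.xNorm_lt_top.ne]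
    exact ENNReal.toReal_mono (ENNReal.add_lt_top.2 ⟨u.xNorm_lt_top, v.xNorm_lt_top⟩).ne
      (xNorm_add_le Fact.out Fact.out _ _)

instance : SeminormedAddCommGroup (W N p μ Ω) := SeminormedAddCommGroup.ofCore W.core

instance : NormedSpace ℝ (W N p μ Ω) := ⟨fun c u => (W.core.norm_smul c u).le⟩

theorem W.ofReal_norm (u : W N p μ Ω) : ENNReal.ofReal ‖u‖ = xNorm p μ u.val :=
  ENNReal.ofReal_toReal u.xNorm_lt_top.ne

theorem W.ofReal_norm_rpow (u : W N p μ Ω) : ENNReal.ofReal (‖u‖ ^ p) = energy p μ u.val := by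
  have hp : 1 < p := Fact.out
  rw [← ENNReal.ofReal_rpow_of_nonneg (norm_nonneg _) (by linarith), W.ofReal_norm, xNorm_rpow hp]

/-- The `L^p` norm on `W`. -/
def W.lp (u : W N p μ Ω) : ℝ := (eLpNorm u.val (ENNReal.ofReal p) volume).toReal

theorem W.lp_nonneg (u : W N p μ Ω) : 0 ≤ u.lp := ENNReal.toReal_nonneg

theorem W.lp_smul (c : ℝ) (u : W N p μ Ω) : (c • u).lp = |c| * u.lp := by
  rw [W.lp, W.lp, W.val_smul, eLpNorm_congr_ae (AEEqFun.coeFn_smul c u.val), eLpNorm_const_smul,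
    ENNReal.toReal_mul, toReal_enorm, Real.norm_eq_abs]

theorem W.lp_add_le (u v : W N p μ Ω) : (u + v).lp ≤ u.lp + v.lp := by
  have hp : 1 < p := Fact.out
  rw [W.lp, W.lp, W.lp, W.val_add, eLpNorm_congr_ae (AEEqFun.coeFn_add u.val v.val),
    ← ENNReal.toReal_add u.memLp.2.ne v.memLp.2.ne]
  exact ENNReal.toReal_mono (ENNReal.add_lt_top.2 ⟨u.memLp.2, v.memLp.2⟩).ne
    (eLpNorm_add_le u.memLp.1 v.memLp.1 (one_le_ofReal hp))

theorem W.lp_neg (u : W N p μ Ω) : (-u).lp = u.lp := by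
  have := W.lp_smul (-1) u
  simpa using this

theorem W.abs_lp_sub_lp_le (u v : W N p μ Ω) : |u.lp - v.lp| ≤ (u - v).lp := by
  refine abs_le.2 ⟨?_, ?_⟩
  · have := W.lp_add_le u (-(u - v))
    rw [W.lp_neg, show u + -(u - v) = v by abel] at this
    linarith
  · have := W.lp_add_le v (u - v)
    rw [show v + (u - v) = u by abel] at this
    linarith

theorem W.ofReal_lp_rpow (u : W N p μ Ω) : ENNReal.ofReal (u.lp ^ p) = ∫⁻ x, ‖u.val x‖ₑ ^ p := by
  have hp : 1 < p := Fact.out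
  rw [← ENNReal.ofReal_rpow_of_nonneg u.lp_nonneg (by linarith), W.lp,
    ENNReal.ofReal_toReal u.memLp.2.ne, eLpNorm_ofReal_rpow (by linarith)]

theorem eLpNorm_restrict_eq {u : Fun N} (hu : ∀ᵐ x, x ∉ Ω → u x = 0) (hΩ : MeasurableSet Ω)
    (q : ℝ≥0∞) : eLpNorm u q (volume.restrict Ω) = eLpNorm u q volume := by
  rw [← eLpNorm_indicator_eq_eLpNorm_restrict hΩ]
  refine eLpNorm_congr_ae ?_
  filter_upwards [hu] with x hx
  by_cases h : x ∈ Ω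
  · rw [indicator_of_mem h]
  · rw [indicator_of_notMem h, hx h]

theorem W.mem_M_iff (hΩ : MeasurableSet Ω) (u : W N p μ Ω) : u.val ∈ M p μ Ω ↔ u.lp = 1 := by
  unfold M
  rw [mem_ofPred_eq, eLpNorm_restrict_eq u.ae_eq_zero hΩ, W.lp, ENNReal.toReal_eq_one_iff]
  exact and_iff_right u.mem_X

/-- The constraint bounds the norm over `Ω`, and the function vanishes elsewhere. So nothing is lost
by working in `W`. -/
theorem memLp_of_mem_M (hΩ : MeasurableSet Ω) {u : Fun N} (hu : u ∈ M p μ Ω) :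
    MemLp u (ENNReal.ofReal p) := by
  refine ⟨u.aestronglyMeasurable, ?_⟩
  rw [← eLpNorm_restrict_eq hu.1.1 hΩ, hu.2]
  exact ENNReal.one_lt_top

/-- An element of the constraint set, as an element of `W`. -/
def W.ofM (hΩ : MeasurableSet Ω) (u : Fun N) (hu : u ∈ M p μ Ω) : W N p μ Ω :=
  W.mk u hu.1 (memLp_of_mem_M hΩ hu)

theorem W.ofM_lp (hΩ : MeasurableSet Ω) {u : Fun N} (hu : u ∈ M p μ Ω) : (W.ofM hΩ u hu).lp = 1 :=
  (W.mem_M_iff hΩ _).1 hu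

theorem W.edist_eq (u v : W N p μ Ω) : edist u v = xNorm p μ (u.val - v.val) := by
  rw [edist_dist, dist_eq_norm, W.ofReal_norm, W.val_sub]

end Space

/-! ### Pointwise inequalities: hidden concavity and submodularity -/

section Pointwise

variable {p : ℝ}

/-- The combination `α a⁺ - β a⁻`. -/
def signComb (α β a : ℝ) : ℝ := α * max a 0 - β * max (-a) 0

theorem signComb_of_nonneg (α β : ℝ) {a : ℝ} (ha : 0 ≤ a) : signComb α β a = α * a := by
  simp [signComb, max_eq_left ha, max_eq_right (neg_nonpos.2 ha)]

theorem signComb_of_nonpos (α β : ℝ) {a : ℝ} (ha : a ≤ 0) : signComb α β a = β * a := by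
  simp [signComb, max_eq_right ha, max_eq_left (neg_nonneg.2 ha)]

/-- Minkowski in weighted `ℓ^p` on two points, for the vectors `(α₁ A, α₂ A)` and `(β₁ B, β₂ B)`
with weights `l`, `m`; their norms are `α A` and `β B`. It says that `(α A + β B) ^ p` is concave in
`(α ^ p, β ^ p)`. -/
theorem minkowski_two (hp : 1 < p) {l m α₁ α₂ β₁ β₂ α β A B : ℝ} (hl : 0 ≤ l) (hm : 0 ≤ m)
    (hα₁ : 0 ≤ α₁) (hα₂ : 0 ≤ α₂) (hβ₁ : 0 ≤ β₁) (hβ₂ : 0 ≤ β₂) (hα : 0 ≤ α) (hβ : 0 ≤ β)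
    (hA : 0 ≤ A) (hB : 0 ≤ B)
    (eα : α ^ p = l * α₁ ^ p + m * α₂ ^ p) (eβ : β ^ p = l * β₁ ^ p + m * β₂ ^ p) :
    l * (α₁ * A + β₁ * B) ^ p + m * (α₂ * A + β₂ * B) ^ p ≤ (α * A + β * B) ^ p := by
  have hp0 : 0 < p := by linarith
  have hl' : (l ^ (1 / p)) ^ p = l := by
    rw [← Real.rpow_mul hl, one_div_mul_cancel hp0.ne', Real.rpow_one]
  have hm' : (m ^ (1 / p)) ^ p = m := by
    rw [← Real.rpow_mul hm, one_div_mul_cancel hp0.ne', Real.rpow_one]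
  set L := l ^ (1 / p)
  set R := m ^ (1 / p)
  have hL : 0 ≤ L := by positivity
  have hR : 0 ≤ R := by positivity
  have key := Real.Lp_add_le_of_nonneg Finset.univ (f := ![L * (α₁ * A), R * (α₂ * A)])
    (g := ![L * (β₁ * B), R * (β₂ * B)]) hp.le (by
      intro i _; fin_cases i <;> simp <;> positivity) (by
      intro i _; fin_cases i <;> simp <;> positivity)
  simp only [Fin.sum_univ_two, Matrix.cons_val_zero, Matrix.cons_val_one,
    ← mul_add] at key
  rw [Real.mul_rpow hL (by positivity), Real.mul_rpow hR (by positivity),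
    Real.mul_rpow hL (by positivity), Real.mul_rpow hR (by positivity),
    Real.mul_rpow hL (by positivity), Real.mul_rpow hR (by positivity), hl', hm',
    Real.mul_rpow hα₁ hA, Real.mul_rpow hα₂ hA, Real.mul_rpow hβ₁ hB, Real.mul_rpow hβ₂ hB,
    ← mul_assoc, ← mul_assoc, ← mul_assoc, ← mul_assoc, ← add_mul, ← add_mul, ← eα, ← eβ,
    ← Real.mul_rpow hα hA, ← Real.mul_rpow hβ hB, ← Real.rpow_mul (by positivity),
    ← Real.rpow_mul (by positivity), mul_one_div_cancel hp0.ne', Real.rpow_one, Real.rpow_one]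
    at key
  have h0 : 0 ≤ l * (α₁ * A + β₁ * B) ^ p + m * (α₂ * A + β₂ * B) ^ p := by positivity
  calc _ = ((l * (α₁ * A + β₁ * B) ^ p + m * (α₂ * A + β₂ * B) ^ p) ^ (1 / p)) ^ p := by
        rw [← Real.rpow_mul h0, one_div_mul_cancel hp0.ne', Real.rpow_one]
    _ ≤ _ := Real.rpow_le_rpow (by positivity) key hp0.le

/-- If `a` and `b` have the same sign, a common coefficient factors out and equality holds. If the
signs differ, the increment is `α |a| + β |b|` up to exchanging the roles, and Minkowski applies. -/
theorem signComb_concave (hp : 1 < p) {l m α₁ α₂ β₁ β₂ α β : ℝ} (hl : 0 ≤ l) (hm : 0 ≤ m)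
    (hα₁ : 0 ≤ α₁) (hα₂ : 0 ≤ α₂) (hβ₁ : 0 ≤ β₁) (hβ₂ : 0 ≤ β₂) (hα : 0 ≤ α) (hβ : 0 ≤ β)
    (eα : α ^ p = l * α₁ ^ p + m * α₂ ^ p) (eβ : β ^ p = l * β₁ ^ p + m * β₂ ^ p) (a b : ℝ) :
    l * |signComb α₁ β₁ a - signComb α₁ β₁ b| ^ p + m * |signComb α₂ β₂ a - signComb α₂ β₂ b| ^ p ≤
      |signComb α β a - signComb α β b| ^ p := by
  have key : ∀ {x y : ℝ}, 0 ≤ x → y ≤ 0 →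
      l * |α₁ * x - β₁ * y| ^ p + m * |α₂ * x - β₂ * y| ^ p ≤ |α * x - β * y| ^ p := by
    intro x y hx hy
    have := minkowski_two hp hl hm hα₁ hα₂ hβ₁ hβ₂ hα hβ hx (neg_nonneg.2 hy) eα eβ
    have e : ∀ {α β : ℝ}, 0 ≤ α → 0 ≤ β → |α * x - β * y| = α * x + β * -y := by
      intro α β hα hβ
      rw [abs_of_nonneg]
      · ring
      · nlinarith [mul_nonneg hα hx, mul_nonneg hβ (neg_nonneg.2 hy)]
    rwa [e hα₁ hβ₁, e hα₂ hβ₂, e hα hβ]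
  rcases le_total 0 a with ha | ha <;> rcases le_total 0 b with hb | hb
  · simp only [signComb_of_nonneg _ _ ha, signComb_of_nonneg _ _ hb, ← mul_sub, abs_mul]
    rw [Real.mul_rpow (abs_nonneg _) (abs_nonneg _), Real.mul_rpow (abs_nonneg _) (abs_nonneg _),
      Real.mul_rpow (abs_nonneg _) (abs_nonneg _), abs_of_nonneg hα₁, abs_of_nonneg hα₂,
      abs_of_nonneg hα, eα]
    apply le_of_eq; ring
  · simp only [signComb_of_nonneg _ _ ha, signComb_of_nonpos _ _ hb]
    exact key ha hb
  · simp only [signComb_of_nonneg _ _ hb, signComb_of_nonpos _ _ ha]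
    have := key hb ha
    simpa only [abs_sub_comm] using this
  · simp only [signComb_of_nonpos _ _ ha, signComb_of_nonpos _ _ hb, ← mul_sub, abs_mul]
    rw [Real.mul_rpow (abs_nonneg _) (abs_nonneg _), Real.mul_rpow (abs_nonneg _) (abs_nonneg _),
      Real.mul_rpow (abs_nonneg _) (abs_nonneg _), abs_of_nonneg hβ₁, abs_of_nonneg hβ₂,
      abs_of_nonneg hβ, eβ]
    apply le_of_eq; ring

theorem abs_rpow_convexComb_le (hp : 1 < p) {l : ℝ} (h0 : 0 ≤ l) (h1 : l ≤ 1) (x y : ℝ) :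
    |l * x + (1 - l) * y| ^ p ≤ l * |x| ^ p + (1 - l) * |y| ^ p := by
  have h2 : 0 ≤ 1 - l := by linarith
  have := (convexOn_rpow hp.le).2 (abs_nonneg x) (abs_nonneg y) h0 h2 (by ring)
  simp only [smul_eq_mul] at this
  refine le_trans (Real.rpow_le_rpow (abs_nonneg _) ?_ (by linarith)) this
  refine (abs_add_le _ _).trans (le_of_eq ?_)
  rw [abs_mul, abs_mul, abs_of_nonneg h0, abs_of_nonneg h2]

/-- Both `s` and `t` are convex combinations of `x` and `y`, with complementary weights; the two
convexity inequalities add up. -/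
theorem abs_rpow_majorize (hp : 1 < p) {x y s t : ℝ} (hs : x ≤ s) (hs' : s ≤ y)
    (hst : s + t = x + y) : |s| ^ p + |t| ^ p ≤ |x| ^ p + |y| ^ p := by
  rcases hs.trans hs' |>.eq_or_lt with h | h
  · have e1 : s = x := by linarith
    have e2 : t = y := by linarith
    rw [e1, e2]
  · have hyx : 0 < y - x := by linarith
    set l := (y - s) / (y - x) with hl
    have l0 : 0 ≤ l := div_nonneg (by linarith) hyx.le
    have l1 : l ≤ 1 := (div_le_one hyx).2 (by linarith)
    have hly : l * (y - x) = y - s := div_mul_cancel₀ _ hyx.ne'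
    have es : s = l * x + (1 - l) * y := by linarith
    have et : t = l * y + (1 - l) * x := by linarith
    have h1 := abs_rpow_convexComb_le hp l0 l1 x y
    have h2 := abs_rpow_convexComb_le hp l0 l1 y x
    rw [← es] at h1
    rw [← et] at h2
    linarith

/-- Submodularity of `|·| ^ p` increments under pointwise maximum and minimum. -/
theorem abs_rpow_submodular (hp : 1 < p) (a b c d : ℝ) :
    |(a + max (c - a) 0) - (b + max (d - b) 0)| ^ p +
      |(c - max (c - a) 0) - (d - max (d - b) 0)| ^ p ≤ |a - b| ^ p + |c - d| ^ p := by
  -- If the order of the two functions is the same at both points, the increments are merely kept or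
  -- exchanged. If it flips, the new increments `a - d` and `c - b` have the same sum and lie
  -- between the old ones.
  rcases le_total c a with h1 | h1 <;> rcases le_total d b with h2 | h2
  · simp [max_eq_right (sub_nonpos.2 h1), max_eq_right (sub_nonpos.2 h2)]
  · rw [max_eq_right (sub_nonpos.2 h1), max_eq_left (sub_nonneg.2 h2)]
    have := abs_rpow_majorize hp (x := c - d) (y := a - b) (s := a - d) (t := c - b) (by linarith)
      (by linarith) (by ring)
    have e1 : a + 0 - (b + (d - b)) = a - d := by ring
    have e2 : c - 0 - (d - (d - b)) = c - b := by ring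
    rw [e1, e2]; linarith
  · rw [max_eq_left (sub_nonneg.2 h1), max_eq_right (sub_nonpos.2 h2)]
    have := abs_rpow_majorize hp (x := a - b) (y := c - d) (s := c - b) (t := a - d) (by linarith)
      (by linarith) (by ring)
    have e1 : a + (c - a) - (b + 0) = c - b := by ring
    have e2 : c - (c - a) - (d - 0) = a - d := by ring
    rw [e1, e2]; linarith
  · rw [max_eq_left (sub_nonneg.2 h1), max_eq_left (sub_nonneg.2 h2)]
    have e1 : a + (c - a) - (b + (d - b)) = c - d := by ring
    have e2 : c - (c - a) - (d - (d - b)) = a - b := by ring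
    rw [e1, e2]; linarith

end Pointwise

/-! ### Positive parts in the space `W` -/

section PosPart

variable {N : ℕ} {p : ℝ} {μ : Measure unitInterval} [IsFiniteMeasure μ] {Ω : Set (E N)}
  [Fact (1 ≤ N)] [Fact (1 < p)]

theorem HasGrad.posPart (hp : 1 < p) {u : E N → ℝ} {g : E N → E N}
    (h : HasGrad μ u g) (hu : MemLp u (ENNReal.ofReal p)) (hg : MemLp g (ENNReal.ofReal p))
    (hsupp : volume {x | u x ≠ 0} ≠ ⊤) :
    HasGrad μ (fun x => max (u x) 0) ({x | 0 < u x}.indicator g) :=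
  fun h0 => (h h0).posPart hp hu hg hsupp

theorem W.exists_grad (u : W N p μ Ω) :
    ∃ g, HasGrad μ u.val g ∧ Measurable g ∧ MemLp g (ENNReal.ofReal p) := by
  obtain ⟨g, hg, hgp⟩ := exists_hasGrad Fact.out Fact.out u.val.aestronglyMeasurable
    u.energy_lt_top.ne
  exact ⟨hgp.1.mk g, fun h0 => (hg h0).congr .rfl hgp.1.ae_eq_mk,
    hgp.1.stronglyMeasurable_mk.measurable, hgp.ae_eq hgp.1.ae_eq_mk⟩

/-- A measurable weak gradient of an element of `W` (irrelevant if the order `1` does not occur). -/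
def W.grad (u : W N p μ Ω) : E N → E N := u.exists_grad.choose

theorem W.hasGrad (u : W N p μ Ω) : HasGrad μ u.val u.grad := u.exists_grad.choose_spec.1
theorem W.measurable_grad (u : W N p μ Ω) : Measurable u.grad := u.exists_grad.choose_spec.2.1
theorem W.memLp_grad (u : W N p μ Ω) : MemLp u.grad (ENNReal.ofReal p) :=
  u.exists_grad.choose_spec.2.2
theorem W.measurable (u : W N p μ Ω) : Measurable u.val := u.val.stronglyMeasurable.measurable

theorem W.energy_eq (u : W N p μ Ω) {f : E N → ℝ} (hf : u.val =ᵐ[volume] f) {g : E N → E N}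
    (hg : HasGrad μ f g) :
    energy p μ u.val = ∫⁻ x, ‖f x‖ₑ ^ p ∂(μ {0} • volume) +
      ∫⁻ q, ‖incr f q‖ₑ ^ p ∂(fracMeasure N p μ) + ∫⁻ x, ‖g x‖ₑ ^ p ∂(μ {1} • volume) := by
  rw [energy_congr_ae hf, Superposition.energy_eq Fact.out Fact.out
    (u.val.aestronglyMeasurable.congr hf) hg]

theorem W.memLp_incr (u : W N p μ Ω) : MemLp (incr u.val) (ENNReal.ofReal p) (fracMeasure N p μ) := by
  have hp : 1 < p := Fact.out
  refine memLp_of_lintegral_rpow_ne_top (by linarith)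
    (aestronglyMeasurable_incr Fact.out hp μ u.val.aestronglyMeasurable) ?_
  have := u.energy_lt_top
  rw [u.energy_eq .rfl u.hasGrad] at this
  exact ((le_add_left le_rfl).trans_lt ((le_add_right le_rfl).trans_lt this)).ne

variable [Fact (volume Ω ≠ ⊤)]

theorem W.volume_support_ne_top (u : W N p μ Ω) : volume {x | u.val x ≠ 0} ≠ ⊤ := by
  have hΩ : volume Ω ≠ ⊤ := Fact.out
  have : volume {x | u.val x ≠ 0} ≤ volume Ω := by
    refine measure_mono_ae ?_
    filter_upwards [u.ae_eq_zero] with x hx h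
    by_contra hxΩ
    exact h (hx hxΩ)
  exact (this.trans_lt hΩ.lt_top).ne

theorem W.hasGrad_posPart (u : W N p μ Ω) :
    HasGrad μ (fun x => max (u.val x) 0) ({x | 0 < u.val x}.indicator u.grad) :=
  u.hasGrad.posPart Fact.out u.memLp u.memLp_grad u.volume_support_ne_top

theorem coeFn_sup_zero (u : Fun N) : ⇑(u ⊔ 0) =ᵐ[volume] fun x => max (u x) 0 := by
  filter_upwards [AEEqFun.coeFn_sup u 0, AEEqFun.coeFn_zero (μ := (volume : Measure (E N))) (β := ℝ)]
    with x h1 h2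
  rw [h1, h2]; rfl

theorem abs_max_sub_max_zero_le (a b : ℝ) : |max a 0 - max b 0| ≤ |a - b| :=
  abs_max_sub_max_le_abs a b 0

theorem enorm_rpow_mono (hp : 1 < p) {a b : ℝ} (h : |a| ≤ |b|) : ‖a‖ₑ ^ p ≤ ‖b‖ₑ ^ p := by
  rw [← ofReal_abs_rpow hp, ← ofReal_abs_rpow hp]
  exact ENNReal.ofReal_le_ofReal (Real.rpow_le_rpow (abs_nonneg _) h (by linarith))

/-- Truncation is `1`-Lipschitz, which handles values and increments; the gradient is only
multiplied by an indicator. -/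
theorem W.energy_posPart_le (u : W N p μ Ω) :
    energy p μ (fun x => max (u.val x) 0) ≤ energy p μ u.val := by
  have hp : 1 < p := Fact.out
  have hm : AEStronglyMeasurable (fun x => max (u.val x) 0) :=
    (u.measurable.max measurable_const).aestronglyMeasurable
  rw [Superposition.energy_eq Fact.out hp hm u.hasGrad_posPart, u.energy_eq .rfl u.hasGrad]
  refine add_le_add (add_le_add (lintegral_mono fun x => ?_) (lintegral_mono fun q => ?_))
    (lintegral_mono fun x => ?_)
  · exact enorm_rpow_mono hp (by simpa using abs_max_sub_max_zero_le (u.val x) 0)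
  · exact enorm_rpow_mono hp (abs_max_sub_max_zero_le _ _)
  · rw [indicator]
    split_ifs
    · exact le_rfl
    · simp [ENNReal.zero_rpow_of_pos (by linarith : 0 < p)]

/-- The positive part of an element of `W`. -/
def W.pos (u : W N p μ Ω) : W N p μ Ω :=
  W.mk (u.val ⊔ 0) ⟨by
      filter_upwards [u.ae_eq_zero, coeFn_sup_zero u.val] with x h1 h2 hx
      rw [h2, h1 hx, max_self], by
      rw [xNorm_lt_top_iff Fact.out, energy_congr_ae (coeFn_sup_zero u.val)]
      exact u.energy_posPart_le.trans_lt u.energy_lt_top⟩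
    ((memLp_congr_ae (coeFn_sup_zero u.val)).2 (memLp_max_zero u.memLp))

theorem W.coeFn_pos (u : W N p μ Ω) : u.pos.val =ᵐ[volume] fun x => max (u.val x) 0 :=
  coeFn_sup_zero u.val

theorem W.coeFn_add (u v : W N p μ Ω) : (u + v).val =ᵐ[volume] fun x => u.val x + v.val x :=
  AEEqFun.coeFn_add u.val v.val

theorem W.coeFn_sub (u v : W N p μ Ω) : (u - v).val =ᵐ[volume] fun x => u.val x - v.val x :=
  AEEqFun.coeFn_sub u.val v.val

theorem W.coeFn_neg (u : W N p μ Ω) : (-u).val =ᵐ[volume] fun x => -u.val x :=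
  AEEqFun.coeFn_neg u.val

theorem W.coeFn_smul (c : ℝ) (u : W N p μ Ω) : (c • u).val =ᵐ[volume] fun x => c * u.val x :=
  AEEqFun.coeFn_smul c u.val

end PosPart

/-! ### Energy and `L^p` norm of `α u⁺ - β u⁻` -/

section Lattice

variable {N : ℕ} {p : ℝ} {μ : Measure unitInterval} [IsFiniteMeasure μ] {Ω : Set (E N)}
  [Fact (1 ≤ N)] [Fact (1 < p)] [Fact (volume Ω ≠ ⊤)]

/-- The element `α u⁺ - β u⁻`. -/
def W.signComb (α β : ℝ) (u : W N p μ Ω) : W N p μ Ω := α • u.pos - β • (-u).pos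

theorem W.coeFn_neg_pos (u : W N p μ Ω) : (-u).pos.val =ᵐ[volume] fun x => max (-u.val x) 0 := by
  filter_upwards [(-u).coeFn_pos, u.coeFn_neg] with x h1 h2
  rw [h1, h2]

theorem W.coeFn_signComb (α β : ℝ) (u : W N p μ Ω) :
    (u.signComb α β).val =ᵐ[volume] fun x => Superposition.signComb α β (u.val x) := by
  filter_upwards [W.coeFn_sub (α • u.pos) (β • (-u).pos), W.coeFn_smul α u.pos,
    W.coeFn_smul β (-u).pos, u.coeFn_pos, u.coeFn_neg_pos] with x h1 h2 h3 h4 h5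
  rw [W.signComb, h1, h2, h3, h4, h5, Superposition.signComb]

/-- Gradient of `α u⁺ - β u⁻`. -/
def signGrad (α β : ℝ) (u : E N → ℝ) (g : E N → E N) (x : E N) : E N :=
  ({x | 0 < u x}.indicator (fun _ => α) x + {x | u x < 0}.indicator (fun _ => β) x) • g x

theorem W.hasGrad_signComb (α β : ℝ) (u : W N p μ Ω) :
    HasGrad μ (fun x => Superposition.signComb α β (u.val x)) (signGrad α β u.val u.grad) := by
  have hp : 1 < p := Fact.out
  have h1 := u.hasGrad_posPart.const_smul α
  have h2 : HasGrad μ (fun x => max (-1 * u.val x) 0)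
      ({x | 0 < -1 * u.val x}.indicator fun x => (-1 : ℝ) • u.grad x) :=
    (u.hasGrad.const_smul (-1)).posPart hp (u.memLp.const_mul (-1))
      (u.memLp_grad.const_smul (-1 : ℝ)) (by simpa using u.volume_support_ne_top)
  have h3 := h1.sub (h2.const_smul β)
  have e1 : (fun x => α * max (u.val x) 0 - β * max (-1 * u.val x) 0) =
      fun x => Superposition.signComb α β (u.val x) := by
    ext x; simp only [Superposition.signComb, neg_one_mul]
  have e2 : (fun x => α • {x | 0 < u.val x}.indicator u.grad x -
      β • {x | 0 < -1 * u.val x}.indicator (fun x => (-1 : ℝ) • u.grad x) x) =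
      signGrad α β u.val u.grad := by
    ext1 x
    simp only [signGrad, indicator, mem_ofPred_eq, neg_one_mul, Left.neg_pos_iff]
    by_cases ha : 0 < u.val x
    · simp [ha, not_lt.2 ha.le]
    · by_cases hb : u.val x < 0
      · simp [ha, hb]
      · simp [ha, hb]
  rwa [e1, e2] at h3

/-- Integrated form of a pointwise concavity bound; it is applied to each of the three pieces of the
energy. -/
theorem lintegral_concave_le {α F : Type*} [MeasurableSpace α] {ν : Measure α}
    [NormedAddCommGroup F] {f₁ f₂ f : α → F}
    (hf₁ : AEStronglyMeasurable f₁ ν) (hf₂ : AEStronglyMeasurable f₂ ν) {l m : ℝ}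
    (hl : 0 ≤ l) (hm : 0 ≤ m) (hp : 1 < p)
    (h : ∀ x, l * ‖f₁ x‖ ^ p + m * ‖f₂ x‖ ^ p ≤ ‖f x‖ ^ p) :
    ENNReal.ofReal l * ∫⁻ x, ‖f₁ x‖ₑ ^ p ∂ν + ENNReal.ofReal m * ∫⁻ x, ‖f₂ x‖ₑ ^ p ∂ν ≤
      ∫⁻ x, ‖f x‖ₑ ^ p ∂ν := by
  rw [← lintegral_const_mul'' _ (by fun_prop), ← lintegral_const_mul'' _ (by fun_prop),
    ← lintegral_add_left' (by fun_prop)]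
  refine lintegral_mono fun x => ?_
  simp only [← ofReal_norm_rpow hp]
  rw [← ENNReal.ofReal_mul hl, ← ENNReal.ofReal_mul hm,
    ← ENNReal.ofReal_add (by positivity) (by positivity)]
  exact ENNReal.ofReal_le_ofReal (h x)

theorem measurable_incr {u : E N → ℝ} (hu : Measurable u) : Measurable (incr u) :=
  (hu.comp (measurable_snd.add measurable_fst)).sub (hu.comp measurable_snd)

theorem measurable_signComb (α β : ℝ) : Measurable (Superposition.signComb α β) := by
  unfold Superposition.signComb; fun_prop

theorem W.measurable_signGrad (α β : ℝ) (u : W N p μ Ω) :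
    Measurable (signGrad α β u.val u.grad) := by
  have h1 := u.measurable
  have h2 := u.measurable_grad
  unfold signGrad
  exact ((Measurable.indicator (f := fun _ => α) measurable_const
    (measurableSet_lt measurable_const h1)).add (Measurable.indicator (f := fun _ => β)
      measurable_const (measurableSet_lt h1 measurable_const))).smul h2

/-- The order-zero and fractional pieces use the pointwise concavity of increments, the former with
second point `0`. The gradient piece is an equality, since the coefficient is `α` or `β` according
to the sign of `u`, and `0` where `u` vanishes. -/
theorem W.norm_signComb_concave {l m α₁ α₂ β₁ β₂ α β : ℝ} (hl : 0 ≤ l) (hm : 0 ≤ m)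
    (hα₁ : 0 ≤ α₁) (hα₂ : 0 ≤ α₂) (hβ₁ : 0 ≤ β₁) (hβ₂ : 0 ≤ β₂) (hα : 0 ≤ α) (hβ : 0 ≤ β)
    (eα : α ^ p = l * α₁ ^ p + m * α₂ ^ p) (eβ : β ^ p = l * β₁ ^ p + m * β₂ ^ p)
    (u : W N p μ Ω) :
    l * ‖u.signComb α₁ β₁‖ ^ p + m * ‖u.signComb α₂ β₂‖ ^ p ≤ ‖u.signComb α β‖ ^ p := by
  have hp : 1 < p := Fact.out
  have hp0 : p ≠ 0 := by linarith
  refine (ENNReal.ofReal_le_ofReal_iff (by positivity)).1 ?_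
  rw [ENNReal.ofReal_add (by positivity) (by positivity), ENNReal.ofReal_mul hl,
    ENNReal.ofReal_mul hm, W.ofReal_norm_rpow, W.ofReal_norm_rpow, W.ofReal_norm_rpow,
    W.energy_eq _ (u.coeFn_signComb α₁ β₁) (u.hasGrad_signComb α₁ β₁),
    W.energy_eq _ (u.coeFn_signComb α₂ β₂) (u.hasGrad_signComb α₂ β₂),
    W.energy_eq _ (u.coeFn_signComb α β) (u.hasGrad_signComb α β)]
  have hm1 : ∀ α β, Measurable fun x => Superposition.signComb α β (u.val x) := fun α β =>
    (measurable_signComb α β).comp u.measurable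
  have hm2 : ∀ α β, Measurable (incr fun x => Superposition.signComb α β (u.val x)) := fun α β =>
    measurable_incr (hm1 α β)
  have hm3 := fun α β => u.measurable_signGrad α β
  have t1 := lintegral_concave_le (ν := μ {0} • volume) (hm1 α₁ β₁).aestronglyMeasurable
    (hm1 α₂ β₂).aestronglyMeasurable hl hm hp
    (f := fun x => Superposition.signComb α β (u.val x)) fun x => by
      have := signComb_concave hp hl hm hα₁ hα₂ hβ₁ hβ₂ hα hβ eα eβ (u.val x) 0
      simpa [Superposition.signComb] using this
  have t2 := lintegral_concave_le (ν := fracMeasure N p μ) (hm2 α₁ β₁).aestronglyMeasurable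
    (hm2 α₂ β₂).aestronglyMeasurable hl hm hp
    (f := incr fun x => Superposition.signComb α β (u.val x)) fun q =>
      signComb_concave hp hl hm hα₁ hα₂ hβ₁ hβ₂ hα hβ eα eβ _ _
  have t3 := lintegral_concave_le (ν := μ {1} • volume) (hm3 α₁ β₁).aestronglyMeasurable
    (hm3 α₂ β₂).aestronglyMeasurable hl hm hp (f := signGrad α β u.val u.grad) fun x => by
      simp only [signGrad, norm_smul, Real.norm_eq_abs, indicator, mem_ofPred_eq]
      rw [Real.mul_rpow (abs_nonneg _) (norm_nonneg _), Real.mul_rpow (abs_nonneg _) (norm_nonneg _),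
        Real.mul_rpow (abs_nonneg _) (norm_nonneg _)]
      by_cases ha : 0 < u.val x
      · simp only [ha, if_true, not_lt.2 ha.le, if_false, add_zero, abs_of_nonneg hα₁,
          abs_of_nonneg hα₂, abs_of_nonneg hα, eα]
        apply le_of_eq; ring
      · by_cases hb : u.val x < 0
        · simp only [ha, if_true, hb, if_false, zero_add, abs_of_nonneg hβ₁,
            abs_of_nonneg hβ₂, abs_of_nonneg hβ, eβ]
          apply le_of_eq; ring
        · simp [ha, hb, Real.zero_rpow hp0]
  refine le_trans (le_of_eq ?_) (add_le_add (add_le_add t1 t2) t3)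
  ring

theorem lintegral_signComb_rpow (hp : 1 < p) {α β : ℝ} (hα : 0 ≤ α) (hβ : 0 ≤ β) {u : E N → ℝ}
    (hu : Measurable u) :
    ∫⁻ x, ‖Superposition.signComb α β (u x)‖ₑ ^ p =
      ENNReal.ofReal (α ^ p) * (∫⁻ x, ‖max (u x) 0‖ₑ ^ p) +
        ENNReal.ofReal (β ^ p) * ∫⁻ x, ‖max (-u x) 0‖ₑ ^ p := by
  have hp0 : 0 < p := by linarith
  rw [← lintegral_const_mul _ (by fun_prop), ← lintegral_const_mul _ (by fun_prop),
    ← lintegral_add_left (by fun_prop)]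
  refine lintegral_congr fun x => ?_
  simp only [← ofReal_abs_rpow hp]
  rw [← ENNReal.ofReal_mul (by positivity), ← ENNReal.ofReal_mul (by positivity),
    ← ENNReal.ofReal_add (by positivity) (by positivity)]
  congr 1
  rcases le_total 0 (u x) with h | h
  · rw [signComb_of_nonneg _ _ h, max_eq_left h, max_eq_right (neg_nonpos.2 h), abs_mul,
      Real.mul_rpow (abs_nonneg _) (abs_nonneg _), abs_of_nonneg hα, abs_zero,
      Real.zero_rpow hp0.ne', mul_zero, add_zero]
  · rw [signComb_of_nonpos _ _ h, max_eq_right h, max_eq_left (neg_nonneg.2 h), abs_mul,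
      Real.mul_rpow (abs_nonneg _) (abs_nonneg _), abs_of_nonneg hβ, abs_zero,
      Real.zero_rpow hp0.ne', mul_zero, zero_add, abs_neg]

theorem W.lp_signComb {α β : ℝ} (hα : 0 ≤ α) (hβ : 0 ≤ β) (u : W N p μ Ω) :
    (u.signComb α β).lp ^ p = α ^ p * u.pos.lp ^ p + β ^ p * (-u).pos.lp ^ p := by
  have hp : 1 < p := Fact.out
  have h0 := u.pos.lp_nonneg
  have h1 := (-u).pos.lp_nonneg
  have h2 := (u.signComb α β).lp_nonneg
  refine (ENNReal.ofReal_eq_ofReal_iff (by positivity) (by positivity)).1 ?_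
  rw [ENNReal.ofReal_add (by positivity) (by positivity), ENNReal.ofReal_mul (by positivity),
    ENNReal.ofReal_mul (by positivity), W.ofReal_lp_rpow, W.ofReal_lp_rpow, W.ofReal_lp_rpow]
  have e1 : ∫⁻ x, ‖(u.signComb α β).val x‖ₑ ^ p =
      ∫⁻ x, ‖Superposition.signComb α β (u.val x)‖ₑ ^ p :=
    lintegral_congr_ae ((u.coeFn_signComb α β).mono fun x hx => by simp only [hx])
  have e2 : ∫⁻ x, ‖u.pos.val x‖ₑ ^ p = ∫⁻ x, ‖max (u.val x) 0‖ₑ ^ p :=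
    lintegral_congr_ae (u.coeFn_pos.mono fun x hx => by simp only [hx])
  have e3 : ∫⁻ x, ‖(-u).pos.val x‖ₑ ^ p = ∫⁻ x, ‖max (-u.val x) 0‖ₑ ^ p :=
    lintegral_congr_ae (u.coeFn_neg_pos.mono fun x hx => by simp only [hx])
  rw [e1, e2, e3, lintegral_signComb_rpow hp hα hβ u.measurable]

theorem W.signComb_one_one (u : W N p μ Ω) : u.signComb 1 1 = u := by
  refine W.ext (AEEqFun.ext ?_)
  filter_upwards [u.coeFn_signComb 1 1] with x hx
  rw [hx]
  rcases le_total 0 (u.val x) with h | h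
  · rw [signComb_of_nonneg _ _ h, one_mul]
  · rw [signComb_of_nonpos _ _ h, one_mul]

end Lattice

/-! ### Submodularity of the energy under maximum and minimum -/

section Submodular

variable {N : ℕ} {p : ℝ} {μ : Measure unitInterval} [IsFiniteMeasure μ] {Ω : Set (E N)}
  [Fact (1 ≤ N)] [Fact (1 < p)] [Fact (volume Ω ≠ ⊤)]

/-- Pointwise maximum. -/
def W.sup (u v : W N p μ Ω) : W N p μ Ω := u + (v - u).pos

/-- Pointwise minimum. -/
def W.inf (u v : W N p μ Ω) : W N p μ Ω := v - (v - u).pos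

theorem W.coeFn_sub_pos (u v : W N p μ Ω) :
    (v - u).pos.val =ᵐ[volume] fun x => max (v.val x - u.val x) 0 := by
  filter_upwards [(v - u).coeFn_pos, W.coeFn_sub v u] with x h1 h2
  rw [h1, h2]

theorem W.coeFn_sup (u v : W N p μ Ω) :
    (u.sup v).val =ᵐ[volume] fun x => u.val x + max (v.val x - u.val x) 0 := by
  filter_upwards [W.coeFn_add u (v - u).pos, W.coeFn_sub_pos u v] with x h1 h2
  rw [W.sup, h1, h2]

theorem W.coeFn_inf (u v : W N p μ Ω) :
    (u.inf v).val =ᵐ[volume] fun x => v.val x - max (v.val x - u.val x) 0 := by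
  filter_upwards [W.coeFn_sub v (v - u).pos, W.coeFn_sub_pos u v] with x h1 h2
  rw [W.inf, h1, h2]

theorem W.hasGrad_sub_pos (u v : W N p μ Ω) :
    HasGrad μ (fun x => max (v.val x - u.val x) 0)
      ({x | 0 < v.val x - u.val x}.indicator fun x => v.grad x - u.grad x) := by
  refine (v.hasGrad.sub u.hasGrad).posPart Fact.out (v.memLp.sub u.memLp)
    (v.memLp_grad.sub u.memLp_grad) ?_
  refine ((measure_mono ?_).trans_lt (measure_union_lt_top v.volume_support_ne_top.lt_top
    u.volume_support_ne_top.lt_top)).ne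
  intro x hx
  by_contra h
  simp only [mem_union, mem_ofPred_eq, not_or, not_not] at h
  exact hx (by rw [h.1, h.2, sub_zero])

theorem lintegral_add_le_add {α F : Type*} [MeasurableSpace α] {ν : Measure α}
    [NormedAddCommGroup F] {f₁ f₂ k₁ k₂ : α → F}
    (hf₁ : AEStronglyMeasurable f₁ ν) (hk₁ : AEStronglyMeasurable k₁ ν) (hp : 1 < p)
    (h : ∀ x, ‖f₁ x‖ ^ p + ‖f₂ x‖ ^ p ≤ ‖k₁ x‖ ^ p + ‖k₂ x‖ ^ p) :
    ∫⁻ x, ‖f₁ x‖ₑ ^ p ∂ν + ∫⁻ x, ‖f₂ x‖ₑ ^ p ∂ν ≤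
      ∫⁻ x, ‖k₁ x‖ₑ ^ p ∂ν + ∫⁻ x, ‖k₂ x‖ₑ ^ p ∂ν := by
  rw [← lintegral_add_left' (by fun_prop), ← lintegral_add_left' (by fun_prop)]
  refine lintegral_mono fun x => ?_
  simp only [← ofReal_norm_rpow hp]
  rw [← ENNReal.ofReal_add (by positivity) (by positivity),
    ← ENNReal.ofReal_add (by positivity) (by positivity)]
  exact ENNReal.ofReal_le_ofReal (h x)

/-- Only the fractional piece can be strict: values and gradients of the maximum and minimum are, at
each point, those of `u` and `v` in some order. -/
theorem W.norm_sup_add_norm_inf_le (u v : W N p μ Ω) :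
    ‖u.sup v‖ ^ p + ‖u.inf v‖ ^ p ≤ ‖u‖ ^ p + ‖v‖ ^ p := by
  have hp : 1 < p := Fact.out
  have hu := u.measurable
  have hv := v.measurable
  have hug := u.measurable_grad
  have hvg := v.measurable_grad
  refine (ENNReal.ofReal_le_ofReal_iff (by positivity)).1 ?_
  rw [ENNReal.ofReal_add (by positivity) (by positivity),
    ENNReal.ofReal_add (by positivity) (by positivity), W.ofReal_norm_rpow, W.ofReal_norm_rpow,
    W.ofReal_norm_rpow, W.ofReal_norm_rpow,
    W.energy_eq _ (u.coeFn_sup v) (u.hasGrad.add (u.hasGrad_sub_pos v)),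
    W.energy_eq _ (u.coeFn_inf v) (v.hasGrad.sub (u.hasGrad_sub_pos v)),
    W.energy_eq u .rfl u.hasGrad, W.energy_eq v .rfl v.hasGrad]
  have hs : Measurable fun x => u.val x + max (v.val x - u.val x) 0 := by fun_prop
  have t1 := lintegral_add_le_add (ν := μ {0} • volume) hs.aestronglyMeasurable
    hu.aestronglyMeasurable (f₂ := fun x => v.val x - max (v.val x - u.val x) 0)
    (k₂ := v.val) hp fun x => by
      have := abs_rpow_submodular hp (u.val x) 0 (v.val x) 0
      simpa using this
  have t2 := lintegral_add_le_add (ν := fracMeasure N p μ) (measurable_incr hs).aestronglyMeasurable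
    (measurable_incr hu).aestronglyMeasurable
    (f₂ := incr fun x => v.val x - max (v.val x - u.val x) 0) (k₂ := incr v.val) hp fun q =>
      abs_rpow_submodular hp _ _ _ _
  have hA : MeasurableSet {x | 0 < v.val x - u.val x} :=
    measurableSet_lt measurable_const (hv.sub hu)
  have t3 := lintegral_add_le_add (ν := μ {1} • volume)
    (hug.add ((hvg.sub hug).indicator hA)).aestronglyMeasurable hug.aestronglyMeasurable
    (f₂ := fun x => v.grad x -
      {x | 0 < v.val x - u.val x}.indicator (fun x => v.grad x - u.grad x) x)
    (k₂ := v.grad) hp fun x => by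
      simp only [Pi.add_apply, indicator, Pi.sub_apply]
      split_ifs
      · rw [add_sub_cancel, sub_sub_cancel, add_comm]
      · rw [add_zero, sub_zero]
  refine le_trans (le_of_eq ?_) ((add_le_add (add_le_add t1 t2) t3).trans (le_of_eq ?_))
  · simp only [Pi.add_apply]; ring!
  · ring

theorem W.lp_sup_add_lp_inf (u v : W N p μ Ω) :
    (u.sup v).lp ^ p + (u.inf v).lp ^ p = u.lp ^ p + v.lp ^ p := by
  have hp : 1 < p := Fact.out
  have h1 := (u.sup v).lp_nonneg
  have h2 := (u.inf v).lp_nonneg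
  have h3 := u.lp_nonneg
  have h4 := v.lp_nonneg
  refine (ENNReal.ofReal_eq_ofReal_iff (by positivity) (by positivity)).1 ?_
  rw [ENNReal.ofReal_add (by positivity) (by positivity),
    ENNReal.ofReal_add (by positivity) (by positivity), W.ofReal_lp_rpow, W.ofReal_lp_rpow,
    W.ofReal_lp_rpow, W.ofReal_lp_rpow, ← lintegral_add_left (by have := (u.sup v).measurable; fun_prop),
    ← lintegral_add_left (by have := u.measurable; fun_prop)]
  refine lintegral_congr_ae ?_
  filter_upwards [u.coeFn_sup v, u.coeFn_inf v] with x a1 a2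
  rw [a1, a2]
  rcases le_total (u.val x) (v.val x) with h | h
  · rw [max_eq_left (sub_nonneg.2 h), add_sub_cancel, sub_sub_cancel, add_comm]
  · rw [max_eq_right (sub_nonpos.2 h), add_zero, sub_zero]

theorem W.lp_mono {u v : W N p μ Ω} (h : ∀ᵐ x, |u.val x| ≤ |v.val x|) : u.lp ≤ v.lp :=
  ENNReal.toReal_mono v.memLp.2.ne (eLpNorm_mono_ae h)

theorem W.lp_le_lp_sup_left {u v : W N p μ Ω} (hu : ∀ᵐ x, 0 ≤ u.val x) :
    u.lp ≤ (u.sup v).lp := by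
  refine W.lp_mono ?_
  filter_upwards [hu, u.coeFn_sup v] with x h1 h2
  rw [h2, abs_of_nonneg h1, abs_of_nonneg (by positivity)]
  exact le_add_of_nonneg_right (le_max_right _ _)

theorem W.lp_le_lp_sup_right {u v : W N p μ Ω} (hv : ∀ᵐ x, 0 ≤ v.val x) :
    v.lp ≤ (u.sup v).lp := by
  refine W.lp_mono ?_
  filter_upwards [hv, u.coeFn_sup v] with x h1 h2
  have h3 : v.val x ≤ u.val x + max (v.val x - u.val x) 0 := by
    linarith [le_max_left (v.val x - u.val x) 0]
  rw [h2, abs_of_nonneg h1, abs_of_nonneg (h1.trans h3)]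
  exact h3

end Submodular

/-! ### Continuity of the positive part along lines -/

section Continuity

variable {N : ℕ} {p : ℝ} {μ : Measure unitInterval} [IsFiniteMeasure μ] {Ω : Set (E N)}
  [Fact (1 ≤ N)] [Fact (1 < p)] [Fact (volume Ω ≠ ⊤)]

theorem tendsto_lintegral_rpow_zero_of_dominated {α F : Type*} [MeasurableSpace α] {ν : Measure α}
    [NormedAddCommGroup F] [MeasurableSpace F] [OpensMeasurableSpace F] (hp : 1 < p)
    {f : ℝ → α → F} {t₀ : ℝ} {b : α → ℝ}
    (hf : ∀ t, Measurable (f t)) (hb : MemLp b (ENNReal.ofReal p) ν)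
    (hfb : ∀ t, |t - t₀| ≤ 1 → ∀ x, ‖f t x‖ ≤ b x)
    (hlim : ∀ᵐ x ∂ν, Tendsto (fun t => ‖f t x‖) (𝓝 t₀) (𝓝 0)) :
    Tendsto (fun t => ∫⁻ x, ‖f t x‖ₑ ^ p ∂ν) (𝓝 t₀) (𝓝 0) := by
  have hp0 : 0 < p := by linarith
  have h := tendsto_lintegral_filter_of_dominated_convergence (μ := ν) (l := 𝓝 t₀)
    (F := fun t x => ‖f t x‖ₑ ^ p) (f := fun _ => 0) (fun x => ‖b x‖ₑ ^ p)
    (Eventually.of_forall fun t => (hf t).enorm.pow_const p) ?_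
    (lintegral_rpow_ne_top_of_memLp hp0 hb) ?_
  · simpa using h
  · filter_upwards [Metric.closedBall_mem_nhds t₀ one_pos] with t ht
    refine Eventually.of_forall fun x => ?_
    refine ENNReal.rpow_le_rpow ?_ hp0.le
    rw [← ofReal_norm, ← ofReal_norm]
    exact ENNReal.ofReal_le_ofReal ((hfb t ht x).trans (le_abs_self _))
  · filter_upwards [hlim] with x hx
    have h1 : Tendsto (fun t => ‖f t x‖ₑ) (𝓝 t₀) (𝓝 0) := by
      have := ENNReal.tendsto_ofReal hx
      simpa only [ofReal_norm, ENNReal.ofReal_zero] using this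
    have h2 := ((ENNReal.continuous_rpow_const (y := p)).tendsto 0).comp h1
    rwa [ENNReal.zero_rpow_of_pos hp0] at h2

theorem W.coeFn_affine_pos (u v : W N p μ Ω) (t : ℝ) :
    (u + t • v).pos.val =ᵐ[volume] fun x => max (u.val x + t * v.val x) 0 := by
  filter_upwards [(u + t • v).coeFn_pos, W.coeFn_add u (t • v), W.coeFn_smul t v] with x h1 h2 h3
  rw [h1, h2, h3]

/-- The positive part is continuous along lines. -/
theorem W.continuous_affine_pos (u v : W N p μ Ω) : Continuous fun t : ℝ => (u + t • v).pos := by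
  have hp : 1 < p := Fact.out
  have hp0 : 0 < p := by linarith
  have hu := u.measurable
  have hv := v.measurable
  have hug := u.measurable_grad
  have hvg := v.measurable_grad
  refine continuous_iff_continuousAt.2 fun t₀ => ?_
  refine tendsto_iff_edist_tendsto_0.2 ?_
  -- `F t` and `G t` represent the difference of the two positive parts and its gradient; each of
  -- the three energies of this difference tends to `0` by dominated convergence.
  let F : ℝ → E N → ℝ := fun t x => max (u.val x + t * v.val x) 0 - max (u.val x + t₀ * v.val x) 0
  let A : ℝ → Set (E N) := fun t => {x | 0 < u.val x + t * v.val x}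
  let G : ℝ → E N → E N := fun t x => (A t).indicator (fun x => u.grad x + t • v.grad x) x -
    (A t₀).indicator (fun x => u.grad x + t₀ • v.grad x) x
  have hsupp : ∀ t, volume {x | u.val x + t * v.val x ≠ 0} ≠ ⊤ := fun t => by
    refine ((measure_mono ?_).trans_lt (measure_union_lt_top v.volume_support_ne_top.lt_top
      u.volume_support_ne_top.lt_top)).ne
    intro x hx
    by_contra h
    simp only [mem_union, mem_ofPred_eq, not_or, not_not] at h
    exact hx (by rw [h.1, h.2, mul_zero, zero_add])
  have hgrad : ∀ t, HasGrad μ (fun x => u.val x + t * v.val x) (fun x => u.grad x + t • v.grad x) :=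
    fun t => u.hasGrad.add (v.hasGrad.const_smul t)
  have hlp : ∀ t : ℝ, MemLp (fun x => u.val x + t * v.val x) (ENNReal.ofReal p) := fun t =>
    u.memLp.add (v.memLp.const_mul t)
  have hlpg : ∀ t : ℝ, MemLp (fun x => u.grad x + t • v.grad x) (ENNReal.ofReal p) := fun t =>
    u.memLp_grad.add (v.memLp_grad.const_smul t)
  have hG : ∀ t, HasGrad μ (F t) (G t) := fun t =>
    ((hgrad t).posPart hp (hlp t) (hlpg t) (hsupp t)).sub
      ((hgrad t₀).posPart hp (hlp t₀) (hlpg t₀) (hsupp t₀))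
  have hF : ∀ t, ((u + t • v).pos - (u + t₀ • v).pos).val =ᵐ[volume] F t := fun t => by
    filter_upwards [W.coeFn_sub (u + t • v).pos (u + t₀ • v).pos, W.coeFn_affine_pos u v t,
      W.coeFn_affine_pos u v t₀] with x h1 h2 h3
    rw [h1, h2, h3]
  have hFm : ∀ t, Measurable (F t) := fun t => by simp only [F]; fun_prop
  have hAm : ∀ t, MeasurableSet (A t) := fun t => measurableSet_lt measurable_const (by fun_prop)
  have hGm : ∀ t, Measurable (G t) := fun t =>
    ((hug.add (hvg.const_smul t)).indicator (hAm t)).sub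
      ((hug.add (hvg.const_smul t₀)).indicator (hAm t₀))
  -- Bounds `|t| + |t₀|` when `|t - t₀| ≤ 1`; it is the coefficient of the `v` term in the
  -- majorants.
  set C : ℝ := 2 * |t₀| + 1 with hC
  have hbound : ∀ t, |t - t₀| ≤ 1 → |t| + |t₀| ≤ C := fun t ht => by
    have := abs_sub_abs_le_abs_sub t t₀
    linarith
  have hFlim : ∀ x, Tendsto (fun t => F t x) (𝓝 t₀) (𝓝 0) := fun x => by
    have : Continuous fun t => F t x := by simp only [F]; fun_prop
    simpa [F] using this.tendsto t₀
  have hac : ∀ c : ℝ≥0∞, (c • (volume : Measure (E N))) ≪ volume := fun c =>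
    Measure.smul_absolutelyContinuous
  have hsm : ∀ {f : E N → ℝ} {c : ℝ≥0∞}, c ≠ ⊤ → MemLp f (ENNReal.ofReal p) →
      MemLp f (ENNReal.ofReal p) (c • volume) := fun hc hf => hf.smul_measure hc
  have t1 : Tendsto (fun t => ∫⁻ x, ‖F t x‖ₑ ^ p ∂(μ {0} • volume)) (𝓝 t₀) (𝓝 0) := by
    refine tendsto_lintegral_rpow_zero_of_dominated hp (b := fun x => |v.val x|) hFm
      (hsm (measure_ne_top _ _) v.memLp.abs) (fun t ht x => ?_)
      (Eventually.of_forall fun x => by simpa using (hFlim x).norm)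
    refine (abs_max_sub_max_zero_le _ _).trans ?_
    rw [show u.val x + t * v.val x - (u.val x + t₀ * v.val x) = (t - t₀) * v.val x by ring, abs_mul]
    exact mul_le_of_le_one_left (abs_nonneg _) ht
  have t2 : Tendsto (fun t => ∫⁻ q, ‖incr (F t) q‖ₑ ^ p ∂(fracMeasure N p μ)) (𝓝 t₀) (𝓝 0) := by
    refine tendsto_lintegral_rpow_zero_of_dominated hp
      (b := fun q => 2 * |incr u.val q| + C * |incr v.val q|) (fun t => measurable_incr (hFm t))
      ((u.memLp_incr.abs.const_mul 2).add (v.memLp_incr.abs.const_mul C)) (fun t ht q => ?_)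
      (Eventually.of_forall fun q => ?_)
    · have hs : ∀ s : ℝ, |max (u.val (q.2 + q.1) + s * v.val (q.2 + q.1)) 0 -
          max (u.val q.2 + s * v.val q.2) 0| ≤ |incr u.val q| + |s| * |incr v.val q| := fun s => by
        refine (abs_max_sub_max_zero_le _ _).trans ?_
        rw [← abs_mul]
        refine le_trans (le_of_eq ?_) (abs_add_le _ _)
        simp only [incr]; congr 1; ring
      have e : incr (F t) q = (max (u.val (q.2 + q.1) + t * v.val (q.2 + q.1)) 0 -
          max (u.val q.2 + t * v.val q.2) 0) - (max (u.val (q.2 + q.1) + t₀ * v.val (q.2 + q.1)) 0 -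
          max (u.val q.2 + t₀ * v.val q.2) 0) := by simp only [incr, F]; ring
      rw [e, Real.norm_eq_abs]
      have h1 := abs_sub (max (u.val (q.2 + q.1) + t * v.val (q.2 + q.1)) 0 -
          max (u.val q.2 + t * v.val q.2) 0) (max (u.val (q.2 + q.1) + t₀ * v.val (q.2 + q.1)) 0 -
          max (u.val q.2 + t₀ * v.val q.2) 0)
      have h2 := mul_le_mul_of_nonneg_right (hbound t ht) (abs_nonneg (incr v.val q))
      linarith [hs t, hs t₀]
    · have : Tendsto (fun t => incr (F t) q) (𝓝 t₀) (𝓝 0) := by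
        simpa [incr] using (hFlim (q.2 + q.1)).sub (hFlim q.2)
      simpa using this.norm
  have t3 : Tendsto (fun t => ∫⁻ x, ‖G t x‖ₑ ^ p ∂(μ {1} • volume)) (𝓝 t₀) (𝓝 0) := by
    rcases eq_or_ne (μ {1}) 0 with h0 | h0
    · simp [h0]
    refine tendsto_lintegral_rpow_zero_of_dominated hp
      (b := fun x => 2 * ‖u.grad x‖ + C * ‖v.grad x‖) hGm
      (hsm (measure_ne_top _ _) ((u.memLp_grad.norm.const_mul 2).add
        (v.memLp_grad.norm.const_mul C))) (fun t ht x => ?_) ?_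
    · have hs : ∀ s : ℝ, ‖(A s).indicator (fun x => u.grad x + s • v.grad x) x‖ ≤
          ‖u.grad x‖ + |s| * ‖v.grad x‖ := fun s => by
        refine (norm_indicator_le_norm_self _ _).trans ?_
        refine (norm_add_le _ _).trans (le_of_eq ?_)
        rw [norm_smul, Real.norm_eq_abs]
      have h1 := norm_sub_le ((A t).indicator (fun x => u.grad x + t • v.grad x) x)
        ((A t₀).indicator (fun x => u.grad x + t₀ • v.grad x) x)
      have h2 := mul_le_mul_of_nonneg_right (hbound t ht) (norm_nonneg (v.grad x))
      have := hs t
      have := hs t₀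
      simp only [G]
      linarith
    · refine (hac _).ae_le ?_
      -- The indicator in the gradient may jump at `t₀` where `u + t₀ v = 0`. There the gradient of
      -- `u + t₀ v` vanishes almost everywhere, so the jump does no harm.
      filter_upwards [(hgrad t₀ h0).ae_eq_zero_of_eq_zero hp (hlp t₀) (hlpg t₀) (hsupp t₀)]
        with x hx
      have hc1 : Continuous fun t : ℝ => u.val x + t * v.val x := by fun_prop
      have hc2 : Continuous fun t : ℝ => u.grad x + t • v.grad x := by fun_prop
      have hlim : Tendsto (fun t => G t x) (𝓝 t₀) (𝓝 0) := by
        rcases lt_trichotomy (u.val x + t₀ * v.val x) 0 with h | h | h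
        · refine tendsto_const_nhds.congr' ?_
          filter_upwards [hc1.continuousAt.eventually_lt continuousAt_const h] with t ht
          have i1 : x ∉ A t := not_lt.2 ht.le
          have i2 : x ∉ A t₀ := not_lt.2 h.le
          simp only [G, indicator_of_notMem i1, indicator_of_notMem i2, sub_zero]
        · have i2 : x ∉ A t₀ := not_lt.2 h.le
          refine squeeze_zero_norm (a := fun t => ‖u.grad x + t • v.grad x‖) (fun t => ?_) ?_
          · simp only [G, indicator_of_notMem i2, sub_zero]
            exact norm_indicator_le_norm_self (fun x => u.grad x + t • v.grad x) x
          · have := hc2.norm.tendsto t₀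
            simpa [hx h] using this
        · have i2 : x ∈ A t₀ := h
          have : Tendsto (fun t : ℝ => (u.grad x + t • v.grad x) - (u.grad x + t₀ • v.grad x))
              (𝓝 t₀) (𝓝 0) := by
            have := (hc2.sub continuous_const).tendsto (x := t₀) (f := fun t : ℝ =>
              (u.grad x + t • v.grad x) - (u.grad x + t₀ • v.grad x))
            simpa using this
          refine this.congr' ?_
          filter_upwards [continuousAt_const.eventually_lt hc1.continuousAt h] with t ht
          have i1 : x ∈ A t := ht
          simp only [G, indicator_of_mem i1, indicator_of_mem i2]
      simpa using hlim.norm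
  have hE : Tendsto (fun t => energy p μ ((u + t • v).pos - (u + t₀ • v).pos).val) (𝓝 t₀) (𝓝 0) := by
    have := (t1.add t2).add t3
    simp only [add_zero] at this
    exact this.congr fun t => (W.energy_eq _ (hF t) (hG t)).symm
  have := ((ENNReal.continuous_rpow_const (y := 1 / p)).tendsto 0).comp hE
  rw [ENNReal.zero_rpow_of_pos (by positivity)] at this
  exact this.congr fun t => by rw [W.edist_eq, ← W.val_sub, xNorm_eq]; rfl

end Continuity

/-! ### Paths inside sublevel sets of the constraint set -/

section Paths

variable {N : ℕ} {p : ℝ} {μ : Measure unitInterval} [IsFiniteMeasure μ] {Ω : Set (E N)}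
  [Fact (1 ≤ N)] [Fact (1 < p)]

/-- The sublevel set `{u ∈ 𝓜 : ‖u‖ ≤ L}`. -/
def sublevel (N : ℕ) (p : ℝ) (μ : Measure unitInterval) [IsFiniteMeasure μ] (Ω : Set (E N))
    [Fact (1 ≤ N)] [Fact (1 < p)] (L : ℝ) : Set (W N p μ Ω) := {u | u.lp = 1 ∧ ‖u‖ ≤ L}

theorem sublevel_mono {L L' : ℝ} (h : L ≤ L') : sublevel N p μ Ω L ⊆ sublevel N p μ Ω L' :=
  fun _ hu => ⟨hu.1, hu.2.trans h⟩

theorem joinedIn_of_continuous {Y : Type*} [TopologicalSpace Y] {F : Set Y} {f : ℝ → Y}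
    (hf : Continuous f) {a b : ℝ} (h : ∀ t ∈ uIcc a b, f t ∈ F) : JoinedIn F (f a) (f b) := by
  refine JoinedIn.ofLine (f := fun s => f (AffineMap.lineMap a b s))
    (hf.comp AffineMap.lineMap_continuous).continuousOn (by simp) (by simp) ?_
  rintro _ ⟨s, hs, rfl⟩
  refine h _ ?_
  rw [← segment_eq_uIcc, segment_eq_image_lineMap]
  exact ⟨s, hs, rfl⟩

theorem W.lp_normalize {u : W N p μ Ω} (hu : 0 < u.lp) : (u.lp⁻¹ • u).lp = 1 := by
  rw [W.lp_smul, abs_of_pos (inv_pos.2 hu), inv_mul_cancel₀ hu.ne']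

theorem W.continuous_lp_of_lipschitz {f : ℝ → W N p μ Ω} {C : ℝ}
    (h : ∀ s t, (f s - f t).lp ≤ C * |s - t|) : Continuous fun t => (f t).lp := by
  refine continuous_iff_continuousAt.2 fun t₀ => ?_
  refine tendsto_iff_dist_tendsto_zero.2 ?_
  refine squeeze_zero (fun _ => dist_nonneg) (g := fun t => C * |t - t₀|) (fun t => ?_) ?_
  · exact (W.abs_lp_sub_lp_le _ _).trans (h t t₀)
  · have : Continuous fun t : ℝ => C * |t - t₀| := by fun_prop
    simpa using this.tendsto t₀

/-- Continuity of the `L^p` norm along the path is a separate hypothesis, since the seminorm of `W`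
has not been shown to control it; a Lipschitz bound is at hand in every use. -/
theorem joinedIn_normalized {f : ℝ → W N p μ Ω} (hf : Continuous f) {C : ℝ}
    (hl : ∀ s t, (f s - f t).lp ≤ C * |s - t|) (hpos : ∀ t ∈ Icc (0 : ℝ) 1, 0 < (f t).lp) {L : ℝ}
    (hL : ∀ t ∈ Icc (0 : ℝ) 1, ‖f t‖ ≤ L * (f t).lp) (h0 : (f 0).lp = 1) (h1 : (f 1).lp = 1) :
    JoinedIn (sublevel N p μ Ω L) (f 0) (f 1) := by
  have hlp := W.continuous_lp_of_lipschitz hl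
  refine JoinedIn.ofLine (f := fun t => (f t).lp⁻¹ • f t) ?_ (by simp [h0]) (by simp [h1]) ?_
  · have h : ContinuousOn (fun t => (f t).lp⁻¹) (Icc 0 1) :=
      hlp.continuousOn.inv₀ fun t ht => (hpos t ht).ne'
    exact h.smul hf.continuousOn
  · rintro _ ⟨t, ht, rfl⟩
    refine ⟨W.lp_normalize (hpos t ht), ?_⟩
    rw [norm_smul, Real.norm_of_nonneg (inv_nonneg.2 (f t).lp_nonneg),
      inv_mul_le_iff₀ (hpos t ht), mul_comm]
    exact hL t ht

/-- Points of `𝓜` close in `L^p` are joined by a normalized segment. -/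
theorem joinedIn_segment {u v : W N p μ Ω} (hu : u.lp = 1) (hv : v.lp = 1) {L₁ L δ : ℝ}
    (hL0 : 0 ≤ L) (hδ : (u - v).lp ≤ δ) (hδ1 : δ < 1) (huL : ‖u‖ ≤ L₁) (hvL : ‖v‖ ≤ L₁)
    (hL : L₁ ≤ L * (1 - δ)) : JoinedIn (sublevel N p μ Ω L) u v := by
  -- Closeness is required in `L^p` only. The norm of `W` is convex along the segment, and the
  -- normalizing factor is at most `1 / (1 - δ)`.
  have hlow : ∀ t ∈ Icc (0 : ℝ) 1, 1 - δ ≤ (u + t • (v - u)).lp := by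
    intro t ht
    have h1 := W.abs_lp_sub_lp_le u (u + t • (v - u))
    rw [show u - (u + t • (v - u)) = t • (u - v) by module, W.lp_smul, hu, abs_of_nonneg ht.1] at h1
    have h2 : t * (u - v).lp ≤ δ :=
      (mul_le_of_le_one_left (u - v).lp_nonneg ht.2).trans hδ
    have h3 := (abs_le.1 h1).2
    linarith
  have hj := joinedIn_normalized (f := fun t : ℝ => u + t • (v - u)) (by fun_prop)
    (C := (v - u).lp) (L := L) (fun s t => ?_) (fun t ht => ?_) (fun t ht => ?_) (by simpa using hu)
    (by simpa using hv)
  · simpa using hj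
  · rw [show u + s • (v - u) - (u + t • (v - u)) = (s - t) • (v - u) by module, W.lp_smul, mul_comm]
  · linarith [hlow t ht]
  · have h1 : ‖u + t • (v - u)‖ ≤ L₁ := by
      rw [show u + t • (v - u) = (1 - t) • u + t • v by module]
      refine (norm_add_le _ _).trans ?_
      rw [norm_smul, norm_smul, Real.norm_of_nonneg ht.1,
        Real.norm_of_nonneg (sub_nonneg.2 ht.2)]
      have h2 : 0 ≤ 1 - t := sub_nonneg.2 ht.2
      calc (1 - t) * ‖u‖ + t * ‖v‖ ≤ (1 - t) * L₁ + t * L₁ := by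
            gcongr; exact ht.1
        _ = L₁ := by ring
    have h2 := mul_le_mul_of_nonneg_left (hlow t ht) hL0
    linarith

variable [Fact (volume Ω ≠ ⊤)]

theorem W.pos_of_nonneg {u : W N p μ Ω} (hu : ∀ᵐ x, 0 ≤ u.val x) : u.pos = u := by
  refine W.ext (AEEqFun.ext ?_)
  filter_upwards [u.coeFn_pos, hu] with x h1 h2
  rw [h1, max_eq_left h2]

theorem W.neg_pos_of_nonneg {u : W N p μ Ω} (hu : ∀ᵐ x, 0 ≤ u.val x) : (-u).pos = 0 := by
  refine W.ext (AEEqFun.ext ?_)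
  filter_upwards [u.coeFn_neg_pos, hu, AEEqFun.coeFn_zero (μ := (volume : Measure (E N))) (β := ℝ)]
    with x h1 h2 h3
  rw [h1, max_eq_right (neg_nonpos.2 h2)]
  exact h3.symm

theorem W.eq_zero_of_lp_eq_zero {u : W N p μ Ω} (hu : u.lp = 0) : ∀ᵐ x, u.val x = 0 := by
  have hp : 1 < p := Fact.out
  have h : eLpNorm u.val (ENNReal.ofReal p) volume = 0 :=
    (ENNReal.toReal_eq_zero_iff _).1 hu |>.resolve_right u.memLp.2.ne
  exact (eLpNorm_eq_zero_iff u.memLp.1 (by simp; linarith)).1 h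

theorem W.nonneg_of_lp_neg_pos_eq_zero {u : W N p μ Ω} (hu : (-u).pos.lp = 0) :
    ∀ᵐ x, 0 ≤ u.val x := by
  filter_upwards [W.eq_zero_of_lp_eq_zero hu, u.coeFn_neg_pos] with x h1 h2
  rw [h2] at h1
  have := le_max_left (-u.val x) 0
  linarith

/-- A constrained local minimizer can be joined to its normalized positive part without increasing
the energy: the energy is concave along `α u⁺ - β u⁻` in the variables `(α^p, β^p)`. -/
theorem exists_nonneg_joinedIn {u : W N p μ Ω} (hu : u.lp = 1) {L : ℝ} (hL : ‖u‖ < L)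
    (hmin : ∀ v, JoinedIn (sublevel N p μ Ω L) u v → ‖u‖ ≤ ‖v‖) (hpos : u.pos.lp ≠ 0) :
    ∃ w : W N p μ Ω, JoinedIn (sublevel N p μ Ω L) u w ∧ ‖w‖ ≤ ‖u‖ ∧ ∀ᵐ x, 0 ≤ w.val x := by
  have hp : 1 < p := Fact.out
  have hp0 : 0 < p := by linarith
  rcases eq_or_ne (-u).pos.lp 0 with hneg | hneg
  · exact ⟨u, JoinedIn.refl ⟨hu, hL.le⟩, le_rfl, W.nonneg_of_lp_neg_pos_eq_zero hneg⟩
  set A : ℝ := u.pos.lp ^ p with hA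
  set B : ℝ := (-u).pos.lp ^ p with hB
  have hA0 : 0 < A := Real.rpow_pos_of_pos (lt_of_le_of_ne u.pos.lp_nonneg hpos.symm) _
  have hB0 : 0 < B := Real.rpow_pos_of_pos (lt_of_le_of_ne (-u).pos.lp_nonneg hneg.symm) _
  have hAB : A + B = 1 := by
    have := u.lp_signComb zero_le_one zero_le_one
    rw [u.signComb_one_one, hu, Real.one_rpow, one_mul, one_mul] at this
    exact this.symm
  -- The coefficients are chosen so that `α ^ p * A = t` and `β ^ p * B = 1 - t`: the curve stays
  -- normalized, passes through `u` at `t = A`, and ends at a multiple of `u⁺` at `t = 1`.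
  let α : ℝ → ℝ := fun t => (t / A) ^ (1 / p)
  let β : ℝ → ℝ := fun t => ((1 - t) / B) ^ (1 / p)
  have hα : ∀ t, 0 ≤ t → 0 ≤ α t ∧ α t ^ p = t / A := fun t ht =>
    ⟨by positivity, by
      rw [← Real.rpow_mul (by positivity), one_div_mul_cancel hp0.ne', Real.rpow_one]⟩
  have hβ : ∀ t, t ≤ 1 → 0 ≤ β t ∧ β t ^ p = (1 - t) / B := fun t ht => by
    have : 0 ≤ (1 - t) / B := div_nonneg (by linarith) hB0.le
    exact ⟨by positivity, by
      rw [← Real.rpow_mul this, one_div_mul_cancel hp0.ne', Real.rpow_one]⟩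
  let f : ℝ → W N p μ Ω := fun t => u.signComb (α t) (β t)
  have hf : Continuous f := by
    have h1 : Continuous α := (Real.continuous_rpow_const (by positivity)).comp (by fun_prop)
    have h2 : Continuous β := (Real.continuous_rpow_const (by positivity)).comp (by fun_prop)
    simp only [f, W.signComb]
    fun_prop
  have hfA : f A = u := by
    have e1 : α A = 1 := by simp only [α, div_self hA0.ne', Real.one_rpow]
    have e2 : β A = 1 := by
      simp only [β, show 1 - A = B by linarith, div_self hB0.ne', Real.one_rpow]
    simp only [f, e1, e2, u.signComb_one_one]
  have hflp : ∀ t ∈ Icc (0 : ℝ) 1, (f t).lp = 1 := fun t ht => by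
    have h := u.lp_signComb (hα t ht.1).1 (hβ t ht.2).1
    rw [(hα t ht.1).2, (hβ t ht.2).2, ← hA, ← hB, div_mul_cancel₀ _ hA0.ne',
      div_mul_cancel₀ _ hB0.ne', add_sub_cancel] at h
    have h' : (f t).lp ^ p = 1 ^ p := by rw [Real.one_rpow]; exact h
    exact (Real.rpow_left_inj (f t).lp_nonneg zero_le_one hp0.ne').1 h'
  obtain ⟨δ, hδ, hball⟩ : ∃ δ > 0, ∀ t, |t - A| < δ → ‖f t‖ < L := by
    have : ∀ᶠ t in 𝓝 A, ‖f t‖ < L :=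
      hf.norm.continuousAt.eventually_lt continuousAt_const (by rwa [hfA])
    exact Metric.eventually_nhds_iff.1 this
  -- Near `t = A` the curve stays in the sublevel set, hence in the component of `u`, where `u` is
  -- minimal.
  have hloc : ∀ t ∈ Icc (0 : ℝ) 1, |t - A| < δ → ‖u‖ ≤ ‖f t‖ := by
    intro t ht htδ
    refine hmin _ ?_
    rw [← hfA]
    refine joinedIn_of_continuous hf fun s hs => ?_
    have hAI : A ∈ Icc (0 : ℝ) 1 := ⟨hA0.le, by linarith⟩
    refine ⟨hflp s (uIcc_subset_Icc hAI ht hs), (hball s ?_).le⟩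
    exact (abs_sub_left_of_mem_uIcc hs).trans_lt htδ
  have hglob : ∀ t ∈ Icc (0 : ℝ) 1, ‖f t‖ ≤ ‖u‖ := by
    intro t ht
    -- Small enough that the point `t'`, reflected through `A` and scaled by `η`, stays in `[0,1]`
    -- and within `δ` of `A`. Then `A` is a convex combination of `t` and `t'`, and concavity
    -- together with `‖u‖ ≤ ‖f t'‖` forces `‖f t‖ ≤ ‖u‖`.
    set η : ℝ := min (δ / 2) (min A B) with hη
    have hη0 : 0 < η := lt_min (by linarith) (lt_min hA0 hB0)
    have hη1 : η ≤ δ / 2 := min_le_left _ _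
    have hη2 : η ≤ A := (min_le_right _ _).trans (min_le_left _ _)
    have hη3 : η ≤ B := (min_le_right _ _).trans (min_le_right _ _)
    have htA : |t - A| ≤ 1 := abs_le.2 ⟨by linarith [ht.1], by linarith [ht.2]⟩
    have hηt : |η * (t - A)| ≤ η := by
      rw [abs_mul, abs_of_pos hη0]; exact mul_le_of_le_one_right hη0.le htA
    obtain ⟨hηt1, hηt2⟩ := abs_le.1 hηt
    set t' : ℝ := A - η * (t - A) with ht'
    have ht'I : t' ∈ Icc (0 : ℝ) 1 := ⟨by linarith, by linarith⟩
    have ht'A : |t' - A| < δ := by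
      rw [ht', show A - η * (t - A) - A = -(η * (t - A)) by ring, abs_neg]
      linarith
    have h1 := hloc t' ht'I ht'A
    set l : ℝ := η / (1 + η) with hl
    set m : ℝ := 1 / (1 + η) with hm
    have hlm : l + m = 1 := by rw [hl, hm]; field_simp; ring
    have hl0 : 0 < l := by positivity
    have hm0 : 0 < m := by positivity
    have hcomb : l * t + m * t' = A := by rw [hl, hm, ht']; field_simp; ring
    have hAI : A ≤ 1 := by linarith
    have hc := u.norm_signComb_concave hl0.le hm0.le (hα t ht.1).1 (hα t' ht'I.1).1 (hβ t ht.2).1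
      (hβ t' ht'I.2).1 (hα A hA0.le).1 (hβ A hAI).1
      (by rw [(hα A hA0.le).2, (hα t ht.1).2, (hα t' ht'I.1).2]
          rw [mul_div_assoc', mul_div_assoc', ← add_div, hcomb])
      (by rw [(hβ A hAI).2, (hβ t ht.2).2, (hβ t' ht'I.2).2]
          rw [mul_div_assoc', mul_div_assoc', ← add_div]
          congr 1
          linear_combination -hlm + hcomb)
    change l * ‖f t‖ ^ p + m * ‖f t'‖ ^ p ≤ ‖f A‖ ^ p at hc
    rw [hfA] at hc
    have h2 : ‖u‖ ^ p ≤ ‖f t'‖ ^ p := Real.rpow_le_rpow (norm_nonneg _) h1 hp0.le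
    have h3 : l * ‖f t‖ ^ p ≤ l * ‖u‖ ^ p := by
      have h4 := mul_le_mul_of_nonneg_left h2 hm0.le
      have h5 : ‖u‖ ^ p = l * ‖u‖ ^ p + m * ‖u‖ ^ p := by rw [← add_mul, hlm, one_mul]
      linarith
    exact (Real.rpow_le_rpow_iff (norm_nonneg _) (norm_nonneg _) hp0).1
      (le_of_mul_le_mul_left h3 hl0)
  refine ⟨f 1, ?_, hglob 1 ⟨zero_le_one, le_rfl⟩, ?_⟩
  · rw [← hfA]
    refine joinedIn_of_continuous hf fun s hs => ?_
    have hs' : s ∈ Icc (0 : ℝ) 1 :=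
      uIcc_subset_Icc ⟨hA0.le, by linarith⟩ ⟨zero_le_one, le_rfl⟩ hs
    exact ⟨hflp s hs', by rw [hfA] at *; exact (hglob s hs').trans hL.le⟩
  · have hβ1 : β 1 = 0 := by
      simp only [β, sub_self, zero_div]
      exact Real.zero_rpow (by positivity)
    filter_upwards [u.coeFn_signComb (α 1) (β 1)] with x hx
    rw [hx, hβ1, Superposition.signComb, zero_mul, sub_zero]
    exact mul_nonneg (hα 1 zero_le_one).1 (le_max_right _ _)

/-- A nonnegative element of `𝓜` is joined to a nonnegative global minimizer without increasing the
energy, along normalized maxima. -/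
theorem joinedIn_nonneg_minimizer {w e : W N p μ Ω} (hw : w.lp = 1) (he : e.lp = 1)
    (hw0 : ∀ᵐ x, 0 ≤ w.val x) (he0 : ∀ᵐ x, 0 ≤ e.val x)
    (hmin : ∀ v : W N p μ Ω, v.lp = 1 → ‖e‖ ≤ ‖v‖) : JoinedIn (sublevel N p μ Ω ‖w‖) w e := by
  have hp : 1 < p := Fact.out
  have hp0 : 0 < p := by linarith
  -- The homogeneous form of minimality; it bounds the energy of the minimum of the two functions
  -- from below.
  have hmin' : ∀ v : W N p μ Ω, ‖e‖ ^ p * v.lp ^ p ≤ ‖v‖ ^ p := by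
    intro v
    rcases v.lp_nonneg.eq_or_lt' with h | h
    · rw [h, Real.zero_rpow hp0.ne', mul_zero]; positivity
    · have h1 := hmin _ (W.lp_normalize h)
      rw [norm_smul, Real.norm_of_nonneg (inv_nonneg.2 v.lp_nonneg), le_inv_mul_iff₀ h] at h1
      rw [← Real.mul_rpow (norm_nonneg _) v.lp_nonneg, mul_comm]
      exact Real.rpow_le_rpow (mul_nonneg h.le (norm_nonneg _)) h1 hp0.le
  -- This is the maximum of `(1 - t) w` and `t e`, written as a positive part along a line so that
  -- the continuity lemma applies.
  let f : ℝ → W N p μ Ω := fun t => (1 - t) • w + (-w + t • (e + w)).pos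
  have hfs : ∀ t, f t = ((1 - t) • w).sup (t • e) := fun t => by
    simp only [f, W.sup]
    congr 2
    module
  have hf : Continuous f := by
    have := W.continuous_affine_pos (-w) (e + w)
    simp only [f]
    fun_prop
  have hlip : ∀ s t, (f s - f t).lp ≤ (w.lp + (e + w).lp) * |s - t| := by
    intro s t
    have e1 : f s - f t = (t - s) • w +
        ((-w + s • (e + w)).pos - (-w + t • (e + w)).pos) := by simp only [f]; module
    rw [e1]
    refine (W.lp_add_le _ _).trans ?_
    rw [add_mul, W.lp_smul, abs_sub_comm t s, mul_comm w.lp]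
    gcongr
    rw [mul_comm, ← W.lp_smul]
    refine W.lp_mono ?_
    filter_upwards [W.coeFn_sub (-w + s • (e + w)).pos (-w + t • (e + w)).pos,
      W.coeFn_affine_pos (-w) (e + w) s, W.coeFn_affine_pos (-w) (e + w) t,
      W.coeFn_smul (s - t) (e + w)] with x h1 h2 h3 h4
    rw [h1, h2, h3, h4]
    refine (abs_max_sub_max_zero_le _ _).trans (le_of_eq ?_)
    congr 1; ring
  have hf0 : f 0 = w := by
    simp only [f, sub_zero, one_smul, zero_smul, add_zero, W.neg_pos_of_nonneg hw0]
  have hf1 : f 1 = e := by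
    simp only [f, sub_self, zero_smul, one_smul, zero_add, neg_add_cancel_comm_assoc,
      W.pos_of_nonneg he0]
  have hsm0 : ∀ {c : ℝ} {v : W N p μ Ω}, 0 ≤ c → (∀ᵐ x, 0 ≤ v.val x) →
      ∀ᵐ x, 0 ≤ (c • v).val x := by
    intro c v hc hv
    filter_upwards [hv, W.coeFn_smul c v] with x h1 h2
    rw [h2]; exact mul_nonneg hc h1
  have hlow1 : ∀ t ∈ Icc (0 : ℝ) 1, 1 - t ≤ (f t).lp := fun t ht => by
    have h0 : 0 ≤ 1 - t := sub_nonneg.2 ht.2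
    have := W.lp_le_lp_sup_left (v := t • e) (hsm0 h0 hw0)
    rwa [W.lp_smul, hw, mul_one, abs_of_nonneg h0, ← hfs] at this
  have hlow2 : ∀ t ∈ Icc (0 : ℝ) 1, t ≤ (f t).lp := fun t ht => by
    have := W.lp_le_lp_sup_right (u := (1 - t) • w) (hsm0 ht.1 he0)
    rwa [W.lp_smul, he, mul_one, abs_of_nonneg ht.1, ← hfs] at this
  have hj := joinedIn_normalized (L := ‖w‖) hf hlip (fun t ht => ?_) (fun t ht => ?_)
    (by rw [hf0, hw]) (by rw [hf1, he])
  · rwa [hf0, hf1] at hj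
  · have h1 := hlow1 t ht
    have h2 := hlow2 t ht
    linarith
  · have h0 : 0 ≤ 1 - t := sub_nonneg.2 ht.2
    have hsub := W.norm_sup_add_norm_inf_le ((1 - t) • w) (t • e)
    have hlp := W.lp_sup_add_lp_inf ((1 - t) • w) (t • e)
    have hinf := hmin' (((1 - t) • w).inf (t • e))
    rw [← hfs] at hsub hlp
    rw [norm_smul, norm_smul, Real.norm_of_nonneg h0, Real.norm_of_nonneg ht.1,
      Real.mul_rpow h0 (norm_nonneg _), Real.mul_rpow ht.1 (norm_nonneg _)] at hsub
    rw [W.lp_smul, W.lp_smul, hw, he, mul_one, mul_one, abs_of_nonneg h0, abs_of_nonneg ht.1] at hlp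
    have h1 : (1 - t) ^ p ≤ (f t).lp ^ p := Real.rpow_le_rpow h0 (hlow1 t ht) hp0.le
    have h2 : ‖e‖ ^ p ≤ ‖w‖ ^ p := Real.rpow_le_rpow (norm_nonneg _) (hmin w hw) hp0.le
    have h3 : ‖f t‖ ^ p ≤ ‖w‖ ^ p * (f t).lp ^ p := by
      have h4 : ‖e‖ ^ p * (((1 - t) • w).inf (t • e)).lp ^ p =
          ‖e‖ ^ p * ((1 - t) ^ p + t ^ p - (f t).lp ^ p) := by rw [← hlp]; ring
      -- Submodularity and minimality bound `‖f t‖ ^ p` by `‖w‖ ^ p * (f t).lp ^ p` minus the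
      -- product `((f t).lp ^ p - (1 - t) ^ p) * (‖w‖ ^ p - ‖e‖ ^ p)`, whose factors are
      -- nonnegative.
      nlinarith [mul_nonneg (sub_nonneg.2 h1) (sub_nonneg.2 h2)]
    rw [← Real.mul_rpow (norm_nonneg _) (f t).lp_nonneg] at h3
    exact (Real.rpow_le_rpow_iff (norm_nonneg _)
      (mul_nonneg (norm_nonneg _) (f t).lp_nonneg) hp0).1 h3

theorem joinedIn_sublevel_neg {u v : W N p μ Ω} {L : ℝ} (h : JoinedIn (sublevel N p μ Ω L) u v) :
    JoinedIn (sublevel N p μ Ω L) (-u) (-v) := by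
  obtain ⟨γ, hγ⟩ := h
  refine ⟨γ.map (continuous_neg), fun t => ?_⟩
  have := hγ t
  exact ⟨by simpa [W.lp_neg] using this.1, by simpa using this.2⟩

end Paths

/-! ### Mean increments and averages over balls -/

section Shift

variable {N : ℕ} {p : ℝ} {μ : Measure unitInterval} [IsFiniteMeasure μ]

/-- The `p`-th power of the `L^p` norm of the increment `u(· + h) - u`. -/
def shiftEnergy (p : ℝ) (u : E N → ℝ) (h : E N) : ℝ≥0∞ := ∫⁻ x, ‖u (x + h) - u x‖ₑ ^ p

theorem measurable_shiftEnergy {u : E N → ℝ} (hu : Measurable u) :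
    Measurable (shiftEnergy p u) := by
  have : Measurable fun q : E N × E N => ‖u (q.2 + q.1) - u q.2‖ₑ ^ p := by fun_prop
  exact this.lintegral_prod_right'

theorem lintegral_incr_eq (hN : 1 ≤ N) (hp : 1 < p) {u : E N → ℝ} (hu : Measurable u) :
    ∫⁻ q, ‖incr u q‖ₑ ^ p ∂(fracMeasure N p μ) = ∫⁻ h, fracKernel p μ h * shiftEnergy p u h := by
  rw [lintegral_fracMeasure hN hp μ (by unfold incr; fun_prop)]
  rfl

theorem lintegral_fracKernel_shiftEnergy_le (hN : 1 ≤ N) (hp : 1 < p) {u : E N → ℝ}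
    (hu : Measurable u) : ∫⁻ h, fracKernel p μ h * shiftEnergy p u h ≤ energy p μ u := by
  rw [energy_split hN hp μ hu.aestronglyMeasurable, lintegral_incr_eq hN hp hu]
  exact le_trans le_add_self le_self_add

/-- A lower bound for the kernel near the diagonal. -/
theorem mul_fracKernel_ge (hN : 1 ≤ N) (hp : 1 < p) (sbar : unitInterval) (hs : 0 < sbar) {h : E N}
    {r : ℝ} (hr : r ≤ 1) (hh : ‖h‖ ≤ r) (hh0 : h ≠ 0) :
    ∫⁻ s in Ico sbar 1, ENNReal.ofReal (normConst N s p) ∂μ ≤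
      ENNReal.ofReal (r ^ ((N : ℝ) + sbar * p)) * fracKernel p μ h := by
  have hp0 : 0 < p := by linarith
  have hs0 : 0 ≤ (sbar : ℝ) := sbar.2.1
  have hr0 : 0 ≤ r := (norm_nonneg _).trans hh
  have hpos : 0 < ‖h‖ := norm_pos_iff.2 hh0
  unfold fracKernel
  rw [← lintegral_const_mul' _ _ ENNReal.ofReal_ne_top]
  refine le_trans ?_ (lintegral_mono_set (Ico_subset_Ioo_left hs))
  refine setLIntegral_mono' measurableSet_Ico fun s hs' => ?_
  rw [← ENNReal.ofReal_mul (by positivity)]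
  refine ENNReal.ofReal_le_ofReal ?_
  have hc := normConst_nonneg hN hp s
  have hss : (sbar : ℝ) ≤ s := hs'.1
  -- Since `‖h‖ ≤ r ≤ 1`, orders above `sbar` only make the kernel larger.
  have h1 : ‖h‖ ^ ((N : ℝ) + s * p) ≤ r ^ ((N : ℝ) + sbar * p) :=
    calc ‖h‖ ^ ((N : ℝ) + s * p) ≤ ‖h‖ ^ ((N : ℝ) + sbar * p) :=
          Real.rpow_le_rpow_of_exponent_ge hpos (hh.trans hr) (by gcongr)
      _ ≤ _ := Real.rpow_le_rpow hpos.le hh (by positivity)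
  rw [mul_div_assoc', le_div_iff₀ (Real.rpow_pos_of_pos hpos _), mul_comm]
  gcongr

theorem volume_ball_eq (c : E N) {r : ℝ} (hr : 0 < r) :
    volume (Metric.ball c r) = ENNReal.ofReal (r ^ (N : ℝ)) * volume (Metric.ball (0 : E N) 1) := by
  rw [Measure.addHaar_ball_of_pos _ _ hr]
  simp

/-- The mean increments of a function of bounded energy are uniformly small. -/
theorem exists_lintegral_shiftEnergy_le (hN : 1 ≤ N) (hp : 1 < p) (sbar : unitInterval)
    (hs : 0 < sbar) (hμ : 0 < μ (Icc sbar 1)) :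
    ∃ C : ℝ≥0∞, C ≠ ⊤ ∧ ∃ r : ℝ, 0 < r ∧ ∀ δ : ℝ, 0 < δ → δ ≤ 1 / 2 → ∀ u : E N → ℝ, Measurable u →
      MemLp u (ENNReal.ofReal p) → energy p μ u ≠ ⊤ →
      ∫⁻ h in Metric.ball (0 : E N) (2 * δ), shiftEnergy p u h ≤
        C * ENNReal.ofReal (δ ^ r) * energy p μ u * volume (Metric.ball (0 : E N) δ) := by
  have hp0 : 0 < p := by linarith
  have hs0 : 0 < (sbar : ℝ) := by exact_mod_cast hs
  set V := volume (Metric.ball (0 : E N) 1) with hV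
  have hV0 : V ≠ 0 := (Metric.measure_ball_pos _ _ one_pos).ne'
  have hVt : V ≠ ⊤ := measure_ball_lt_top.ne
  -- Either the orders in `[sbar, 1)` carry mass and the kernel bound gives the rate `δ ^ (sbar *
  -- p)`, or the order `1` is charged and the gradient gives the rate `δ ^ p`.
  by_cases hb : μ {1} = 0
  · set m := ∫⁻ s in Ico sbar 1, ENNReal.ofReal (normConst N s p) ∂μ with hm
    have hμ' : 0 < μ (Ico sbar 1) := by
      refine pos_iff_ne_zero.2 fun h0 => hμ.ne' ?_
      have hs1 : sbar ≤ 1 := sbar.2.2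
      rw [← Ico_union_right hs1]
      exact measure_union_null h0 hb
    have hm0 : m ≠ 0 := by
      rw [hm]
      refine (setLIntegral_pos_iff (continuous_normConst hN hp).measurable.ennreal_ofReal).2
        ?_ |>.ne'
      refine hμ'.trans_le (measure_mono fun s hs' => ⟨?_, hs'⟩)
      simpa using normConst_pos hN hp (hs.trans_le hs'.1) hs'.2
    refine ⟨ENNReal.ofReal (2 ^ ((N : ℝ) + sbar * p)) / m / V, ?_, sbar * p, by positivity, ?_⟩
    · exact ENNReal.div_ne_top (ENNReal.div_ne_top ENNReal.ofReal_ne_top hm0) hV0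
    intro δ hδ hδ2 u hu _ hE
    have hkey : m * ∫⁻ h in Metric.ball (0 : E N) (2 * δ), shiftEnergy p u h ≤
        ENNReal.ofReal ((2 * δ) ^ ((N : ℝ) + sbar * p)) * energy p μ u := by
      rw [← lintegral_const_mul _ (measurable_shiftEnergy hu)]
      calc ∫⁻ h in Metric.ball (0 : E N) (2 * δ), m * shiftEnergy p u h
          ≤ ∫⁻ h in Metric.ball (0 : E N) (2 * δ),
              ENNReal.ofReal ((2 * δ) ^ ((N : ℝ) + sbar * p)) *
                (fracKernel p μ h * shiftEnergy p u h) := by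
            refine setLIntegral_mono' measurableSet_ball fun h hh => ?_
            rcases eq_or_ne h 0 with rfl | hh0
            · simp [shiftEnergy, ENNReal.zero_rpow_of_pos hp0]
            rw [← mul_assoc]
            gcongr
            exact mul_fracKernel_ge hN hp sbar hs (by linarith)
              (mem_ball_zero_iff.1 hh).le hh0
        _ ≤ ∫⁻ h, ENNReal.ofReal ((2 * δ) ^ ((N : ℝ) + sbar * p)) *
                (fracKernel p μ h * shiftEnergy p u h) := setLIntegral_le_lintegral _ _
        _ ≤ _ := by
            rw [lintegral_const_mul' _ _ ENNReal.ofReal_ne_top]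
            gcongr
            exact lintegral_fracKernel_shiftEnergy_le hN hp hu
    rw [mul_comm, ← ENNReal.le_div_iff_mul_le (Or.inl hm0)
      (Or.inr (ENNReal.mul_ne_top ENNReal.ofReal_ne_top hE))] at hkey
    refine hkey.trans (le_of_eq ?_)
    rw [volume_ball_eq _ hδ, ← hV, Real.mul_rpow two_pos.le hδ.le, Real.rpow_add hδ,
      ENNReal.ofReal_mul (by positivity), ENNReal.ofReal_mul (by positivity)]
    set a := ENNReal.ofReal (2 ^ ((N : ℝ) + sbar * p))
    set b := ENNReal.ofReal (δ ^ (N : ℝ))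
    set c := ENNReal.ofReal (δ ^ ((sbar : ℝ) * p))
    simp only [div_eq_mul_inv]
    calc a * (b * c) * energy p μ u * m⁻¹ = a * (b * c) * energy p μ u * m⁻¹ * 1 := by rw [mul_one]
      _ = a * (b * c) * energy p μ u * m⁻¹ * (V⁻¹ * V) := by rw [ENNReal.inv_mul_cancel hV0 hVt]
      _ = _ := by ring
  · refine ⟨ENNReal.ofReal (2 ^ ((N : ℝ) + p)) / μ {1}, ENNReal.div_ne_top ENNReal.ofReal_ne_top hb,
      p, hp0, ?_⟩
    intro δ hδ hδ2 u hu hup hE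
    obtain ⟨g, hg, hgp⟩ := exists_hasGrad hN hp hu.aestronglyMeasurable hE
    have hgE : ∫⁻ x, ‖g x‖ₑ ^ p ≤ energy p μ u / μ {1} := by
      rw [ENNReal.le_div_iff_mul_le (Or.inl hb) (Or.inl (measure_ne_top _ _)), mul_comm,
        energy_eq hN hp hu.aestronglyMeasurable hg, lintegral_smul_measure (μ {1}), smul_eq_mul]
      exact le_add_self
    calc ∫⁻ h in Metric.ball (0 : E N) (2 * δ), shiftEnergy p u h
        ≤ ∫⁻ h in Metric.ball (0 : E N) (2 * δ), ENNReal.ofReal ((2 * δ) ^ p) *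
            (energy p μ u / μ {1}) := by
          refine setLIntegral_mono' measurableSet_ball fun h hh => ?_
          refine ((hg hb).lintegral_translate_sub_le hp hgp h).trans ?_
          gcongr
          rw [← ofReal_norm_rpow hp]
          exact ENNReal.ofReal_le_ofReal
            (Real.rpow_le_rpow (norm_nonneg _) (mem_ball_zero_iff.1 hh).le hp0.le)
      _ = _ := by
          rw [setLIntegral_const, volume_ball_eq _ hδ, volume_ball_eq _ (by positivity),
            Real.mul_rpow two_pos.le hδ.le, Real.mul_rpow two_pos.le hδ.le, Real.rpow_add two_pos,
            ENNReal.ofReal_mul (by positivity), ENNReal.ofReal_mul (by positivity),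
            ENNReal.ofReal_mul (by positivity)]
          simp only [div_eq_mul_inv]
          ring

/-- Normalized Lebesgue measure on a ball. -/
def ballMeasure (c : E N) (δ : ℝ) : Measure (E N) :=
  (volume (Metric.ball c δ))⁻¹ • volume.restrict (Metric.ball c δ)

theorem isProbabilityMeasure_ballMeasure (c : E N) {δ : ℝ} (hδ : 0 < δ) :
    IsProbabilityMeasure (ballMeasure c δ) := by
  refine ⟨?_⟩
  rw [ballMeasure, Measure.smul_apply, Measure.restrict_apply_univ, smul_eq_mul,
    ENNReal.inv_mul_cancel (Metric.measure_ball_pos _ _ hδ).ne' measure_ball_lt_top.ne]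

theorem integrable_ballMeasure (hp : 1 < p) (c : E N) {δ : ℝ} (hδ : 0 < δ) {u : E N → ℝ}
    (hu : MemLp u (ENNReal.ofReal p)) : Integrable u (ballMeasure c δ) :=
  (((hu.locallyIntegrable (one_le_ofReal hp)).integrableOn_isCompact
    (isCompact_closedBall c δ)).mono_set Metric.ball_subset_closedBall).smul_measure
      (ENNReal.inv_ne_top.2 (ne_of_gt (Metric.measure_ball_pos _ _ hδ)))

/-- Averages over a ball are controlled by the `L^p` norm. -/
theorem enorm_integral_ballMeasure_le (hp : 1 < p) (c : E N) {δ : ℝ} (hδ : 0 < δ) {u : E N → ℝ}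
    (hu : Measurable u) :
    ‖∫ y, u y ∂(ballMeasure c δ)‖ₑ ^ p ≤ (volume (Metric.ball c δ))⁻¹ * ∫⁻ x, ‖u x‖ₑ ^ p := by
  have := isProbabilityMeasure_ballMeasure c hδ
  calc ‖∫ y, u y ∂(ballMeasure c δ)‖ₑ ^ p ≤ (∫⁻ y, ‖u y‖ₑ ∂(ballMeasure c δ)) ^ p := by
        gcongr; exact enorm_integral_le_lintegral_enorm _
    _ ≤ ∫⁻ y, ‖u y‖ₑ ^ p ∂(ballMeasure c δ) :=
        rpow_lintegral_le_lintegral_rpow hp _ (by fun_prop)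
    _ ≤ _ := by
        rw [ballMeasure, lintegral_smul_measure, smul_eq_mul]
        exact mul_le_mul_right (setLIntegral_le_lintegral _ _) _

/-- Jensen for the normalized measure on the ball; two points of a ball of radius `δ` differ by less
than `2 * δ`, which accounts for the larger ball of increments. -/
theorem enorm_sub_integral_ballMeasure_le (hp : 1 < p) (c : E N) {δ : ℝ} (hδ : 0 < δ) {u : E N → ℝ}
    (hu : Measurable u) (hup : MemLp u (ENNReal.ofReal p)) {x : E N} (hx : x ∈ Metric.ball c δ) :
    ‖u x - ∫ y, u y ∂(ballMeasure c δ)‖ₑ ^ p ≤ (volume (Metric.ball (0 : E N) δ))⁻¹ *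
      ∫⁻ h in Metric.ball (0 : E N) (2 * δ), ‖u (x + h) - u x‖ₑ ^ p := by
  have := isProbabilityMeasure_ballMeasure c hδ
  have e : u x - ∫ y, u y ∂(ballMeasure c δ) = ∫ y, (u x - u y) ∂(ballMeasure c δ) := by
    rw [integral_sub (integrable_const _) (integrable_ballMeasure hp c hδ hup)]
    simp
  rw [e]
  calc ‖∫ y, (u x - u y) ∂(ballMeasure c δ)‖ₑ ^ p
      ≤ (∫⁻ y, ‖u x - u y‖ₑ ∂(ballMeasure c δ)) ^ p := by
        gcongr; exact enorm_integral_le_lintegral_enorm _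
    _ ≤ ∫⁻ y, ‖u x - u y‖ₑ ^ p ∂(ballMeasure c δ) :=
        rpow_lintegral_le_lintegral_rpow hp _ (by fun_prop)
    _ ≤ _ := by
        rw [ballMeasure, lintegral_smul_measure, smul_eq_mul,
          Measure.addHaar_ball_center volume c]
        refine mul_le_mul_right ?_ _
        rw [← lintegral_indicator measurableSet_ball, ← lintegral_indicator measurableSet_ball,
          ← lintegral_add_left_eq_self _ x]
        refine lintegral_mono fun h => ?_
        by_cases hh : x + h ∈ Metric.ball c δ
        · have hh' : h ∈ Metric.ball (0 : E N) (2 * δ) := by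
            rw [mem_ball_zero_iff]
            rw [Metric.mem_ball, dist_eq_norm] at hx hh
            calc ‖h‖ = ‖(x + h - c) - (x - c)‖ := by congr 1; abel
              _ ≤ ‖x + h - c‖ + ‖x - c‖ := norm_sub_le _ _
              _ < 2 * δ := by linarith
          rw [indicator_of_mem hh, indicator_of_mem hh', ← enorm_neg, neg_sub]
        · rw [indicator_of_notMem hh]; exact zero_le

/-- The `L^p` norm is controlled by mean increments and finitely many averages. -/
theorem lintegral_rpow_le_of_cover (hp : 1 < p) {Ω : Set (E N)} (hΩ : MeasurableSet Ω) {δ : ℝ}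
    (hδ : 0 < δ) (t : Finset (E N)) (ht : Ω ⊆ ⋃ c ∈ t, Metric.ball c δ) {u : E N → ℝ} (hu : Measurable u)
    (hup : MemLp u (ENNReal.ofReal p)) (hu0 : ∀ᵐ x, x ∉ Ω → u x = 0) :
    ∫⁻ x, ‖u x‖ₑ ^ p ≤ 2 ^ (p - 1) * ((volume (Metric.ball (0 : E N) δ))⁻¹ *
      (∫⁻ h in Metric.ball (0 : E N) (2 * δ), shiftEnergy p u h) +
        volume Ω * ∑ c ∈ t, ‖∫ y, u y ∂(ballMeasure c δ)‖ₑ ^ p) := by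
  have hp0 : 0 < p := by linarith
  set S := ∑ c ∈ t, ‖∫ y, u y ∂(ballMeasure c δ)‖ₑ ^ p with hS
  set V := (volume (Metric.ball (0 : E N) δ))⁻¹ with hV
  have hm : Measurable fun q : E N × E N => ‖u (q.1 + q.2) - u q.1‖ₑ ^ p := by fun_prop
  have hm' : Measurable fun x => ∫⁻ h in Metric.ball (0 : E N) (2 * δ), ‖u (x + h) - u x‖ₑ ^ p :=
    hm.lintegral_prod_right'
  calc ∫⁻ x, ‖u x‖ₑ ^ p ≤ ∫⁻ x in Ω, ‖u x‖ₑ ^ p := by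
        rw [← lintegral_indicator hΩ]
        refine lintegral_mono_ae ?_
        filter_upwards [hu0] with x hx
        by_cases h : x ∈ Ω
        · rw [indicator_of_mem h]
        · rw [hx h, enorm_zero, ENNReal.zero_rpow_of_pos hp0]; exact zero_le
    _ ≤ ∫⁻ x in Ω, 2 ^ (p - 1) * (V * (∫⁻ h in Metric.ball (0 : E N) (2 * δ),
          ‖u (x + h) - u x‖ₑ ^ p) + S) := by
        refine setLIntegral_mono (by fun_prop) fun x hx => ?_
        obtain ⟨c, hc, hxc⟩ := mem_iUnion₂.1 (ht hx)
        calc ‖u x‖ₑ ^ p = ‖(u x - ∫ y, u y ∂(ballMeasure c δ)) + ∫ y, u y ∂(ballMeasure c δ)‖ₑ ^ p := by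
              rw [sub_add_cancel]
          _ ≤ (‖u x - ∫ y, u y ∂(ballMeasure c δ)‖ₑ + ‖∫ y, u y ∂(ballMeasure c δ)‖ₑ) ^ p := by
              gcongr; exact enorm_add_le _ _
          _ ≤ 2 ^ (p - 1) * (‖u x - ∫ y, u y ∂(ballMeasure c δ)‖ₑ ^ p +
                ‖∫ y, u y ∂(ballMeasure c δ)‖ₑ ^ p) :=
              ENNReal.rpow_add_le_mul_rpow_add_rpow _ _ hp.le
          _ ≤ _ := by
              gcongr
              · exact enorm_sub_integral_ballMeasure_le hp c hδ hu hup hxc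
              · exact Finset.single_le_sum (f := fun c => ‖∫ y, u y ∂(ballMeasure c δ)‖ₑ ^ p)
                  (fun _ _ => zero_le) hc
    _ ≤ _ := by
        rw [lintegral_const_mul _ (by fun_prop), lintegral_add_right _ measurable_const,
          lintegral_const_mul _ hm', setLIntegral_const, mul_comm S]
        refine mul_le_mul_right (add_le_add_left (mul_le_mul_right ?_ _) _) _
        refine (setLIntegral_le_lintegral _ _).trans (le_of_eq ?_)
        exact lintegral_lintegral_swap hm.aemeasurable

end Shift

/-! ### Compactness in `L^p`, lower semicontinuity and minimizers -/

section Compactness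

variable {N : ℕ} {p : ℝ} {μ : Measure unitInterval} [IsFiniteMeasure μ] {Ω : Set (E N)}
  [Fact (1 ≤ N)] [Fact (1 < p)] [Fact (volume Ω ≠ ⊤)]

/-- Tychonoff in place of a diagonal argument: a countable product of compact intervals is
sequentially compact. -/
theorem exists_subseq_tendsto_countable {ι : Type*} [Countable ι] {a : ℕ → ι → ℝ} {R : ι → ℝ}
    (h : ∀ n i, |a n i| ≤ R i) :
    ∃ φ : ℕ → ℕ, StrictMono φ ∧ ∃ l : ι → ℝ, ∀ i, Tendsto (fun n => a (φ n) i) atTop (𝓝 (l i)) := by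
  have hc : IsCompact (univ.pi fun i => Icc (-R i) (R i)) := isCompact_univ_pi fun _ => isCompact_Icc
  obtain ⟨l, -, φ, hφ, hl⟩ := hc.tendsto_subseq (x := a) fun n i _ => abs_le.1 (h n i)
  exact ⟨φ, hφ, l, fun i => (continuous_apply i).continuousAt.tendsto.comp hl⟩

/-- The `L^p` norm of a bounded sequence in `W` is Cauchy along a subsequence. -/
theorem exists_subseq_tendsto_lp_sub (hΩ : MeasurableSet Ω) (hΩb : Bornology.IsBounded Ω)
    (sbar : unitInterval) (hs : 0 < sbar) (hμ : 0 < μ (Icc sbar 1)) {u : ℕ → W N p μ Ω} {L : ℝ}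
    (hL : ∀ n, ‖u n‖ ≤ L) (hlp : ∀ n, (u n).lp = 1) :
    ∃ φ : ℕ → ℕ, StrictMono φ ∧
      Tendsto (fun q : ℕ × ℕ => ∫⁻ x, ‖(u (φ q.1) - u (φ q.2)).val x‖ₑ ^ p) atTop (𝓝 0) := by
  have hN : 1 ≤ N := Fact.out
  have hp : 1 < p := Fact.out
  have hp0 : 0 < p := by linarith
  obtain ⟨C, hC, r, hr, hbound⟩ := exists_lintegral_shiftEnergy_le (N := N) hN hp sbar hs hμ
  let δ : ℕ → ℝ := fun k => 1 / ((k : ℝ) + 2)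
  have hδ0 : ∀ k, 0 < δ k := fun k => by positivity
  have hδ1 : ∀ k, δ k ≤ 1 / 2 := fun k => by
    refine one_div_le_one_div_of_le two_pos ?_
    have : (0 : ℝ) ≤ k := k.cast_nonneg
    linarith
  have hδt : Tendsto δ atTop (𝓝 0) :=
    tendsto_const_nhds.div_atTop (tendsto_atTop_add_const_right _ _ tendsto_natCast_atTop_atTop)
  have hcov : ∀ k, ∃ t : Finset (E N), Ω ⊆ ⋃ c ∈ t, Metric.ball c (δ k) := by
    intro k
    have htb : TotallyBounded Ω := hΩb.isCompact_closure.totallyBounded.subset subset_closure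
    obtain ⟨t, ht, htΩ⟩ := Metric.totallyBounded_iff.1 htb (δ k) (hδ0 k)
    exact ⟨ht.toFinset, by simpa using htΩ⟩
  choose t ht using hcov
  -- The averages at all scales are indexed together, so that one subsequence makes all of them
  -- converge.
  let avg : ℕ → (Σ k, t k) → ℝ := fun n i => ∫ y, (u n).val y ∂(ballMeasure i.2.1 (δ i.1))
  have havg : ∀ n i, |avg n i| ≤ (((volume (Metric.ball i.2.1 (δ i.1)))⁻¹) ^ (1 / p)).toReal := by
    intro n i
    have h := enorm_integral_ballMeasure_le hp i.2.1 (hδ0 i.1) (u n).measurable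
    rw [← W.ofReal_lp_rpow, hlp, Real.one_rpow, ENNReal.ofReal_one, mul_one] at h
    have h2 := (ENNReal.le_rpow_inv_iff hp0).2 h
    rw [← Real.norm_eq_abs, ← toReal_enorm, one_div]
    refine ENNReal.toReal_mono (ENNReal.rpow_ne_top_of_nonneg (by positivity) ?_) h2
    exact ENNReal.inv_ne_top.2 (Metric.measure_ball_pos _ _ (hδ0 _)).ne'
  obtain ⟨φ, hφ, l, hl⟩ := exists_subseq_tendsto_countable havg
  refine ⟨φ, hφ, ENNReal.tendsto_nhds_zero.2 fun ε hε => ?_⟩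
  set A : ℝ≥0∞ := ENNReal.ofReal ((L + L) ^ p) with hA
  have hsub : ∀ m n, energy p μ (u m - u n).val ≤ A := fun m n => by
    rw [← W.ofReal_norm_rpow]
    refine ENNReal.ofReal_le_ofReal (Real.rpow_le_rpow (norm_nonneg _) ?_ hp0.le)
    exact (norm_sub_le _ _).trans (add_le_add (hL m) (hL n))
  have hε2 : 0 < ε / 2 := ENNReal.half_pos hε.ne'
  have hpt : (2 : ℝ≥0∞) ^ (p - 1) ≠ ⊤ := ENNReal.rpow_ne_top_of_nonneg (by linarith) (by simp)
  -- The scale is fixed first and makes the increment term small uniformly in the sequence. At this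
  -- scale only finitely many averages remain, and they converge.
  obtain ⟨k, hk⟩ : ∃ k, 2 ^ (p - 1) * (C * ENNReal.ofReal (δ k ^ r) * A) ≤ ε / 2 := by
    have h1 : Tendsto (fun k => ENNReal.ofReal (δ k ^ r)) atTop (𝓝 0) := by
      have := (ENNReal.continuous_ofReal.tendsto _).comp
        ((Real.continuousAt_rpow_const 0 r (Or.inr hr.le)).tendsto.comp hδt)
      simpa [Real.zero_rpow hr.ne', Function.comp_def] using this
    have h2 : Tendsto (fun k => 2 ^ (p - 1) * (C * ENNReal.ofReal (δ k ^ r) * A)) atTop (𝓝 0) := by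
      have h3 := ENNReal.Tendsto.const_mul (a := 2 ^ (p - 1) * C * A) h1
        (Or.inr (ENNReal.mul_ne_top (ENNReal.mul_ne_top hpt hC) ENNReal.ofReal_ne_top))
      rw [mul_zero] at h3
      refine h3.congr fun k => by ring
    exact ((ENNReal.tendsto_nhds_zero.1 h2) _ hε2).exists
  have hΩt : volume Ω ≠ ⊤ := hΩb.measure_lt_top.ne
  have hF : Tendsto (fun q : ℕ × ℕ => 2 ^ (p - 1) * (volume Ω *
      ∑ c : t k, ‖avg (φ q.1) ⟨k, c⟩ - avg (φ q.2) ⟨k, c⟩‖ₑ ^ p)) atTop (𝓝 0) := by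
    have h1 : ∀ c : t k, Tendsto (fun q : ℕ × ℕ =>
        ‖avg (φ q.1) ⟨k, c⟩ - avg (φ q.2) ⟨k, c⟩‖ₑ ^ p) atTop (𝓝 0) := by
      intro c
      rw [← prod_atTop_atTop_eq]
      have h2 := ((hl ⟨k, c⟩).comp tendsto_fst).sub ((hl ⟨k, c⟩).comp
        (tendsto_snd (f := (atTop : Filter ℕ)) (g := (atTop : Filter ℕ))))
      rw [sub_self] at h2
      have h3 := (ENNReal.continuous_rpow_const (y := p)).tendsto _ |>.comp
        ((continuous_enorm.tendsto _).comp h2)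
      simpa [ENNReal.zero_rpow_of_pos hp0, Function.comp_def] using h3
    have h2 := tendsto_finsetSum Finset.univ fun c _ => h1 c
    have h3 := ENNReal.Tendsto.const_mul (a := 2 ^ (p - 1) * volume Ω) h2
      (Or.inr (ENNReal.mul_ne_top hpt hΩt))
    simpa [mul_assoc] using h3
  filter_upwards [ENNReal.tendsto_nhds_zero.1 hF _ hε2] with q hq
  set w := u (φ q.1) - u (φ q.2) with hw
  have h := lintegral_rpow_le_of_cover hp hΩ (hδ0 k) (t k) (ht k) w.measurable w.memLp w.ae_eq_zero
  have h2 := hbound (δ k) (hδ0 k) (hδ1 k) w.val w.measurable w.memLp w.energy_lt_top.ne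
  have hVpos := (Metric.measure_ball_pos volume (0 : E N) (hδ0 k)).ne'
  have hVt : volume (Metric.ball (0 : E N) (δ k)) ≠ ⊤ := measure_ball_lt_top.ne
  have h3 : (volume (Metric.ball (0 : E N) (δ k)))⁻¹ *
      (∫⁻ h in Metric.ball (0 : E N) (2 * δ k), shiftEnergy p w.val h) ≤
      C * ENNReal.ofReal (δ k ^ r) * A := by
    rw [ENNReal.inv_mul_le_iff hVpos hVt]
    refine h2.trans ?_
    rw [mul_comm]
    gcongr
    exact hsub _ _
  have h4 : ∑ c ∈ t k, ‖∫ y, w.val y ∂(ballMeasure c (δ k))‖ₑ ^ p =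
      ∑ c : t k, ‖avg (φ q.1) ⟨k, c⟩ - avg (φ q.2) ⟨k, c⟩‖ₑ ^ p := by
    rw [← Finset.sum_coe_sort]
    refine Finset.sum_congr rfl fun c _ => ?_
    congr 2
    have hac : ballMeasure c.1 (δ k) ≪ volume :=
      Measure.smul_absolutelyContinuous.trans Measure.restrict_le_self.absolutelyContinuous
    rw [integral_congr_ae (hac.ae_le (W.coeFn_sub _ _)), integral_sub
      (integrable_ballMeasure hp _ (hδ0 k) (u _).memLp)
      (integrable_ballMeasure hp _ (hδ0 k) (u _).memLp)]
  rw [h4] at h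
  refine h.trans ?_
  rw [mul_add, ← ENNReal.add_halves ε]
  exact add_le_add ((mul_le_mul_right h3 _).trans hk) hq

/-- Lower semicontinuity of the norm of `W` under `L^p` convergence, with stability of the
constraint. -/
theorem exists_norm_le_of_tendsto {u : ℕ → W N p μ Ω} {f : E N → ℝ}
    (hf : Measurable f) (hfp : MemLp f (ENNReal.ofReal p))
    (huf : Tendsto (fun n => ∫⁻ x, ‖(u n).val x - f x‖ₑ ^ p) atTop (𝓝 0)) {ℓ : ℝ}
    (hℓ : Tendsto (fun n => ‖u n‖) atTop (𝓝 ℓ)) :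
    ∃ w : W N p μ Ω, w.val =ᵐ[volume] f ∧ ‖w‖ ≤ ℓ := by
  have hN : 1 ≤ N := Fact.out
  have hp : 1 < p := Fact.out
  have hp0 : 0 < p := by linarith
  have hℓ0 : 0 ≤ ℓ := ge_of_tendsto' hℓ fun n => norm_nonneg _
  -- along a subsequence: convergence a.e. and of each of the three energies
  obtain ⟨φ, hφ, hae⟩ := (tendstoInMeasure_of_tendsto_eLpNorm (p := ENNReal.ofReal p) (by simpa using hp0)
    (fun n => (u n).measurable.aestronglyMeasurable) hf.aestronglyMeasurable
    ((tendsto_eLpNorm_iff hp0 (fun n x => (u n).val x - f x) volume).2 huf)).exists_seq_tendsto_ae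
  -- Lower semicontinuity is proved separately for the three pieces, so each must have its own
  -- limit; compactness of `ℝ≥0∞` provides one.
  obtain ⟨⟨A, B, G⟩, -, ψ, hψ, hlim⟩ := isCompact_univ.tendsto_subseq
    (x := fun n => ((∫⁻ x, ‖(u (φ n)).val x‖ₑ ^ p ∂(μ {0} • volume),
      ∫⁻ q, ‖incr (u (φ n)).val q‖ₑ ^ p ∂(fracMeasure N p μ),
      ∫⁻ x, ‖(u (φ n)).grad x‖ₑ ^ p ∂(μ {1} • volume)) : ℝ≥0∞ × ℝ≥0∞ × ℝ≥0∞)) fun n => mem_univ _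
  set v : ℕ → W N p μ Ω := fun n => u (φ (ψ n)) with hv
  have hφψ : Tendsto (fun n => φ (ψ n)) atTop atTop := hφ.tendsto_atTop.comp hψ.tendsto_atTop
  have hA : Tendsto (fun n => ∫⁻ x, ‖(v n).val x‖ₑ ^ p ∂(μ {0} • volume)) atTop (𝓝 A) :=
    (continuous_fst.tendsto _).comp hlim
  have hB : Tendsto (fun n => ∫⁻ q, ‖incr (v n).val q‖ₑ ^ p ∂(fracMeasure N p μ)) atTop (𝓝 B) :=
    ((continuous_fst.comp continuous_snd).tendsto _).comp hlim
  have hG : Tendsto (fun n => ∫⁻ x, ‖(v n).grad x‖ₑ ^ p ∂(μ {1} • volume)) atTop (𝓝 G) :=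
    ((continuous_snd.comp continuous_snd).tendsto _).comp hlim
  have hvae : ∀ᵐ x, Tendsto (fun n => (v n).val x) atTop (𝓝 (f x)) :=
    hae.mono fun x hx => hx.comp hψ.tendsto_atTop
  have hvf : Tendsto (fun n => ∫⁻ x, ‖(v n).val x - f x‖ₑ ^ p) atTop (𝓝 0) := huf.comp hφψ
  have hsum : A + B + G = ENNReal.ofReal (ℓ ^ p) := by
    have h1 : Tendsto (fun n => ENNReal.ofReal (‖v n‖ ^ p)) atTop (𝓝 (ENNReal.ofReal (ℓ ^ p))) :=
      (ENNReal.continuous_ofReal.tendsto _).comp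
        ((Real.continuousAt_rpow_const ℓ p (Or.inr hp0.le)).tendsto.comp (hℓ.comp hφψ))
    refine tendsto_nhds_unique ?_ h1
    refine ((hA.add hB).add hG).congr fun n => ?_
    rw [W.ofReal_norm_rpow, W.energy_eq (v n) .rfl (v n).hasGrad]
  have hGt : G ≠ ⊤ := by
    intro h
    rw [h, add_top] at hsum
    exact ENNReal.ofReal_ne_top hsum.symm
  have fatou : ∀ {α : Type} [MeasurableSpace α] {ν : Measure α} {k : ℕ → α → ℝ} {k₀ : α → ℝ}
      {c : ℝ≥0∞}, (∀ n, AEStronglyMeasurable (k n) ν) →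
      (∀ᵐ x ∂ν, Tendsto (fun n => k n x) atTop (𝓝 (k₀ x))) →
      Tendsto (fun n => ∫⁻ x, ‖k n x‖ₑ ^ p ∂ν) atTop (𝓝 c) → ∫⁻ x, ‖k₀ x‖ₑ ^ p ∂ν ≤ c := by
    intro α _ ν k k₀ c hk hlim hc
    rw [← hc.liminf_eq]
    refine le_trans (lintegral_mono_ae ?_)
      (lintegral_liminf_le' fun n => (hk n).enorm.pow_const p)
    filter_upwards [hlim] with x hx
    have : Tendsto (fun n => ‖k n x‖ₑ ^ p) atTop (𝓝 (‖k₀ x‖ₑ ^ p)) :=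
      (ENNReal.continuous_rpow_const.tendsto _).comp ((continuous_enorm.tendsto _).comp hx)
    rw [this.liminf_eq]
  have hfA : ∫⁻ x, ‖f x‖ₑ ^ p ∂(μ {0} • volume) ≤ A :=
    fatou (fun n => (v n).measurable.aestronglyMeasurable)
      (Measure.smul_absolutelyContinuous.ae_le hvae) hA
  have hfB : ∫⁻ q, ‖incr f q‖ₑ ^ p ∂(fracMeasure N p μ) ≤ B := by
    refine fatou (fun n => aestronglyMeasurable_incr hN hp μ (v n).val.aestronglyMeasurable) ?_ hB
    filter_upwards [(quasiMeasurePreserving_fracMeasure_snd μ).ae hvae,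
      (quasiMeasurePreserving_fracMeasure_add hN hp μ).ae hvae] with q h1 h2
    exact h2.sub h1
  -- Fatou does not apply to the gradients, which need not converge almost everywhere; weak
  -- closedness is used instead. It needs a uniform bound, available for a tail of the sequence only
  -- above `G`, hence the slack `G'`.
  have hfG : ∀ G' : ℝ≥0∞, G < G' → G' ≠ ⊤ → ∃ k, HasGrad μ f k ∧
      ∫⁻ x, ‖k x‖ₑ ^ p ∂(μ {1} • volume) ≤ G' := by
    intro G' hGG' hG't
    rcases eq_or_ne (μ {1}) 0 with h0 | h0
    · exact ⟨0, fun h => absurd h0 h, by simp [h0]⟩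
    obtain ⟨n₀, hn₀⟩ := eventually_atTop.1 (hG.eventually_le_const hGG')
    obtain ⟨k, hk, -, hkG⟩ := exists_isWeakGradient_of_bounded hp
      (u := fun n => (v (n + n₀)).val) (g := fun n => (v (n + n₀)).grad) (v := f)
      (fun n => (v (n + n₀)).hasGrad h0) (fun n => (v _).memLp) hfp
      (hvf.comp (tendsto_add_atTop_nat n₀)) (B := G' / μ {1}) (ENNReal.div_ne_top hG't h0)
      (fun n => by
        have := hn₀ (n + n₀) le_add_self
        rw [lintegral_smul_measure, smul_eq_mul, mul_comm] at this
        exact (ENNReal.le_div_iff_mul_le (Or.inl h0) (Or.inl (measure_ne_top _ _))).2 this)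
    refine ⟨k, fun _ => hk, ?_⟩
    rw [lintegral_smul_measure, smul_eq_mul, mul_comm]
    exact (ENNReal.le_div_iff_mul_le (Or.inl h0) (Or.inl (measure_ne_top _ _))).1 hkG
  have hE : energy p μ f ≤ ENNReal.ofReal (ℓ ^ p) := by
    rw [← hsum]
    refine ENNReal.le_of_forall_pos_le_add fun ε hε _ => ?_
    obtain ⟨k, hk, hkG⟩ := hfG (G + ε) (ENNReal.lt_add_right hGt (by exact_mod_cast hε.ne'))
      (ENNReal.add_ne_top.2 ⟨hGt, ENNReal.coe_ne_top⟩)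
    rw [energy_eq hN hp hf.aestronglyMeasurable hk, add_assoc _ G]
    exact add_le_add (add_le_add hfA hfB) hkG
  let F : Fun N := AEEqFun.mk f hf.aestronglyMeasurable
  have hF : F =ᵐ[volume] f := AEEqFun.coeFn_mk _ _
  have hFE : energy p μ F ≤ ENNReal.ofReal (ℓ ^ p) := (energy_congr_ae hF).trans_le hE
  refine ⟨W.mk F ⟨?_, (xNorm_lt_top_iff hp _).2 (hFE.trans_lt ENNReal.ofReal_lt_top)⟩
    ((memLp_congr_ae hF).2 hfp), hF, ?_⟩
  · have hz : ∀ᵐ x, ∀ n, x ∉ Ω → (v n).val x = 0 := ae_all_iff.2 fun n => (v n).ae_eq_zero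
    filter_upwards [hz, hvae, hF] with x h1 h2 h3 hx
    rw [h3]
    exact tendsto_nhds_unique h2 (tendsto_const_nhds.congr fun n => (h1 n hx).symm)
  · refine (Real.rpow_le_rpow_iff (norm_nonneg _) hℓ0 hp0).1 ?_
    refine (ENNReal.ofReal_le_ofReal_iff (by positivity)).1 ?_
    rw [W.ofReal_norm_rpow]
    exact hFE

/-- Bounded sequences of `𝓜` have `L^p`-limits in `𝓜`, along subsequences, and the norm is lower
semicontinuous. -/
theorem exists_subseq_limit (hΩ : MeasurableSet Ω) (hΩb : Bornology.IsBounded Ω)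
    (sbar : unitInterval) (hs : 0 < sbar) (hμ : 0 < μ (Icc sbar 1)) {u : ℕ → W N p μ Ω} {ℓ : ℝ}
    (hℓ : Tendsto (fun n => ‖u n‖) atTop (𝓝 ℓ)) (hlp : ∀ n, (u n).lp = 1) :
    ∃ w : W N p μ Ω, w.lp = 1 ∧ ‖w‖ ≤ ℓ ∧ ∃ φ : ℕ → ℕ, StrictMono φ ∧
      Tendsto (fun n => (u (φ n) - w).lp) atTop (𝓝 0) := by
  have hp : 1 < p := Fact.out
  have hp0 : 0 < p := by linarith
  have : Fact (1 ≤ ENNReal.ofReal p) := ⟨one_le_ofReal hp⟩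
  obtain ⟨L, hL⟩ := hℓ.bddAbove_range
  obtain ⟨φ, hφ, hcau⟩ := exists_subseq_tendsto_lp_sub hΩ hΩb sbar hs hμ
    (fun n => hL (mem_range_self n)) hlp
  have hlpt : ∀ {ι : Type} {l : Filter ι} {v : ι → W N p μ Ω},
      Tendsto (fun i => ∫⁻ x, ‖(v i).val x‖ₑ ^ p) l (𝓝 0) → Tendsto (fun i => (v i).lp) l (𝓝 0) := by
    intro ι l v h
    have h1 := (tendsto_eLpNorm_iff hp0 (fun i x => (v i).val x) volume).2 h
    exact (ENNReal.tendsto_toReal ENNReal.zero_ne_top).comp h1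
  have hC : CauchySeq fun n => (u (φ n)).memLp.toLp (u (φ n)).val := by
    refine cauchySeq_iff_tendsto_dist_atTop_0.2 ((hlpt hcau).congr fun q => ?_)
    rw [Lp.dist_def, W.lp]
    congr 1
    refine eLpNorm_congr_ae ?_
    filter_upwards [W.coeFn_sub (u (φ q.1)) (u (φ q.2)), (u (φ q.1)).memLp.coeFn_toLp,
      (u (φ q.2)).memLp.coeFn_toLp] with x h1 h2 h3
    rw [h1, Pi.sub_apply, h2, h3]
  obtain ⟨f, hf⟩ := cauchySeq_tendsto_of_complete hC
  have hf' := tendsto_lintegral_of_tendsto_Lp hp hf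
  have hf'' : Tendsto (fun n => ∫⁻ x, ‖(u (φ n)).val x - f x‖ₑ ^ p) atTop (𝓝 0) := by
    refine hf'.congr fun n => lintegral_congr_ae ?_
    filter_upwards [(u (φ n)).memLp.coeFn_toLp] with x h1
    rw [h1]
  obtain ⟨w, hw, hwℓ⟩ := exists_norm_le_of_tendsto (Lp.stronglyMeasurable f).measurable (Lp.memLp f)
    hf'' (hℓ.comp hφ.tendsto_atTop)
  have hlim : Tendsto (fun n => (u (φ n) - w).lp) atTop (𝓝 0) := by
    refine hlpt (hf''.congr fun n => lintegral_congr_ae ?_)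
    filter_upwards [W.coeFn_sub (u (φ n)) w, hw] with x h1 h2
    rw [h1, h2]
  refine ⟨w, ?_, hwℓ, φ, hφ, hlim⟩
  have h0 : |1 - w.lp| ≤ 0 :=
    ge_of_tendsto' hlim fun n => by rw [← hlp (φ n)]; exact W.abs_lp_sub_lp_le _ _
  have := abs_nonpos_iff.1 h0
  linarith

/-- The norm attains its minimum over each path component of a sublevel set of `𝓜`. -/
theorem exists_min_joinedIn (hΩ : MeasurableSet Ω) (hΩb : Bornology.IsBounded Ω)
    (sbar : unitInterval) (hs : 0 < sbar) (hμ : 0 < μ (Icc sbar 1)) {u₀ : W N p μ Ω} {L : ℝ}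
    (hu₀ : u₀.lp = 1) (hL : ‖u₀‖ < L) :
    ∃ w : W N p μ Ω, JoinedIn (sublevel N p μ Ω L) u₀ w ∧ ‖w‖ < L ∧
      ∀ v, JoinedIn (sublevel N p μ Ω L) u₀ v → ‖w‖ ≤ ‖v‖ := by
  -- The infimum `m` over the component lies strictly below `L`. The limit of a minimizing sequence
  -- is close in `L^p` to its late terms, and this gap pays for the normalized segment that puts the
  -- limit in the component.
  set S : Set ℝ := norm '' {v : W N p μ Ω | JoinedIn (sublevel N p μ Ω L) u₀ v} with hS
  have hu₀S : ‖u₀‖ ∈ S := ⟨u₀, JoinedIn.refl ⟨hu₀, hL.le⟩, rfl⟩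
  have hbdd : BddBelow S := ⟨0, by rintro _ ⟨v, -, rfl⟩; exact norm_nonneg _⟩
  obtain ⟨a, -, ha, haS⟩ := exists_seq_tendsto_sInf ⟨_, hu₀S⟩ hbdd
  choose v hv hva using haS
  set m := sInf S with hm
  have hvm : Tendsto (fun n => ‖v n‖) atTop (𝓝 m) := ha.congr fun n => (hva n).symm
  have hmL : m < L := (csInf_le hbdd hu₀S).trans_lt hL
  have hm0 : 0 ≤ m := ge_of_tendsto' hvm fun n => norm_nonneg _
  have hL0 : 0 < L := hm0.trans_lt hmL
  obtain ⟨w, hw, hwm, φ, hφ, hlim⟩ := exists_subseq_limit hΩ hΩb sbar hs hμ hvm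
    fun n => (hv n).target_mem.1
  set L₁ : ℝ := (m + L) / 2 with hL₁
  -- Chosen so that `L * (1 - δ) = L₁`, the condition for the segment to stay below `L`.
  set δ : ℝ := 1 - L₁ / L with hδ
  have hL₁L : L₁ / L < 1 := by rw [div_lt_one hL0]; linarith
  have hL₁0 : 0 < L₁ / L := by apply div_pos <;> linarith
  obtain ⟨n, hn1, hn2⟩ := ((hlim.eventually_le_const (show 0 < δ by linarith)).and
    ((hvm.comp hφ.tendsto_atTop).eventually_le_const (show m < L₁ by linarith))).exists
  refine ⟨w, (hv (φ n)).trans (joinedIn_segment (hv (φ n)).target_mem.1 hw hL0.le hn1 (by linarith)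
    hn2 (by linarith) (le_of_eq ?_)), hwm.trans_lt hmL, fun x hx => hwm.trans (csInf_le hbdd ⟨x, hx, rfl⟩)⟩
  rw [hδ]; field_simp; ring

end Compactness

/-! ### Smooth functions have finite energy -/

section Smooth

variable {N : ℕ} {p : ℝ} {μ : Measure unitInterval} [IsFiniteMeasure μ] {Ω : Set (E N)}

theorem inner_gradient (f : E N → ℝ) (x w : E N) : inner ℝ (gradient f x) w = fderiv ℝ f x w := by
  rw [gradient, InnerProductSpace.toDual_symm_apply]

theorem isWeakGradient_of_contDiff {f : E N → ℝ} (hf : ContDiff ℝ 1 f) (hc : HasCompactSupport f) :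
    IsWeakGradient f (gradient f) := by
  have hgc : Continuous (gradient f) :=
    (InnerProductSpace.toDual ℝ (E N)).symm.continuous.comp (hf.continuous_fderiv one_ne_zero)
  refine ⟨hf.continuous.locallyIntegrable, hgc.locallyIntegrable, fun φ hφ hφc w => ?_⟩
  have hφ1 : ContDiff ℝ 1 φ := hφ.of_le (by exact_mod_cast le_top)
  have hfd : Continuous fun x => fderiv ℝ f x w :=
    (hf.continuous_fderiv one_ne_zero).clm_apply continuous_const
  have hφd : Continuous fun x => fderiv ℝ φ x w :=
    (hφ1.continuous_fderiv one_ne_zero).clm_apply continuous_const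
  simp only [inner_gradient]
  exact integral_mul_fderiv_eq_neg_fderiv_mul_of_integrable
    ((hfd.mul hφ.continuous).integrable_of_hasCompactSupport hφc.mul_left)
    ((hf.continuous.mul hφd).integrable_of_hasCompactSupport hc.mul_right)
    ((hf.continuous.mul hφ.continuous).integrable_of_hasCompactSupport hc.mul_right)
    (fun x _ => hf.differentiable one_ne_zero x) (fun x _ => hφ1.differentiable one_ne_zero x)

theorem memLp_gradient {f : E N → ℝ} (hf : ContDiff ℝ 1 f) (hc : HasCompactSupport f) (q : ℝ≥0∞) :
    MemLp (gradient f) q := by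
  have hgc : Continuous (gradient f) :=
    (InnerProductSpace.toDual ℝ (E N)).symm.continuous.comp (hf.continuous_fderiv one_ne_zero)
  refine hgc.memLp_of_hasCompactSupport ?_
  exact (hc.fderiv ℝ).comp_left (g := (InnerProductSpace.toDual ℝ (E N)).symm) (map_zero _)

theorem shiftEnergy_eq_eLpNorm (hp : 1 < p) (u : E N → ℝ) (h : E N) :
    shiftEnergy p u h = eLpNorm (fun x => u (x + h) - u x) (ENNReal.ofReal p) volume ^ p :=
  (eLpNorm_ofReal_rpow (by linarith) _ _).symm

theorem eLpNorm_shift_nsmul_le (hp : 1 < p) {u : E N → ℝ} (hu : Measurable u) (h : E N) (k : ℕ) :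
    eLpNorm (fun x => u (x + k • h) - u x) (ENNReal.ofReal p) volume ≤
      k * eLpNorm (fun x => u (x + h) - u x) (ENNReal.ofReal p) volume := by
  induction k with
  | zero => simp
  | succ k ih =>
    have e : (fun x => u (x + (k + 1) • h) - u x) =
        (fun x => u (x + k • h + h) - u (x + k • h)) + fun x => u (x + k • h) - u x := by
      ext x
      simp only [Pi.add_apply, succ_nsmul, add_assoc]
      ring
    rw [e]
    refine (eLpNorm_add_le (by fun_prop) (by fun_prop) (one_le_ofReal hp)).trans ?_
    have e2 : eLpNorm (fun x => u (x + k • h + h) - u (x + k • h)) (ENNReal.ofReal p) volume =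
        eLpNorm (fun x => u (x + h) - u x) (ENNReal.ofReal p) volume :=
      eLpNorm_comp_measurePreserving (g := fun x => u (x + h) - u x) (by fun_prop)
        (measurePreserving_add_right volume (k • h))
    rw [e2, Nat.cast_succ, add_mul, one_mul, add_comm]
    gcongr

/-- Telescoping: a shift by `k • h` is a composition of `k` shifts by `h`, each with the same `L^p`
increment by translation invariance. -/
theorem shiftEnergy_nsmul_le (hp : 1 < p) {u : E N → ℝ} (hu : Measurable u) (h : E N) (k : ℕ) :
    shiftEnergy p u (k • h) ≤ (k : ℝ≥0∞) ^ p * shiftEnergy p u h := by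
  rw [shiftEnergy_eq_eLpNorm hp, shiftEnergy_eq_eLpNorm hp,
    ← ENNReal.mul_rpow_of_nonneg _ _ (by linarith : 0 ≤ p)]
  exact ENNReal.rpow_le_rpow (eLpNorm_shift_nsmul_le hp hu h k) (by linarith)

/-- Large shifts separate the supports. -/
theorem le_shiftEnergy_of_norm_ge {R : ℝ} (hR : Ω ⊆ Metric.ball 0 R)
    (hp : 1 < p) {u : E N → ℝ} (hu0 : ∀ᵐ x, x ∉ Ω → u x = 0) {h : E N} (hh : 2 * R ≤ ‖h‖) :
    ∫⁻ x, ‖u x‖ₑ ^ p ≤ shiftEnergy p u h := by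
  have hp0 : 0 < p := by linarith
  have hsh : ∀ᵐ x, x + h ∉ Ω → u (x + h) = 0 :=
    (measurePreserving_add_right volume h).quasiMeasurePreserving.ae hu0
  refine lintegral_mono_ae ?_
  filter_upwards [hu0, hsh] with x h1 h2
  by_cases hx : x ∈ Ω
  · have hxh : x + h ∉ Ω := fun hxh => by
      have a1 := mem_ball_zero_iff.1 (hR hx)
      have a2 := mem_ball_zero_iff.1 (hR hxh)
      have : ‖h‖ ≤ ‖x + h‖ + ‖x‖ := by
        calc ‖h‖ = ‖(x + h) - x‖ := by rw [add_sub_cancel_left]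
          _ ≤ _ := norm_sub_le _ _
      linarith
    rw [h2 hxh, zero_sub, enorm_neg]
  · rw [h1 hx, enorm_zero, ENNReal.zero_rpow_of_pos hp0]; exact zero_le

/-- A small shift, repeated until its length reaches `2 * R`, moves the support off itself, where
the increment is at least the full `L^p` norm. Hence no normalized function has increments smaller
than linear in `‖h‖`. -/
theorem min_rpow_le_shiftEnergy {R : ℝ} (hR0 : 0 < R)
    (hR : Ω ⊆ Metric.ball 0 R) (hp : 1 < p) {u : E N → ℝ} (hu : Measurable u)
    (hu0 : ∀ᵐ x, x ∉ Ω → u x = 0) (hu1 : ∫⁻ x, ‖u x‖ₑ ^ p = 1) (h : E N) :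
    ENNReal.ofReal (min 1 (‖h‖ / (4 * R)) ^ p) ≤ shiftEnergy p u h := by
  have hp0 : 0 < p := by linarith
  rcases le_or_gt (2 * R) ‖h‖ with hh | hh
  · refine le_trans ?_ (hu1.symm.le.trans (le_shiftEnergy_of_norm_ge hR hp hu0 hh))
    rw [ENNReal.ofReal_le_one]
    exact Real.rpow_le_one (by positivity) (min_le_left _ _) hp0.le
  rcases eq_or_ne h 0 with rfl | hh0
  · simp [Real.zero_rpow hp0.ne']
  have hpos : 0 < ‖h‖ := norm_pos_iff.2 hh0
  -- The number of repetitions; since `‖h‖ < 2 * R`, rounding up at most doubles it.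
  set k := ⌈2 * R / ‖h‖⌉₊ with hk
  have hk1 : 2 * R / ‖h‖ ≤ k := Nat.le_ceil _
  have hk2 : (k : ℝ) ≤ 4 * R / ‖h‖ := by
    have h1 : (k : ℝ) < 2 * R / ‖h‖ + 1 := Nat.ceil_lt_add_one (by positivity)
    have h2 : 1 ≤ 2 * R / ‖h‖ := by rw [le_div_iff₀ hpos]; linarith
    have h3 : 4 * R / ‖h‖ = 2 * R / ‖h‖ + 2 * R / ‖h‖ := by ring
    linarith
  have hkh : 2 * R ≤ ‖k • h‖ := by
    rw [← Nat.cast_smul_eq_nsmul ℝ, norm_smul, Real.norm_natCast]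
    rwa [div_le_iff₀ hpos] at hk1
  have h1 := (hu1.symm.le.trans (le_shiftEnergy_of_norm_ge hR hp hu0 hkh)).trans
    (shiftEnergy_nsmul_le hp hu h k)
  have hk0 : 0 < (k : ℝ) := lt_of_lt_of_le (by positivity) hk1
  have e : (k : ℝ≥0∞) ^ p = ENNReal.ofReal ((k : ℝ) ^ p) := by
    rw [← ENNReal.ofReal_rpow_of_nonneg hk0.le hp0.le, ENNReal.ofReal_natCast]
  calc ENNReal.ofReal (min 1 (‖h‖ / (4 * R)) ^ p)
      ≤ ENNReal.ofReal (((k : ℝ)⁻¹) ^ p) := by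
        refine ENNReal.ofReal_le_ofReal (Real.rpow_le_rpow (by positivity) ?_ hp0.le)
        refine (min_le_right _ _).trans ?_
        rw [← inv_div]
        exact inv_anti₀ hk0 hk2
    _ = ENNReal.ofReal (((k : ℝ)⁻¹) ^ p) * 1 := (mul_one _).symm
    _ ≤ ENNReal.ofReal (((k : ℝ)⁻¹) ^ p) * ((k : ℝ≥0∞) ^ p * shiftEnergy p u h) := by gcongr
    _ = shiftEnergy p u h := by
        rw [e, ← mul_assoc, ← ENNReal.ofReal_mul (by positivity), ← Real.mul_rpow (by positivity)
          hk0.le, inv_mul_cancel₀ hk0.ne', Real.one_rpow, ENNReal.ofReal_one, one_mul]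

theorem shiftEnergy_le (hp : 1 < p) {f : E N → ℝ} (hf : Measurable f) (h : E N) :
    shiftEnergy p f h ≤ 2 ^ p * ∫⁻ x, ‖f x‖ₑ ^ p := by
  have hp0 : 0 < p := by linarith
  rw [shiftEnergy_eq_eLpNorm hp, ← eLpNorm_ofReal_rpow hp0,
    ← ENNReal.mul_rpow_of_nonneg _ _ hp0.le]
  refine ENNReal.rpow_le_rpow ?_ hp0.le
  refine (eLpNorm_sub_le (f := fun x => f (x + h))
    (hf.comp (by fun_prop)).aestronglyMeasurable hf.aestronglyMeasurable
    (one_le_ofReal hp)).trans (le_of_eq ?_)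
  rw [two_mul]
  congr 1
  exact eLpNorm_comp_measurePreserving (g := f) hf.aestronglyMeasurable (measurePreserving_add_right volume h)

/-- If `X_p(Ω)` contains a normalized function, then smooth functions have finite energy. -/
theorem energy_lt_top_of_contDiff (hN : 1 ≤ N) (hp : 1 < p)
    (hΩb : Bornology.IsBounded Ω) {u : E N → ℝ} (hu : Measurable u)
    (hu0 : ∀ᵐ x, x ∉ Ω → u x = 0) (hu1 : ∫⁻ x, ‖u x‖ₑ ^ p = 1) (huE : energy p μ u ≠ ⊤)
    {f : E N → ℝ} (hf : ContDiff ℝ 1 f) (hc : HasCompactSupport f) : energy p μ f < ⊤ := by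
  have hp0 : 0 < p := by linarith
  have hfm : Measurable f := hf.continuous.measurable
  have hfp : MemLp f (ENNReal.ofReal p) := hf.continuous.memLp_of_hasCompactSupport hc
  have hF := (lintegral_rpow_ne_top_of_memLp hp0 hfp).lt_top
  have hG := (lintegral_rpow_ne_top_of_memLp hp0 (memLp_gradient hf hc (ENNReal.ofReal p))).lt_top
  set F := ∫⁻ x, ‖f x‖ₑ ^ p with hFdef
  set G := ∫⁻ x, ‖gradient f x‖ₑ ^ p with hGdef
  obtain ⟨R, hR0, hR⟩ : ∃ R, 0 < R ∧ Ω ⊆ Metric.ball 0 R := hΩb.subset_ball_lt 0 0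
  have hwg := isWeakGradient_of_contDiff hf hc
  -- The first term covers large shifts by the triangle inequality, the second covers `‖h‖ ≤ 4 * R`
  -- by the gradient bound; together they match the lower bound for the increments of `u`.
  set C : ℝ≥0∞ := 2 ^ p * F + ENNReal.ofReal ((4 * R) ^ p) * G with hC
  have hCt : C < ⊤ := ENNReal.add_lt_top.2 ⟨ENNReal.mul_lt_top
    (ENNReal.rpow_lt_top_of_nonneg hp0.le (by simp)) hF, ENNReal.mul_lt_top ENNReal.ofReal_lt_top hG⟩
  have hle : ∀ h, shiftEnergy p f h ≤ C * shiftEnergy p u h := by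
    intro h
    refine le_trans ?_ (mul_le_mul_right (min_rpow_le_shiftEnergy hR0 hR hp hu hu0 hu1 h) C)
    rcases le_total 1 (‖h‖ / (4 * R)) with h1 | h1
    · rw [min_eq_left h1, Real.one_rpow, ENNReal.ofReal_one, mul_one]
      exact (shiftEnergy_le hp hfm h).trans le_self_add
    · rw [min_eq_right h1]
      refine (hwg.lintegral_translate_sub_le hp (memLp_gradient hf hc _) h).trans ?_
      rw [hC, add_mul]
      refine le_trans (le_of_eq ?_) le_add_self
      rw [mul_right_comm, ← ENNReal.ofReal_mul (by positivity),
        ← Real.mul_rpow (by positivity) (by positivity), mul_div_cancel₀ _ (by positivity),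
        ofReal_norm_rpow hp]
  rw [energy_eq hN hp hfm.aestronglyMeasurable fun _ => hwg, lintegral_smul_measure (μ {0}),
    lintegral_smul_measure (μ {1}), lintegral_incr_eq hN hp hfm]
  refine ENNReal.add_lt_top.2 ⟨ENNReal.add_lt_top.2 ⟨ENNReal.mul_lt_top (measure_lt_top _ _) hF, ?_⟩,
    ENNReal.mul_lt_top (measure_lt_top _ _) hG⟩
  calc ∫⁻ h, fracKernel p μ h * shiftEnergy p f h
      ≤ ∫⁻ h, C * (fracKernel p μ h * shiftEnergy p u h) := lintegral_mono fun h => by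
        rw [mul_left_comm]
        exact mul_le_mul_right (hle h) _
    _ = C * ∫⁻ h, fracKernel p μ h * shiftEnergy p u h := lintegral_const_mul' _ _ hCt.ne
    _ < ⊤ := ENNReal.mul_lt_top hCt
      ((lintegral_fracKernel_shiftEnergy_le hN hp hu).trans_lt huE.lt_top)

end Smooth

/-! ### Two independent elements of the space -/

section Loop

variable {N : ℕ} {p : ℝ} {μ : Measure unitInterval} [IsFiniteMeasure μ] {Ω : Set (E N)}
  [Fact (1 ≤ N)] [Fact (1 < p)] [Fact (volume Ω ≠ ⊤)]

theorem W.exists_of_contDiff (hΩb : Bornology.IsBounded Ω) {u : W N p μ Ω}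
    (hu : u.lp = 1) {f : E N → ℝ} (hf : ContDiff ℝ 1 f) (hc : HasCompactSupport f)
    (hfΩ : ∀ x, x ∉ Ω → f x = 0) : ∃ w : W N p μ Ω, w.val =ᵐ[volume] f := by
  have hp : 1 < p := Fact.out
  have hfm : Measurable f := hf.continuous.measurable
  let F : Fun N := AEEqFun.mk f hfm.aestronglyMeasurable
  have hF : F =ᵐ[volume] f := AEEqFun.coeFn_mk _ _
  have hu1 : ∫⁻ x, ‖u.val x‖ₑ ^ p = 1 := by
    rw [← W.ofReal_lp_rpow, hu, Real.one_rpow, ENNReal.ofReal_one]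
  have hE : energy p μ F < ⊤ := (energy_congr_ae hF).trans_lt
    (energy_lt_top_of_contDiff Fact.out hp hΩb u.measurable u.ae_eq_zero hu1 u.energy_lt_top.ne
      hf hc)
  refine ⟨W.mk F ⟨?_, (xNorm_lt_top_iff hp _).2 hE⟩
    ((memLp_congr_ae hF).2 (hf.continuous.memLp_of_hasCompactSupport hc)), hF⟩
  filter_upwards [hF] with x hx hxΩ
  rw [hx, hfΩ x hxΩ]

theorem W.exists_linearIndependent (hΩ : IsOpen Ω) (hΩb : Bornology.IsBounded Ω) {u : W N p μ Ω}
    (hu : u.lp = 1) :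
    ∃ v w : W N p μ Ω, ∀ x y : ℝ, (x • v + y • w).lp = 0 → x = 0 ∧ y = 0 := by
  have hN : 1 ≤ N := Fact.out
  obtain ⟨x₀, hx₀⟩ : Ω.Nonempty := by
    by_contra h
    rw [not_nonempty_iff_eq_empty] at h
    have : u.val =ᵐ[volume] (0 : E N → ℝ) := u.ae_eq_zero.mono fun x hx => hx (by simp [h])
    have h0 : u.lp = 0 := by rw [W.lp, eLpNorm_congr_ae this]; simp
    linarith
  obtain ⟨r, hr, hrΩ⟩ := Metric.isOpen_iff.1 hΩ x₀ hx₀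
  -- At distance `r / 3` from the centre `f` already vanishes while `g` is still `1`; both are `1`
  -- at the centre. Evaluating a vanishing combination at these two points gives independence.
  let f : ContDiffBump x₀ := ⟨r / 4, r / 3, by linarith, by linarith⟩
  let g : ContDiffBump x₀ := ⟨r / 3, r / 2, by linarith, by linarith⟩
  have hsub : ∀ b : ContDiffBump x₀, b.rOut ≤ r → ∀ x, x ∉ Ω → b x = 0 := fun b hb x hx =>
    b.zero_of_le_dist (hb.trans (not_lt.1 fun h => hx (hrΩ (Metric.mem_ball.2 h))))
  obtain ⟨v, hv⟩ := W.exists_of_contDiff hΩb hu f.contDiff f.hasCompactSupport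
    (hsub f (by simp only [f]; linarith))
  obtain ⟨w, hw⟩ := W.exists_of_contDiff hΩb hu g.contDiff g.hasCompactSupport
    (hsub g (by simp only [g]; linarith))
  refine ⟨v, w, fun x y h => ?_⟩
  have hae : (fun z => x * f z + y * g z) =ᵐ[volume] fun _ => (0 : ℝ) := by
    filter_upwards [W.eq_zero_of_lp_eq_zero h, W.coeFn_add (x • v) (y • w), W.coeFn_smul x v,
      W.coeFn_smul y w, hv, hw] with z h1 h2 h3 h4 h5 h6
    rw [← h5, ← h6, ← h3, ← h4, ← h2, h1]
  have hfc : Continuous fun z => x * f z + y * g z :=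
    (continuous_const.mul f.continuous).add (continuous_const.mul g.continuous)
  have heq := fun z => congrFun ((hfc.ae_eq_iff_eq volume continuous_const).1 hae) z
  have hd : dist (x₀ + EuclideanSpace.single (⟨0, hN⟩ : Fin N) (r / 3)) x₀ = r / 3 := by
    rw [dist_eq_norm, add_sub_cancel_left, PiLp.norm_single,
      Real.norm_of_nonneg (by linarith)]
  have h1 := heq x₀
  have h2 := heq (x₀ + EuclideanSpace.single (⟨0, hN⟩ : Fin N) (r / 3))
  rw [f.zero_of_le_dist (by simp only [f]; exact hd.ge), g.one_of_mem_closedBall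
    (Metric.mem_closedBall.2 hd.le)] at h2
  rw [f.one_of_mem_closedBall (Metric.mem_closedBall_self f.rIn_pos.le), g.one_of_mem_closedBall
    (Metric.mem_closedBall_self g.rIn_pos.le)] at h1
  constructor <;> linarith

end Loop

/-! ### First eigenfunctions are global minimizers -/

section Eigenfunction

variable {N : ℕ} {p : ℝ} {μ : Measure unitInterval} [IsFiniteMeasure μ] {Ω : Set (E N)}
  [Fact (1 ≤ N)] [Fact (1 < p)]

theorem norm_rpow_mul_inner_self {F : Type*} [NormedAddCommGroup F] [InnerProductSpace ℝ F]
    (hp : 1 < p) (a : F) : ‖a‖ ^ (p - 2) * inner ℝ a a = ‖a‖ ^ p := by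
  rcases eq_or_ne a 0 with rfl | ha
  · simp [Real.zero_rpow (by linarith : p ≠ 0)]
  · rw [real_inner_self_eq_norm_sq, ← Real.rpow_natCast, ← Real.rpow_add (norm_pos_iff.2 ha)]
    norm_num

theorem abs_rpow_mul_self (hp : 1 < p) (a : ℝ) : |a| ^ (p - 2) * a * a = |a| ^ p := by
  have h := norm_rpow_mul_inner_self hp a
  rwa [real_inner_self_eq_norm_sq, Real.norm_eq_abs, sq_abs, sq, ← mul_assoc] at h

theorem integral_norm_rpow_eq {α F : Type*} [MeasurableSpace α] {ν : Measure α}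
    [NormedAddCommGroup F] (hp : 1 < p) {f : α → F} (hf : AEStronglyMeasurable f ν) :
    ∫ x, ‖f x‖ ^ p ∂ν = (∫⁻ x, ‖f x‖ₑ ^ p ∂ν).toReal := by
  rw [integral_eq_lintegral_of_nonneg_ae (ae_of_all _ fun x => by positivity)
    (hf.norm.aemeasurable.pow_const p).aestronglyMeasurable]
  simp only [ofReal_norm_rpow hp]

/-- Finiteness of the total is needed because Bochner integrals are `0` when divergent. It makes
almost every seminorm finite, so that real and extended integrals agree. -/
theorem setIntegral_seminormPow (hN : 1 ≤ N) (hp : 1 < p) {u : E N → ℝ} (hu : Measurable u)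
    (h : ∫⁻ s in Ioo (0 : unitInterval) 1, seminormPow p s u ∂μ ≠ ⊤) :
    ∫ s in Ioo (0 : unitInterval) 1, normConst N s p *
      (∫ z : E N × E N, |u z.1 - u z.2| ^ (p - 2) * (u z.1 - u z.2) * (u z.1 - u z.2) /
        ‖z.1 - z.2‖ ^ ((N : ℝ) + s * p)) ∂μ =
      (∫⁻ s in Ioo (0 : unitInterval) 1, seminormPow p s u ∂μ).toReal := by
  have hm : AEMeasurable (fun s => seminormPow p s u) (μ.restrict (Ioo 0 1)) := by
    have h1 : Measurable fun s : unitInterval => ∫⁻ z : E N × E N,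
        ENNReal.ofReal (normConst N s p / ‖z.1 - z.2‖ ^ ((N : ℝ) + s * p)) *
          ‖u z.1 - u z.2‖ₑ ^ p :=
      Measurable.lintegral_prod_right' ((measurable_pairKernel hN hp).mul
        (by fun_prop : Measurable fun q : unitInterval × (E N × E N) => ‖u q.2.1 - u q.2.2‖ₑ ^ p))
    refine ⟨_, h1, ?_⟩
    filter_upwards [ae_restrict_mem measurableSet_Ioo] with s hs
    exact seminormPow_eq_lintegral hN hp hu hs
  rw [← integral_toReal hm (ae_lt_top' hm h)]
  refine setIntegral_congr_fun measurableSet_Ioo fun s hs => ?_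
  have hs1 : ¬ s = 0 := hs.1.ne'
  have hs2 : ¬ s = 1 := hs.2.ne
  simp only [seminormPow, hs1, hs2, if_false, abs_rpow_mul_self hp]
  rw [ENNReal.toReal_mul, ENNReal.toReal_ofReal (normConst_nonneg hN hp s),
    integral_eq_lintegral_of_nonneg_ae (ae_of_all _ fun z => by positivity)
      (Measurable.aestronglyMeasurable (by fun_prop))]

/-- The energy form on the diagonal. -/
theorem W.pairing_self (u : W N p μ Ω) : pairing p μ u.val u.val = ‖u‖ ^ p := by
  have hN : 1 ≤ N := Fact.out
  have hp : 1 < p := Fact.out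
  have hp0 : 0 < p := by linarith
  have hE := u.energy_lt_top
  have hsplit := energy_split hN hp μ u.val.aestronglyMeasurable
  rw [← lintegral_frac_seminormPow hN hp μ u.measurable] at hsplit
  have hE' := hE
  rw [hsplit] at hE'
  obtain ⟨hE1, hE3⟩ := ENNReal.add_lt_top.1 hE'
  obtain ⟨hE0, hE2⟩ := ENNReal.add_lt_top.1 hE1
  have hnorm : ‖u‖ ^ p = (energy p μ u.val).toReal := by
    rw [← W.ofReal_norm_rpow, ENNReal.toReal_ofReal (by positivity)]
  rw [hnorm, hsplit, ENNReal.toReal_add hE1.ne hE3.ne, ENNReal.toReal_add hE0.ne hE2.ne, pairing,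
    setIntegral_seminormPow hN hp u.measurable hE2.ne, ENNReal.toReal_mul, ENNReal.toReal_mul]
  simp only [abs_rpow_mul_self hp, norm_rpow_mul_inner_self hp]
  have h0 : ∫ x, |u.val x| ^ p = (∫⁻ x, ‖u.val x‖ₑ ^ p).toReal :=
    integral_norm_rpow_eq hp u.val.aestronglyMeasurable
  rw [h0, add_comm ((μ {0}).toReal * _)]
  congr 1
  rcases eq_or_ne (μ {1}) 0 with h | h
  · simp [Measure.real, h]
  have hg := u.hasGrad h
  have hex : ∃ g, IsWeakGradient u.val g := ⟨_, hg⟩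
  have haesm : AEStronglyMeasurable (weakGrad u.val) volume :=
    u.memLp_grad.1.congr hg.weakGrad_ae_eq.symm
  simp only [seminormPow, one_ne_zero, if_false, if_true, hex, Superposition.ofReal_norm_rpow hp]
  rw [integral_norm_rpow_eq hp haesm, Measure.real]

theorem setLIntegral_of_mem_M {u : Fun N} (hu : u ∈ M p μ Ω) :
    ∫⁻ x in Ω, ENNReal.ofReal (|u x| ^ p) = 1 := by
  have hp : 1 < p := Fact.out
  simp only [ofReal_abs_rpow hp]
  rw [← eLpNorm_ofReal_rpow (by linarith), hu.2, ENNReal.one_rpow]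

theorem lambda1_le {u : Fun N} (hu : u ∈ M p μ Ω) : lambda1 p μ Ω ≤ xNorm p μ u ^ p := by
  have hp : 1 < p := Fact.out
  have hu0 : u ≠ 0 := by
    rintro rfl
    have h := hu.2
    rw [eLpNorm_congr_ae (ae_restrict_of_ae (AEEqFun.coeFn_zero (β := ℝ))), eLpNorm_zero] at h
    exact zero_ne_one h
  refine (iInf₂_le u ⟨hu.1, hu0⟩).trans ?_
  rw [setLIntegral_of_mem_M hu, div_one]

/-- First eigenfunctions minimize the norm over `𝓜`. -/
theorem IsFirstEigenfunction.norm_le (hΩ : MeasurableSet Ω) {e : Fun N}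
    (he : IsFirstEigenfunction p μ Ω e) (v : W N p μ Ω) (hv : v.lp = 1) :
    ‖W.ofM hΩ e he.1‖ ≤ ‖v‖ := by
  have hp : 1 < p := Fact.out
  have hp0 : 0 < p := by linarith
  -- Testing the equation with `e` identifies its energy with the first eigenvalue, which is a lower
  -- bound on the constraint set.
  have h1 := he.2.2.2 e he.1.1
  have h2 : ∫ x in Ω, |e x| ^ (p - 2) * e x * e x = 1 := by
    simp only [abs_rpow_mul_self hp]
    rw [integral_eq_lintegral_of_nonneg_ae (ae_of_all _ fun z => by positivity)
      (by have := e.stronglyMeasurable.measurable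
          exact Measurable.aestronglyMeasurable (by fun_prop)), setLIntegral_of_mem_M he.1]
    rfl
  rw [h2, mul_one] at h1
  have h3 : ‖W.ofM hΩ e he.1‖ ^ p = (lambda1 p μ Ω).toReal :=
    (W.pairing_self (W.ofM hΩ e he.1)).symm.trans h1
  have h4 := lambda1_le ((W.mem_M_iff hΩ v).2 hv)
  rw [xNorm_rpow hp, ← W.ofReal_norm_rpow] at h4
  refine (Real.rpow_le_rpow_iff (norm_nonneg _) (norm_nonneg _) hp0).1 ?_
  rw [h3]
  exact ENNReal.toReal_le_of_le_ofReal (by positivity) h4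

end Eigenfunction

/-! ### Continuous maps into the constraint set and odd loops -/

section Maps

variable {N : ℕ} {p : ℝ} {μ : Measure unitInterval} [IsFiniteMeasure μ] {Ω : Set (E N)}
  [Fact (1 ≤ N)] [Fact (1 < p)] {T : Type*} [TopologicalSpace T]

theorem W.xNorm_rpow_val (u : W N p μ Ω) : xNorm p μ u.val ^ p = ENNReal.ofReal (‖u‖ ^ p) := by
  rw [xNorm_rpow Fact.out, W.ofReal_norm_rpow]

theorem W.xNorm_rpow_le_iff (u : W N p μ Ω) {L : ℝ} (hL : 0 ≤ L) :
    xNorm p μ u.val ^ p ≤ ENNReal.ofReal (L ^ p) ↔ ‖u‖ ≤ L := by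
  have hp : 1 < p := Fact.out
  rw [W.xNorm_rpow_val, ENNReal.ofReal_le_ofReal_iff (by positivity),
    Real.rpow_le_rpow_iff (norm_nonneg _) hL (by linarith)]

/-- A continuous map into `𝓜`, as a continuous map into `W`. -/
theorem IsContinuousInto.exists_lift (hΩ : MeasurableSet Ω) {φ : T → Fun N}
    (h : IsContinuousInto p μ Ω φ) :
    ∃ f : T → W N p μ Ω, Continuous f ∧ (∀ t, (f t).lp = 1) ∧ ∀ t, (f t).val = φ t := by
  refine ⟨fun t => W.ofM hΩ (φ t) (h.1 t), ?_, fun t => W.ofM_lp hΩ (h.1 t), fun t => rfl⟩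
  refine continuous_iff_continuousAt.2 fun t₀ => tendsto_iff_edist_tendsto_0.2 ?_
  simp only [W.edist_eq]
  exact h.2 t₀

theorem isContinuousInto_val (hΩ : MeasurableSet Ω) {f : T → W N p μ Ω} (hf : Continuous f)
    (h : ∀ t, (f t).lp = 1) : IsContinuousInto p μ Ω fun t => (f t).val := by
  refine ⟨fun t => (W.mem_M_iff hΩ _).2 (h t), fun t₀ => ?_⟩
  have := tendsto_iff_edist_tendsto_0.1 (hf.tendsto t₀)
  simpa only [W.edist_eq] using this

/-- A continuous map from a compact space into `𝓜` attains its maximal energy. -/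
theorem IsContinuousInto.exists_max (hΩ : MeasurableSet Ω) [CompactSpace T] [Nonempty T]
    {φ : T → Fun N} (h : IsContinuousInto p μ Ω φ) :
    ∃ t₀, ∀ t, xNorm p μ (φ t) ^ p ≤ xNorm p μ (φ t₀) ^ p := by
  obtain ⟨f, hf, -, hfφ⟩ := h.exists_lift hΩ
  obtain ⟨t₀, -, ht₀⟩ := isCompact_univ.exists_isMaxOn univ_nonempty hf.norm.continuousOn
  refine ⟨t₀, fun t => ?_⟩
  rw [← hfφ, ← hfφ, W.xNorm_rpow_val (f t₀), W.xNorm_rpow_le_iff _ (norm_nonneg _)]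
  exact ht₀ (mem_univ t)

theorem W.continuous_lp_comb (v w : W N p μ Ω) :
    Continuous fun q : ℝ × ℝ => (q.1 • v + q.2 • w).lp := by
  refine continuous_iff_continuousAt.2 fun q₀ => tendsto_iff_dist_tendsto_zero.2 ?_
  refine squeeze_zero (fun _ => dist_nonneg)
    (g := fun q => |q.1 - q₀.1| * v.lp + |q.2 - q₀.2| * w.lp) (fun q => ?_) ?_
  · refine (W.abs_lp_sub_lp_le _ _).trans ?_
    rw [show q.1 • v + q.2 • w - (q₀.1 • v + q₀.2 • w) =
      (q.1 - q₀.1) • v + (q.2 - q₀.2) • w by module, ← W.lp_smul, ← W.lp_smul]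
    exact W.lp_add_le _ _
  · have : Continuous fun q : ℝ × ℝ => |q.1 - q₀.1| * v.lp + |q.2 - q₀.2| * w.lp := by fun_prop
    simpa using this.tendsto q₀

theorem S1.sq_add_sq (ω : S1) : ω.1 0 ^ 2 + ω.1 1 ^ 2 = 1 := by
  have h : ‖ω.1‖ = 1 := mem_sphere_zero_iff_norm.1 ω.2
  have h2 := EuclideanSpace.real_norm_sq_eq ω.1
  rw [h, Fin.sum_univ_two] at h2
  linarith

theorem S1.continuous_coord (i : Fin 2) : Continuous fun ω : S1 => ω.1 i := by fun_prop

theorem S1.neg_coord (ω : S1) (i : Fin 2) : (-ω).1 i = -ω.1 i := rfl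

theorem oddLoops_nonempty_of_odd (hΩ : MeasurableSet Ω) {F : S1 → W N p μ Ω} (hF : Continuous F)
    (hFlp : Continuous fun ω => (F ω).lp) (hpos : ∀ ω, 0 < (F ω).lp) (hodd : ∀ ω, F (-ω) = -F ω) :
    (oddLoops p μ Ω).Nonempty := by
  have hc : Continuous fun ω => (F ω).lp⁻¹ := hFlp.inv₀ fun ω => (hpos ω).ne'
  have hG : Continuous fun ω => (F ω).lp⁻¹ • F ω := hc.smul hF
  refine ⟨fun ω => ((F ω).lp⁻¹ • F ω).val,
    isContinuousInto_val hΩ hG fun ω => W.lp_normalize (hpos ω), fun ω => ?_⟩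
  simp only [hodd, W.lp_neg, smul_neg, W.val_neg]

theorem oddLoops_nonempty_of_coord (hΩ : MeasurableSet Ω) {v w : W N p μ Ω}
    (h : ∀ x y : ℝ, (x • v + y • w).lp = 0 → x = 0 ∧ y = 0) {c d : S1 → ℝ} (hc : Continuous c)
    (hd : Continuous d) (hcn : ∀ ω, c (-ω) = -c ω) (hdn : ∀ ω, d (-ω) = -d ω)
    (hcd : ∀ ω, c ω ^ 2 + d ω ^ 2 = 1) : (oddLoops p μ Ω).Nonempty := by
  have hG : Continuous fun q : ℝ × ℝ => q.1 • v + q.2 • w := by fun_prop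
  refine oddLoops_nonempty_of_odd hΩ (hG.comp (hc.prodMk hd))
    ((W.continuous_lp_comb v w).comp (hc.prodMk hd)) (fun ω => ?_) fun ω => ?_
  · refine lt_of_le_of_ne (W.lp_nonneg _) fun h0 => ?_
    obtain ⟨h1, h2⟩ := h (c ω) (d ω) h0.symm
    have := hcd ω
    rw [h1, h2] at this
    norm_num at this
  · simp only [Function.comp_apply, hcn, hdn, neg_smul, neg_add]

/-- Normalized combinations of two independent functions form an odd loop. -/
theorem oddLoops_nonempty (hΩ : MeasurableSet Ω) {v w : W N p μ Ω}
    (h : ∀ x y : ℝ, (x • v + y • w).lp = 0 → x = 0 ∧ y = 0) : (oddLoops p μ Ω).Nonempty :=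
  oddLoops_nonempty_of_coord hΩ h (S1.continuous_coord 0) (S1.continuous_coord 1)
    (fun ω => S1.neg_coord ω 0) (fun ω => S1.neg_coord ω 1) S1.sq_add_sq

theorem lambda2_lt_top (hΩ : MeasurableSet Ω) (h : (oddLoops p μ Ω).Nonempty) :
    lambda2 p μ Ω < ⊤ := by
  obtain ⟨φ, hφ⟩ := h
  have : Nonempty S1 := ⟨⟨EuclideanSpace.single 0 1, by simp⟩⟩
  obtain ⟨t₀, ht₀⟩ := hφ.1.exists_max hΩ
  refine (iInf₂_le φ hφ).trans_lt ((iSup_le ht₀).trans_lt ?_)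
  exact ENNReal.rpow_lt_top_of_nonneg (by have : 1 < p := Fact.out; linarith)
    (hφ.1.1 t₀).1.2.ne

/-- A path from `-e` to `e` closes up to an odd loop. -/
theorem lambda2_le_of_path (hΩ : MeasurableSet Ω) {e : Fun N} {φ : Icc (-1 : ℝ) 1 → Fun N}
    (hφ : φ ∈ paths p μ Ω e) : lambda2 p μ Ω ≤ ⨆ t, xNorm p μ (φ t) ^ p := by
  obtain ⟨f, hf, hf1, hfφ⟩ := hφ.1.exists_lift hΩ
  have hends : f ⟨1, by norm_num⟩ = -f ⟨-1, by norm_num⟩ := by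
    refine W.ext ?_
    rw [W.val_neg, hfφ, hfφ, hφ.2.1, hφ.2.2, neg_neg]
  have hmem : ∀ ω : S1, ω.1 0 ∈ Icc (-1 : ℝ) 1 := fun ω =>
    abs_le.1 (abs_le_one_iff_mul_self_le_one.2 (by nlinarith [S1.sq_add_sq ω, sq_nonneg (ω.1 1)]))
  let a : S1 → Icc (-1 : ℝ) 1 := fun ω => ⟨ω.1 0, hmem ω⟩
  have ha : Continuous a := (S1.continuous_coord 0).subtype_mk _
  have ha1 : ∀ ω : S1, ω.1 1 = 0 → f (a ω) = -f (a (-ω)) := by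
    intro ω h
    have h2 := S1.sq_add_sq ω
    rw [h] at h2
    have h3 : ω.1 0 = 1 ∨ ω.1 0 = -1 := sq_eq_one_iff.1 (by linarith)
    rcases h3 with h3 | h3
    · have e1 : a ω = ⟨1, by norm_num⟩ := Subtype.ext h3
      have e2 : a (-ω) = ⟨-1, by norm_num⟩ := Subtype.ext (by simp only [a, S1.neg_coord, h3])
      rw [e1, e2, hends]
    · have e1 : a ω = ⟨-1, by norm_num⟩ := Subtype.ext h3
      have e2 : a (-ω) = ⟨1, by norm_num⟩ :=
        Subtype.ext (by simp only [a, S1.neg_coord, h3, neg_neg])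
      rw [e1, e2, hends, neg_neg]
  -- The path runs over the upper half circle, parametrized by the first coordinate, and its
  -- antipodal image over the lower half. They agree at the two junction points because the
  -- endpoints of the path are opposite.
  let ψ : S1 → W N p μ Ω := fun ω => if 0 ≤ ω.1 1 then f (a ω) else -f (a (-ω))
  have hψ : Continuous ψ := by
    refine Continuous.if_le (hf.comp ha) (hf.comp (ha.comp continuous_neg)).neg continuous_const
      (S1.continuous_coord 1) fun ω h => ha1 ω h.symm
  have hψ1 : ∀ ω, ∃ t, (ψ ω).lp = 1 ∧ ‖ψ ω‖ = ‖f t‖ := by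
    intro ω
    by_cases h : 0 ≤ ω.1 1
    · exact ⟨a ω, by simp only [ψ, h, if_true, hf1], by simp only [ψ, h, if_true]⟩
    · exact ⟨a (-ω), by simp only [ψ, h, if_false, W.lp_neg, hf1],
        by simp only [ψ, h, if_false, norm_neg]⟩
  have hodd : ∀ ω, ψ (-ω) = -ψ ω := by
    intro ω
    rcases lt_trichotomy (ω.1 1) 0 with h | h | h
    · have h1 : ¬ 0 ≤ ω.1 1 := not_le.2 h
      have h2 : 0 ≤ (-ω).1 1 := by rw [S1.neg_coord]; linarith
      simp only [ψ, h1, h2, if_true, if_false, neg_neg]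
    · have h1 : 0 ≤ ω.1 1 := h.ge
      have h2 : 0 ≤ (-ω).1 1 := by rw [S1.neg_coord, h, neg_zero]
      simp only [ψ, h1, h2, if_true, ha1 ω h, neg_neg]
    · have h1 : 0 ≤ ω.1 1 := h.le
      have h2 : ¬ 0 ≤ (-ω).1 1 := by rw [S1.neg_coord]; linarith
      simp only [ψ, h1, h2, if_true, if_false, neg_neg]
  refine (iInf₂_le (fun ω => (ψ ω).val) ⟨isContinuousInto_val hΩ hψ fun ω =>
    (hψ1 ω).choose_spec.1, fun ω => by simp only [hodd, W.val_neg]⟩).trans (iSup_le fun ω => ?_)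
  obtain ⟨t, -, ht⟩ := hψ1 ω
  refine le_iSup_of_le t ?_
  rw [← hfφ, W.xNorm_rpow_val, W.xNorm_rpow_val, ht]

end Maps

/-! ### Joining the first eigenfunctions inside a sublevel set -/

section Main

variable {N : ℕ} {p : ℝ} {μ : Measure unitInterval} [IsFiniteMeasure μ] {Ω : Set (E N)}
  [Fact (1 ≤ N)] [Fact (1 < p)] [Fact (volume Ω ≠ ⊤)]

/-- Up to sign, a minimizer over a component of a sublevel set is joined to a nonnegative one. -/
theorem exists_nonneg_joinedIn_or_neg {u : W N p μ Ω} (hu : u.lp = 1) {L : ℝ} (hL : ‖u‖ < L)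
    (hmin : ∀ v, JoinedIn (sublevel N p μ Ω L) u v → ‖u‖ ≤ ‖v‖) :
    ∃ w : W N p μ Ω, (JoinedIn (sublevel N p μ Ω L) u w ∨ JoinedIn (sublevel N p μ Ω L) (-u) w) ∧
      ‖w‖ ≤ ‖u‖ ∧ ∀ᵐ x, 0 ≤ w.val x := by
  have hp : 1 < p := Fact.out
  by_cases hpos : u.pos.lp = 0
  · have hneg : (-u).pos.lp ≠ 0 := by
      intro hneg
      have h := u.lp_signComb zero_le_one zero_le_one
      rw [u.signComb_one_one, hu, hpos, hneg, Real.zero_rpow (by linarith)] at h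
      simp at h
    obtain ⟨w, h1, h2, h3⟩ := exists_nonneg_joinedIn (u := -u) (by rwa [W.lp_neg])
      (by rwa [norm_neg]) (fun v hv => by
        have := hmin (-v) (by simpa using joinedIn_sublevel_neg hv)
        rwa [norm_neg] at this ⊢) hneg
    exact ⟨w, Or.inr h1, by rwa [norm_neg] at h2, h3⟩
  · obtain ⟨w, h1, h2, h3⟩ := exists_nonneg_joinedIn hu hL hmin hpos
    exact ⟨w, Or.inl h1, h2, h3⟩

/-- If a sublevel set joins some function to its opposite, it joins the first eigenfunctions. -/
theorem joinedIn_neg_of_joinedIn_neg (hΩ : MeasurableSet Ω) (hΩb : Bornology.IsBounded Ω)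
    (sbar : unitInterval) (hs : 0 < sbar) (hμ : 0 < μ (Icc sbar 1)) {u e : W N p μ Ω} {L : ℝ}
    (hu : u.lp = 1) (hL : ‖u‖ < L) (hj : JoinedIn (sublevel N p μ Ω L) u (-u)) (he : e.lp = 1)
    (hmin : ∀ v : W N p μ Ω, v.lp = 1 → ‖e‖ ≤ ‖v‖) : JoinedIn (sublevel N p μ Ω L) (-e) e := by
  have hneg : ∀ {a b : W N p μ Ω}, JoinedIn (sublevel N p μ Ω L) a b →
      JoinedIn (sublevel N p μ Ω L) a (-a) → JoinedIn (sublevel N p μ Ω L) b (-b) :=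
    fun hab ha => (hab.symm.trans ha).trans (joinedIn_sublevel_neg hab)
  obtain ⟨w, hw, hwL, hwmin⟩ := exists_min_joinedIn hΩ hΩb sbar hs hμ hu hL
  obtain ⟨z, hz, hzw, hz0⟩ := exists_nonneg_joinedIn_or_neg hw.target_mem.1 hwL
    fun v hv => hwmin v (hw.trans hv)
  -- Being joined to one's opposite is a property of the component, so it passes to `w`. This is
  -- what allows the sign ambiguity for `z` to be removed on the next line.
  have hww := hneg hw hj
  have hwz : JoinedIn (sublevel N p μ Ω L) w z := hz.elim id fun h => hww.trans h
  -- The eigenfunction is not assumed to have a sign; as a global minimizer it is joined, up to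
  -- sign, to a nonnegative function that is again a global minimizer.
  obtain ⟨e', he', hee', he0⟩ := exists_nonneg_joinedIn_or_neg he ((hmin u hu).trans_lt hL)
    fun v hv => hmin v hv.target_mem.1
  have he'1 : e'.lp = 1 := he'.elim (fun h => h.target_mem.1) fun h => h.target_mem.1
  have hze : JoinedIn (sublevel N p μ Ω L) z e' :=
    (joinedIn_nonneg_minimizer hwz.target_mem.1 he'1 hz0 he0 fun v hv => hee'.trans (hmin v hv)).mono
      (sublevel_mono (hzw.trans hwL.le))
  have hee := hneg hze (hneg hwz hww)
  rcases he' with h | h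
  · exact (hneg h.symm hee).symm
  · simpa using hneg h.symm hee

theorem exists_path_of_joinedIn (hΩ : MeasurableSet Ω) {e : W N p μ Ω} {L : ℝ}
    (h : JoinedIn (sublevel N p μ Ω L) (-e) e) :
    ∃ φ ∈ paths p μ Ω e.val, ∀ t, xNorm p μ (φ t) ^ p ≤ ENNReal.ofReal (L ^ p) := by
  obtain ⟨γ, hγ⟩ := h
  have hL : 0 ≤ L := (norm_nonneg _).trans (hγ 0).2
  let f : Icc (-1 : ℝ) 1 → W N p μ Ω := fun t => γ.extend ((t + 1) / 2)
  have hmem : ∀ t, f t ∈ sublevel N p μ Ω L := fun t => hγ (projIcc 0 1 zero_le_one _)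
  have hf : Continuous f := γ.continuous_extend.comp (by fun_prop)
  refine ⟨fun t => (f t).val, ⟨isContinuousInto_val hΩ hf fun t => (hmem t).1, ?_, ?_⟩,
    fun t => (W.xNorm_rpow_le_iff _ hL).2 (hmem t).2⟩
  · simp [f]
  · simp only [f]
    norm_num

theorem iInf_paths_le_of_oddLoop (hΩ : MeasurableSet Ω) (hΩb : Bornology.IsBounded Ω)
    (sbar : unitInterval) (hs : 0 < sbar) (hμ : 0 < μ (Icc sbar 1)) {e : Fun N}
    (he : IsFirstEigenfunction p μ Ω e) {φ : S1 → Fun N} (hφ : φ ∈ oddLoops p μ Ω) :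
    ⨅ ψ ∈ paths p μ Ω e, ⨆ t, xNorm p μ (ψ t) ^ p ≤ ⨆ ω, xNorm p μ (φ ω) ^ p := by
  have hp : 1 < p := Fact.out
  have hp0 : 0 < p := by linarith
  -- A level strictly above the maximum on the loop leaves the room `‖u‖ < L` needed to reach
  -- minimizers along normalized segments.
  refine le_of_forall_gt_imp_ge_of_dense fun c hc => ?_
  rcases eq_or_ne c ⊤ with rfl | hct
  · exact le_top
  obtain ⟨f, hf, hf1, hfφ⟩ := hφ.1.exists_lift hΩ
  set L : ℝ := c.toReal ^ (1 / p) with hLdef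
  have hLc : ENNReal.ofReal (L ^ p) = c := by
    rw [hLdef, ← Real.rpow_mul ENNReal.toReal_nonneg, one_div_mul_cancel hp0.ne', Real.rpow_one,
      ENNReal.ofReal_toReal hct]
  have hL0 : 0 ≤ L := by positivity
  have hfL : ∀ ω, ‖f ω‖ < L := by
    intro ω
    have h1 : xNorm p μ (f ω).val ^ p < ENNReal.ofReal (L ^ p) := by
      rw [hLc, hfφ]
      exact (le_iSup (fun ω => xNorm p μ (φ ω) ^ p) ω).trans_lt hc
    rw [W.xNorm_rpow_val] at h1
    exact (Real.rpow_lt_rpow_iff (norm_nonneg _) hL0 hp0).1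
      ((ENNReal.ofReal_lt_ofReal_iff_of_nonneg (by positivity)).1 h1)
  have hpc : PathConnectedSpace S1 := isPathConnected_iff_pathConnectedSpace.1
    (isPathConnected_sphere (by rw [rank_eq_card_basis (EuclideanSpace.basisFun (Fin 2) ℝ).toBasis]
                                simp) 0 zero_le_one)
  let ω₀ : S1 := ⟨EuclideanSpace.single 0 1, by simp⟩
  have hodd : f (-ω₀) = -f ω₀ := W.ext (by rw [W.val_neg, hfφ, hfφ, hφ.2])
  have hj : JoinedIn (sublevel N p μ Ω L) (f ω₀) (-f ω₀) := by
    rw [← hodd]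
    exact ⟨(PathConnectedSpace.somePath ω₀ (-ω₀)).map hf, fun t => ⟨hf1 _, (hfL _).le⟩⟩
  have hje := joinedIn_neg_of_joinedIn_neg hΩ hΩb sbar hs hμ (hf1 ω₀) (hfL ω₀) hj
    (W.ofM_lp hΩ he.1) (he.norm_le hΩ)
  obtain ⟨ψ, hψ, hψL⟩ := exists_path_of_joinedIn hΩ hje
  refine (iInf₂_le ψ hψ).trans (iSup_le fun t => ?_)
  rw [← hLc]
  exact hψL t

end Main

end Superposition

end

theorem theorem1p7 (N : ℕ) (hN : 1 ≤ N) (p : ℝ) (hp : 1 < p)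
    (Ω : Set (Superposition.E N)) (hΩ : IsOpen Ω) (hΩb : Bornology.IsBounded Ω)
    (μ : Measure unitInterval) [IsFiniteMeasure μ]
    (sbar : unitInterval) (hs : 0 < sbar) (hμ : 0 < μ (Icc sbar 1))
    (e : Superposition.Fun N) (he : Superposition.IsFirstEigenfunction p μ Ω e) :
    Superposition.lambda2 p μ Ω < ⊤ ∧
    (∀ φ ∈ Superposition.paths p μ Ω e,
      ∃ t₀, ∀ t, Superposition.xNorm p μ (φ t) ^ p ≤ Superposition.xNorm p μ (φ t₀) ^ p) ∧
    Superposition.lambda2 p μ Ω =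
      ⨅ φ ∈ Superposition.paths p μ Ω e, ⨆ t, Superposition.xNorm p μ (φ t) ^ p := by
  have : Fact (1 ≤ N) := ⟨hN⟩
  have : Fact (1 < p) := ⟨hp⟩
  have : Fact (volume Ω ≠ ⊤) := ⟨hΩb.measure_lt_top.ne⟩
  have hm := hΩ.measurableSet
  refine ⟨?_, fun φ hφ => ?_, le_antisymm ?_ ?_⟩
  · obtain ⟨v, w, hvw⟩ := Superposition.W.exists_linearIndependent hΩ hΩb
      (Superposition.W.ofM_lp hm he.1)
    exact Superposition.lambda2_lt_top hm (Superposition.oddLoops_nonempty hm hvw)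
  · have : Nonempty (Icc (-1 : ℝ) 1) := ⟨⟨1, by norm_num⟩⟩
    exact hφ.1.exists_max hm
  · exact le_iInf₂ fun φ hφ => Superposition.lambda2_le_of_path hm hφ
  · exact le_iInf₂ fun φ hφ => Superposition.iInf_paths_le_of_oddLoop hm hΩb sbar hs hμ he hφ
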